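/- Let $(a_n)_{n\ge 0}$ be a complex sequence with $\limsup_n |a_n|^{1/n}>0$ whose generating series $G(z)=\sum_{n\ge0} a_n z^n$ converges in a disk $|z|<\rho$, $\rho>0$. Let $\Lambda\subset\mathbb C$ be a finite set, and suppose that $G$ extends to a multivalued analytic function on $\mathbb C\setminus\Lambda$, i.e. that $G$ can be continued analytically along every path in $\mathbb C\setminus\Lambda$ that starts in the disk $|z|<\rho$. Suppose that this multivalued function has quasi-unipotent local monodromy with moderate growth: for every $p\in\Lambda$, every $\delta>0$ such that no other point of $\Lambda$ lies in $|z-p|<\delta$, and every branch $F$ of it on the universal covering of the punctured disk $0<|z-p|<\delta$, * the continuations of $F$ around $p$ span a finite-dimensional vector space, and all eigenvalues of the local monodromy (continuation once around $p$) on this space are roots of unity; * for every $A>0$ there are real constants $C,K$ and $\varepsilon>0$ with $|F(z)|\le C|z-p|^{-K}$ for $0<|z-p|<\varepsilon$, $|\arg(z-p)|\le A$. Then $(a_n)$ is a sequence of Nilsson type. That is, there are a finite set $S\subset\mathbb Q$, a natural number $d$, a real $r>0$, a finite set $M$ of complex numbers of absolute value $r$, and complex numbers $c_{\omega,\mu}$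 for $\omega\in\Omega=(S+\mathbb N)\times\{0,1,\dots,d\}$, $\mu\in M$, not all zero, such that, with $h_{\omega}(n)=(\log n)^{\beta}n^{-\alpha}$ for $\omega=(\alpha,\beta)$, and with $\Omega$ ordered by $(\alpha,\beta)<(\alpha',\beta')$ if and only if $\alpha<\alpha'$, or $\alpha=\alpha'$ and $\beta>\beta'$, for every $\omega\in\Omega$ $$\lim_{n\to\infty}\frac{1}{h_\omega(n)}\Bigl(a_n r^{-n}-\sum_{\omega'\le\omega}h_{\omega'}(n)\sum_{\mu\in M}c_{\omega',\mu}\,(\mu r^{-1})^n\Bigr)=0 .$$ -/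

import Mathlib

open Filter Topology
open scoped ENNReal

/-! ### Sequences of Nilsson type -/

/-- The index set `Ω = (S + ℕ) × {0, …, d}`. -/
def nilssonIndex (S : Finset ℚ) (d : ℕ) : Set (ℚ × ℕ) :=
  {ω | (∃ s ∈ S, ∃ k : ℕ, ω.1 = s + k) ∧ ω.2 ≤ d}

/-- The order on `Ω`: `(α', β') ≤ (α, β)` iff `α' < α`, or `α' = α` and `β ≤ β'`. -/
def NilssonLE (ω' ω : ℚ × ℕ) : Prop :=
  ω'.1 < ω.1 ∨ (ω'.1 = ω.1 ∧ ω.2 ≤ ω'.2)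

/-- Initial segments of `Ω` are finite. -/
theorem nilssonInitial_finite (S : Finset ℚ) (d : ℕ) (ω : ℚ × ℕ) :
    {ω' ∈ nilssonIndex S d | NilssonLE ω' ω}.Finite := by
  have h : (⋃ s ∈ S, (fun p : ℕ × ℕ => (s + (p.1 : ℚ), p.2)) ''
      ((Finset.range (⌊ω.1 - s⌋₊ + 1) ×ˢ Finset.range (d + 1) : Finset (ℕ × ℕ)) :
        Set (ℕ × ℕ))).Finite :=
    Set.Finite.biUnion S.finite_toSet fun s _ => (Finset.finite_toSet _).image _
  refine h.subset ?_
  rintro ⟨α, β⟩ ⟨⟨⟨s, hs, k, hk⟩, hβ⟩, hle⟩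
  simp only at hk hβ
  have hα : α ≤ ω.1 := by
    rcases hle with h1 | h1
    · exact h1.le
    · exact h1.1.le
  simp only [Set.mem_iUnion]
  refine ⟨s, hs, (k, β), ?_, by simp [hk]⟩
  have : k ≤ ⌊ω.1 - s⌋₊ := Nat.le_floor (by linarith)
  simp only [Finset.coe_product, Finset.coe_range, Set.mem_prod, Set.mem_Iio]
  omega

/-- The finite set of all `ω' ∈ Ω` with `ω' ≤ ω`. -/
noncomputable def nilssonInitial (S : Finset ℚ) (d : ℕ) (ω : ℚ × ℕ) : Finset (ℚ × ℕ) :=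
  (nilssonInitial_finite S d ω).toFinset

/-- The monomial `h_ω(n) = (log n)^β / n^α`, where `ω = (α, β)`. -/
noncomputable def nilssonMonomial (ω : ℚ × ℕ) (n : ℕ) : ℝ :=
  Real.log n ^ ω.2 / (n : ℝ) ^ (ω.1 : ℝ)

/-- The asymptotic expansion `a_n ∼ ∑_{ω ∈ Ω} h_ω(n) ∑_{μ ∈ Λ} c_{ω,μ} μ^n`, where all elements of
`Λ` have magnitude `r`; only the values of `c` on `Ω × Λ` play a role. -/
def HasNilssonExpansion (a : ℕ → ℂ) (S : Finset ℚ) (d : ℕ) (Λ : Finset ℂ) (r : ℝ)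
    (c : ℚ × ℕ → ℂ → ℂ) : Prop :=
  (∀ ω ∈ nilssonIndex S d,
    Tendsto (fun n : ℕ =>
      (a n * ((r : ℂ)⁻¹) ^ n -
        ∑ ω' ∈ nilssonInitial S d ω,
          (nilssonMonomial ω' n : ℂ) * ∑ μ ∈ Λ, c ω' μ * (μ * (r : ℂ)⁻¹) ^ n) *
        (1 / (nilssonMonomial ω n : ℂ))) atTop (𝓝 0)) ∧
  ∃ ω ∈ nilssonIndex S d, ∃ μ ∈ Λ, c ω μ ≠ 0

/-- A sequence is of Nilsson type if it has an asymptotic expansion as above for some `Ω`, some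
finite set `Λ` of complex numbers of equal magnitude `r > 0` and some coefficients. -/
def IsNilssonType (a : ℕ → ℂ) : Prop :=
  ∃ (S : Finset ℚ) (d : ℕ) (Λ : Finset ℂ) (r : ℝ) (c : ℚ × ℕ → ℂ → ℂ),
    0 < r ∧ (∀ μ ∈ Λ, ‖μ‖ = r) ∧ HasNilssonExpansion a S d Λ r c

/-! ### Multivalued analytic functions on the complement of a finite set -/

/-- `f` is an analytic continuation along the path `γ : [0, 1] → ℂ`: each `f t` represents a germ
of an analytic function at `γ t`, and for `s` close to `t` the germ of `f s` at `γ s` is the one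
given by `f t`. -/
def IsContinuationAlong (γ : ℝ → ℂ) (f : ℝ → ℂ → ℂ) : Prop :=
  ∀ t ∈ Set.Icc (0 : ℝ) 1, AnalyticAt ℂ (f t) (γ t) ∧
    ∀ᶠ s in 𝓝[Set.Icc (0 : ℝ) 1] t, f s =ᶠ[𝓝 (γ s)] f t

/-- `γ` restricts to a continuous path `[0, 1] → ℂ ∖ Λ` starting in the disk of radius `ρ` around
the origin. -/
def IsAdmissiblePath (Λ : Finset ℂ) (ρ : ℝ) (γ : ℝ → ℂ) : Prop :=
  ContinuousOn γ (Set.Icc 0 1) ∧ γ 0 ∈ Metric.ball (0 : ℂ) ρ ∧ ∀ t ∈ Set.Icc (0 : ℝ) 1, γ t ∉ Λ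

/-- `G`, given on the disk of radius `ρ` around the origin, extends to a multivalued analytic
function on `ℂ ∖ Λ`: it can be continued analytically along every path in `ℂ ∖ Λ` that starts in
the disk. -/
def ExtendsMultivalued (Λ : Finset ℂ) (ρ : ℝ) (G : ℂ → ℂ) : Prop :=
  ∀ γ : ℝ → ℂ, IsAdmissiblePath Λ ρ γ →
    ∃ f : ℝ → ℂ → ℂ, IsContinuationAlong γ f ∧ f 0 =ᶠ[𝓝 (γ 0)] G

/-- `φ` represents, near `z`, a branch of the multivalued function obtained from `G`. -/
def IsBranchAt (Λ : Finset ℂ) (ρ : ℝ) (G : ℂ → ℂ) (z : ℂ) (φ : ℂ → ℂ) : Prop :=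
  ∃ (γ : ℝ → ℂ) (f : ℝ → ℂ → ℂ), IsAdmissiblePath Λ ρ γ ∧ IsContinuationAlong γ f ∧
    f 0 =ᶠ[𝓝 (γ 0)] G ∧ γ 1 = z ∧ f 1 =ᶠ[𝓝 z] φ

/-! ### Local monodromy -/

/-- The half-plane `Re w < log δ`; through `w ↦ p + exp w` it is the universal covering of the
punctured disk `0 < |z - p| < δ`. -/
def logHalfPlane (δ : ℝ) : Set ℂ := {w | w.re < Real.log δ}

/-- The deck transformation `w ↦ w + 2πik` of the half-plane. -/
noncomputable def logShift (δ : ℝ) (k : ℤ) (w : logHalfPlane δ) : logHalfPlane δ :=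
  ⟨(w : ℂ) + k * (2 * Real.pi * Complex.I), by
    have hw := w.2
    simp only [logHalfPlane, Set.mem_ofPred_eq] at hw ⊢
    simpa using hw⟩

/-- The local monodromy: continuation once around the puncture, counterclockwise, acting on
functions on the universal covering of the punctured disk. -/
noncomputable def localMonodromy (δ : ℝ) : Module.End ℂ (logHalfPlane δ → ℂ) :=
  LinearMap.funLeft ℂ ℂ (logShift δ 1)

/-- `F` is a branch, near the point `p`, of the multivalued function obtained from `G`, written
in the coordinate `w = log (z - p)` on the universal covering of the punctured disk
`0 < |z - p| < δ`. -/
def IsLocalBranch (Λ : Finset ℂ) (ρ : ℝ) (G : ℂ → ℂ) (p : ℂ) (δ : ℝ) (F : ℂ → ℂ) : Prop :=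
  DifferentiableOn ℂ F (logHalfPlane δ) ∧
    ∃ w₀ ∈ logHalfPlane δ, ∃ φ : ℂ → ℂ, IsBranchAt Λ ρ G (p + Complex.exp w₀) φ ∧
      F =ᶠ[𝓝 w₀] fun w => φ (p + Complex.exp w)

/-- The space spanned by all continuations of `F` around the puncture. -/
noncomputable def determinations (δ : ℝ) (F : ℂ → ℂ) : Submodule ℂ (logHalfPlane δ → ℂ) :=
  Submodule.span ℂ (Set.range fun (k : ℤ) (w : logHalfPlane δ) => F (logShift δ k w))

/-- `F` has finite determination, and all eigenvalues of the local monodromy on the space spanned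
by its continuations are roots of unity. -/
def IsQuasiUnipotent (δ : ℝ) (F : ℂ → ℂ) : Prop :=
  FiniteDimensional ℂ (determinations δ F) ∧
    ∀ (μ : ℂ), ∀ v ∈ determinations δ F, v ≠ 0 → localMonodromy δ v = μ • v →
      ∃ N : ℕ, 0 < N ∧ μ ^ N = 1

/-- Moderate growth at the puncture: on every sector `|arg (z - p)| ≤ A` the function is bounded
by `C |z - p|^(-K)` for `z` close to `p`. -/
def HasModerateGrowth (δ : ℝ) (F : ℂ → ℂ) : Prop :=
  ∀ A : ℝ, ∃ C K ε : ℝ, 0 < ε ∧ ε ≤ δ ∧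
    ∀ w ∈ logHalfPlane ε, |w.im| ≤ A → ‖F w‖ ≤ C * Real.exp (-K * w.re)

/-- Quasi-unipotent local monodromy (at singularities of moderate growth): for every `p ∈ Λ` and
every punctured disk around `p` that contains no point of `Λ`, each branch there is
quasi-unipotent and of moderate growth. -/
def HasQuasiUnipotentLocalMonodromy (Λ : Finset ℂ) (ρ : ℝ) (G : ℂ → ℂ) : Prop :=
  ∀ p ∈ Λ, ∀ δ : ℝ, 0 < δ → (∀ q ∈ Λ, q ∈ Metric.ball p δ → q = p) →
    ∀ F : ℂ → ℂ, IsLocalBranch Λ ρ G p δ F → IsQuasiUnipotent δ F ∧ HasModerateGrowth δ F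

/-! ### Linear recurrences with an analytic multiplier -/

section Recurrence

open Asymptotics

/-! The proof is Darboux's method on the circle of convergence. The condition on the limsup makes
the radius of convergence `R` finite. After rescaling to `R = 1`, the sum `g` of the series extends
analytically across every point of the unit circle outside a finite set `Z`, which comes from `Λ`.

Near `ζ ∈ Z` put `u = 1 - z / ζ` and `w = log u`. In the coordinate `w` the function lives on a left
half-plane, and a turn around `ζ` is the translation by `2πi`. Finite determination with roots of
unity as eigenvalues means that some power of the difference operator with step `2πiN` kills the
function (`IsQuasiUnipotent.exists_fwdDiff_eq_zero`). Hence it is a polynomial in `w` with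
`2πiN`-periodic coefficients (`exists_periodic_decomposition`), and moderate growth turns each
coefficient into a Laurent series in `exp (w / N)` with finite principal part
(`exists_analyticAt_of_periodic`). So near `ζ` the function `g` is a finite sum of powers of `log u`
times convergent Puiseux series in `u`, with exponents `(j - M) / N`.

Subtract, at all `ζ` at once, the terms with `j < J`. If `(J - M) / N > D`, the remainder has a
bounded derivative of order `D` on the disk, so its coefficients are `O(n^(-D))` by Cauchy's
estimate (`exists_darboux_expansion`). This leaves the coefficients of `u^s (log u)^k`
(`exists_logCoeff_expansion`). Up to the factor `k!` they are the `ε^k`-parts of the coefficients of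
`(1 - z)^(s + ε)` over `ℂ[ε] / (ε^(k+1))`. Multiplied by `n^(1 + s + ε)`, the latter satisfy `u (n +
1) = χ (1 / n) * u n` with `χ y = 1 + O(y^2)`, and such sequences have an expansion in powers of `1
/ n` (`exists_expansion_of_recurrence`). The factor `n^(-ε)` then produces the powers of `log n`.

The expansion is not identically zero because the passage from local terms to asymptotic terms is
triangular (`grid_coeff_ne_zero`): `u^s (log u)^k` has leading term `n^(-s-1) (log n)^k`, except for
`s ∈ ℕ`, where the leading power is `(log n)^(k-1)`, and where nothing at all remains if `k = 0`. If
all coefficients vanished, only terms `u^i` with `i ∈ ℕ` and no logarithm could occur at each `ζ`.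
Then `g` would extend across the whole circle and the series would converge beyond it
(`exists_summable_of_analytic_extension`). -/

theorem exists_seq_of_step {α : Type*} (P : ℕ → (ℕ → α) → Prop)
    (hcongr : ∀ I f g, (∀ i < I, f i = g i) → P I f → P I g) (f₀ : ℕ → α) (h0 : P 0 f₀)
    (hs : ∀ I f, P I f → ∃ c, P (I + 1) (Function.update f I c)) : ∃ f, ∀ I, P I f := by
  have : Nonempty α := ⟨f₀ 0⟩
  choose! c hc using hs
  let F : ℕ → ℕ → α := fun I => Nat.rec f₀ (fun I f => Function.update f I (c I f)) I
  have hF : ∀ I, P I (F I) := by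
    intro I
    induction I with
    | zero => exact h0
    | succ I ih => exact hc I _ ih
  have hst : ∀ i J, i < J → F J i = F (i + 1) i := by
    intro i J hJ
    induction J with
    | zero => omega
    | succ J ih =>
      rcases Nat.lt_succ_iff_lt_or_eq.mp hJ with h | h
      · rw [← ih h]
        exact Function.update_of_ne h.ne _ _
      · rw [h]
  -- Entry `i` is final after step `i`, so the diagonal agrees with `F I` on all indices below `I`.
  exact ⟨fun i => F (i + 1) i, fun I => hcongr I _ _ (fun i hi => hst i I hi) (hF I)⟩

theorem AnalyticAt.exists_eq_smul_of_eq_zero {E : Type*} [NormedAddCommGroup E] [NormedSpace ℂ E]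
    {G : ℂ → E} (hG : AnalyticAt ℂ G 0) (h0 : G 0 = 0) :
    ∃ g : ℂ → E, AnalyticAt ℂ g 0 ∧ ∀ y, G y = y • g y := by
  obtain ⟨p, hp⟩ := hG
  refine ⟨dslope G 0, (HasFPowerSeriesAt.has_fpower_series_dslope_fslope hp).analyticAt, fun y => ?_⟩
  have := sub_smul_dslope G 0 y
  simpa [h0] using this.symm

/-- Discrete version of `∫ x^(-i-1) dx = -x^(-i) / i`: it bounds a term of a convergent series by a
telescoping difference. -/
theorem inv_pow_succ_le_sub (n i : ℕ) (hn : 1 ≤ n) (hi : 1 ≤ i) :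
    ((n : ℝ) ^ (i + 1))⁻¹ ≤ 2 ^ i * (((n : ℝ) ^ i)⁻¹ - (((n + 1 : ℕ) : ℝ) ^ i)⁻¹) := by
  have hn0 : (1 : ℝ) ≤ n := by exact_mod_cast hn
  obtain ⟨j, rfl⟩ : ∃ j, i = j + 1 := ⟨i - 1, by omega⟩
  have h1 : (n : ℝ) ^ (j + 1) + n ^ j ≤ ((n + 1 : ℕ) : ℝ) ^ (j + 1) := by
    have : (n : ℝ) ^ j ≤ ((n + 1 : ℕ) : ℝ) ^ j := by gcongr; omega
    rw [pow_succ, pow_succ]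
    push_cast at this ⊢
    nlinarith
  have h2 : ((n + 1 : ℕ) : ℝ) ^ (j + 1) ≤ 2 ^ (j + 1) * n ^ (j + 1) := by
    rw [← mul_pow]
    gcongr
    push_cast
    linarith
  have hpos : (0 : ℝ) < n := by linarith
  set b := ((n + 1 : ℕ) : ℝ) ^ (j + 1) with hb
  have hbpos : 0 < b := by positivity
  have key : ((n : ℝ) ^ (j + 1))⁻¹ - b⁻¹ = (b - n ^ (j + 1)) / (n ^ (j + 1) * b) := by
    field_simp
  rw [key]
  rw [← mul_div_assoc, le_div_iff₀ (by positivity), pow_succ (n : ℝ) (j + 1), mul_inv]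
  have : ((n : ℝ) ^ (j + 1))⁻¹ * (n : ℝ)⁻¹ * (n ^ (j + 1) * b) = b / n := by
    field_simp
  rw [this, div_le_iff₀ hpos]
  calc b ≤ 2 ^ (j + 1) * n ^ (j + 1) := h2
    _ = 2 ^ (j + 1) * n ^ j * n := by ring
    _ ≤ 2 ^ (j + 1) * (b - n ^ (j + 1)) * n := by gcongr; linarith

/-- A null sequence is minus the sum of its later differences, and summing a tail of `n^(-i-1)`
costs one power of `n`. -/
theorem isBigO_inv_pow_of_sub {E : Type*} [NormedAddCommGroup E] {w : ℕ → E} {i : ℕ}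
    (hi : 1 ≤ i) (h0 : Tendsto w atTop (𝓝 0))
    (h : (fun n => w (n + 1) - w n) =O[atTop] fun n => ((n : ℝ) ^ (i + 1))⁻¹) :
    w =O[atTop] fun n => ((n : ℝ) ^ i)⁻¹ := by
  obtain ⟨C, hC0, hC⟩ := h.exists_nonneg
  obtain ⟨n0, hn0⟩ := eventually_atTop.mp hC.bound
  refine IsBigO.of_bound (C * 2 ^ i) (eventually_atTop.mpr ⟨max n0 1, fun n hn => ?_⟩)
  have hn0' : n0 ≤ n := le_trans (le_max_left _ _) hn
  have hn1 : 1 ≤ n := le_trans (le_max_right _ _) hn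
  have key : ∀ k : ℕ, ‖w (n + k) - w n‖ ≤
      C * 2 ^ i * (((n : ℝ) ^ i)⁻¹ - (((n + k : ℕ) : ℝ) ^ i)⁻¹) := by
    intro k
    induction k with
    | zero => simp
    | succ k ih =>
      have h1 := hn0 (n + k) (by omega)
      have h2 := inv_pow_succ_le_sub (n + k) i (by omega) hi
      rw [Real.norm_of_nonneg (by positivity)] at h1
      calc ‖w (n + (k + 1)) - w n‖
          = ‖(w (n + k + 1) - w (n + k)) + (w (n + k) - w n)‖ := by rw [← add_assoc]; congr 1; abel
        _ ≤ _ := norm_add_le _ _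
        _ ≤ C * (2 ^ i * ((((n + k : ℕ) : ℝ) ^ i)⁻¹ - (((n + k + 1 : ℕ) : ℝ) ^ i)⁻¹)) +
            C * 2 ^ i * (((n : ℝ) ^ i)⁻¹ - (((n + k : ℕ) : ℝ) ^ i)⁻¹) := by
          gcongr
          exact h1.trans (by gcongr)
        _ = _ := by rw [← add_assoc]; ring
  have hlim : Tendsto (fun k => ‖w (n + k) - w n‖) atTop (𝓝 ‖0 - w n‖) := by
    refine ((Tendsto.sub_const ?_ _)).norm
    have := h0.comp (tendsto_add_atTop_nat n)
    simpa [Function.comp_def, add_comm] using this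
  rw [zero_sub, norm_neg] at hlim
  rw [Real.norm_of_nonneg (by positivity)]
  refine le_of_tendsto' hlim fun k => (key k).trans ?_
  gcongr
  have : 0 ≤ (((n + k : ℕ) : ℝ) ^ i)⁻¹ := by positivity
  linarith

variable {A : Type*} [NormedCommRing A]

/-- A discrete Gronwall inequality: the factors `1 + ‖a n‖` have a convergent product. -/
theorem isBigO_one_of_sub_eq_mul {u a : ℕ → A}
    (hu : ∀ᶠ n in atTop, u (n + 1) - u n = a n * u n)
    (ha : a =O[atTop] fun n => ((n : ℝ) ^ 2)⁻¹) :
    u =O[atTop] fun _ => (1 : ℝ) := by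
  obtain ⟨C, hC0, hC⟩ := ha.exists_nonneg
  obtain ⟨n0, hn0⟩ := eventually_atTop.mp (hC.bound.and (hu.and (eventually_ge_atTop 1)))
  -- The weighted norm `‖u n‖ exp (2C / n)` is nonincreasing, because `C / n^2 ≤ 2C / n - 2C / (n +
  -- 1)`.
  have key : ∀ k : ℕ, ‖u (n0 + k)‖ * Real.exp (2 * C / ((n0 + k : ℕ) : ℝ)) ≤
      ‖u n0‖ * Real.exp (2 * C / (n0 : ℝ)) := by
    intro k
    induction k with
    | zero => simp
    | succ k ih =>
      refine le_trans ?_ ih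
      obtain ⟨h1, h2, h3⟩ := hn0 (n0 + k) (by omega)
      set n := n0 + k with hn
      have hnp : (1 : ℝ) ≤ n := by exact_mod_cast h3
      rw [Real.norm_of_nonneg (by positivity)] at h1
      have h4 : ‖u (n + 1)‖ ≤ (1 + C * ((n : ℝ) ^ 2)⁻¹) * ‖u n‖ := by
        have : u (n + 1) = u n + a n * u n := by rw [← h2]; abel
        rw [this]
        calc _ ≤ ‖u n‖ + ‖a n‖ * ‖u n‖ := (norm_add_le _ _).trans (by gcongr; exact norm_mul_le _ _)
          _ ≤ ‖u n‖ + C * ((n : ℝ) ^ 2)⁻¹ * ‖u n‖ := by gcongr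
          _ = _ := by ring
      have h5 : C * ((n : ℝ) ^ 2)⁻¹ + 2 * C / ((n + 1 : ℕ) : ℝ) ≤ 2 * C / (n : ℝ) := by
        have := inv_pow_succ_le_sub n 1 h3 le_rfl
        simp only [pow_one] at this
        calc _ ≤ C * (2 * ((n : ℝ)⁻¹ - (((n + 1 : ℕ) : ℝ))⁻¹)) + 2 * C / ((n + 1 : ℕ) : ℝ) := by
              gcongr
          _ = _ := by ring
      calc ‖u (n + 1)‖ * Real.exp (2 * C / ((n + 1 : ℕ) : ℝ))
          ≤ (1 + C * ((n : ℝ) ^ 2)⁻¹) * ‖u n‖ * Real.exp (2 * C / ((n + 1 : ℕ) : ℝ)) := by gcongr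
        _ ≤ Real.exp (C * ((n : ℝ) ^ 2)⁻¹) * ‖u n‖ * Real.exp (2 * C / ((n + 1 : ℕ) : ℝ)) := by
            gcongr
            rw [add_comm]
            exact Real.add_one_le_exp _
        _ = ‖u n‖ * Real.exp (C * ((n : ℝ) ^ 2)⁻¹ + 2 * C / ((n + 1 : ℕ) : ℝ)) := by
            rw [Real.exp_add]; ring
        _ ≤ _ := by gcongr
  refine IsBigO.of_bound (‖u n0‖ * Real.exp (2 * C / (n0 : ℝ)))
    (eventually_atTop.mpr ⟨n0, fun n hn => ?_⟩)
  obtain ⟨k, rfl⟩ := Nat.exists_eq_add_of_le hn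
  simp only [norm_one, mul_one]
  refine le_trans ?_ (key k)
  refine le_mul_of_one_le_right (norm_nonneg _) (Real.one_le_exp (by positivity))

theorem exists_tendsto_of_sub_eq_mul [CompleteSpace A] {u a : ℕ → A}
    (hu : ∀ᶠ n in atTop, u (n + 1) - u n = a n * u n)
    (ha : a =O[atTop] fun n => ((n : ℝ) ^ 2)⁻¹) : ∃ L, Tendsto u atTop (𝓝 L) := by
  have hb : (fun n => u (n + 1) - u n) =O[atTop] fun n => ((n : ℝ) ^ 2)⁻¹ := by
    have := ha.mul (isBigO_one_of_sub_eq_mul hu ha)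
    simp only [mul_one] at this
    exact this.congr' (hu.mono fun n hn => hn.symm) EventuallyEq.rfl
  refine cauchySeq_tendsto_of_complete (cauchySeq_of_summable_dist ?_)
  have hs : Summable fun n : ℕ => ((n : ℝ) ^ 2)⁻¹ := Real.summable_nat_pow_inv.mpr one_lt_two
  have := summable_of_isBigO_nat hs hb.norm_left
  refine this.congr fun n => ?_
  rw [dist_comm, dist_eq_norm]

/-- The reciprocals satisfy a recurrence of the same kind, so they converge too, and the product of
the two limits is `1`. -/
theorem ne_zero_of_tendsto_of_sub_eq_mul {u a : ℕ → ℂ} {L : ℂ}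
    (hu : ∀ᶠ n in atTop, u (n + 1) - u n = a n * u n)
    (ha : a =O[atTop] fun n => ((n : ℝ) ^ 2)⁻¹) (hne : ∀ᶠ n in atTop, u n ≠ 0)
    (hL : Tendsto u atTop (𝓝 L)) : L ≠ 0 := by
  have ha0 : Tendsto a atTop (𝓝 0) := ha.trans_tendsto (by
    have := tendsto_inv_atTop_nhds_zero_nat (𝕜 := ℝ)
    simpa using this.pow 2)
  have hinv : Tendsto (fun n => (1 + a n)⁻¹) atTop (𝓝 1) := by
    have : Tendsto (fun n => (1 + a n)⁻¹) atTop (𝓝 (1 + 0)⁻¹) :=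
      (ha0.const_add 1).inv₀ (by simp)
    simpa using this
  have hb : (fun n => -a n * (1 + a n)⁻¹) =O[atTop] fun n => ((n : ℝ) ^ 2)⁻¹ := by
    simpa using ha.neg_left.mul (hinv.isBigO_one ℝ)
  obtain ⟨L', hL'⟩ := exists_tendsto_of_sub_eq_mul (u := fun n => (u n)⁻¹)
    (a := fun n => -a n * (1 + a n)⁻¹) (by
      filter_upwards [hu, hne, (tendsto_add_atTop_nat 1).eventually hne] with n h1 h2 h3
      have h4 : u (n + 1) = (1 + a n) * u n := by linear_combination h1
      have h5 : 1 + a n ≠ 0 := fun h => h3 (by rw [h4, h, zero_mul])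
      rw [h4]
      field_simp
      ring) hb
  intro h0
  have h1 : Tendsto (fun n => u n * (u n)⁻¹) atTop (𝓝 (L * L')) := hL.mul hL'
  have h2 : Tendsto (fun n => u n * (u n)⁻¹) atTop (𝓝 1) :=
    tendsto_const_nhds.congr' (hne.mono fun n hn => (mul_inv_cancel₀ hn).symm)
  have := tendsto_nhds_unique h1 h2
  simp [h0] at this

/-! ### Formal and asymptotic solutions of the recurrence. -/

variable [NormedAlgebra ℂ A]

/-- For `y = 1 / n` one has `y / (1 + y) = 1 / (n + 1)`, so this solves the recurrence by a formal
power series in `1 / n`. A new term `c y^(I+1)` changes the error at order `y^(I+2)` by `-(I + 1)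
c`, and this can be solved for `c`. -/
theorem exists_formal_solution {χ h : ℂ → A} (hh : AnalyticAt ℂ h 0)
    (hχ : ∀ᶠ y in 𝓝 0, χ y = 1 + y ^ 2 • h y) :
    ∃ f : ℕ → A, ∀ I : ℕ, ∃ g : ℂ → A, AnalyticAt ℂ g 0 ∧ ∀ᶠ y in 𝓝 (0 : ℂ),
      (1 + ∑ i ∈ Finset.range I, (y / (1 + y)) ^ (i + 1) • f i) -
        χ y * (1 + ∑ i ∈ Finset.range I, y ^ (i + 1) • f i) = y ^ (I + 2) • g y := by
  refine exists_seq_of_step _ ?_ (fun _ => 0) ?_ ?_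
  · rintro I f f' hf ⟨g, hg, h⟩
    refine ⟨g, hg, h.mono fun y hy => ?_⟩
    rw [← hy]
    have e1 : ∀ z : ℂ, ∑ i ∈ Finset.range I, z ^ (i + 1) • f' i =
        ∑ i ∈ Finset.range I, z ^ (i + 1) • f i := fun z =>
      Finset.sum_congr rfl fun i hi => by rw [hf i (Finset.mem_range.mp hi)]
    rw [e1, e1]
  · refine ⟨fun y => -h y, hh.neg, hχ.mono fun y hy => ?_⟩
    simp [hy]
  · rintro I f ⟨g, hg, hE⟩
    -- Here `(1 + y)^(-(I+1)) = 1 + y k(y)`, and `k 0 = -(I + 1)` is the number by which one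
    -- divides.
    obtain ⟨k, hk, hk'⟩ := AnalyticAt.exists_eq_smul_of_eq_zero
      (G := fun y : ℂ => ((1 + y)⁻¹) ^ (I + 1) - 1)
      (((analyticAt_const.add analyticAt_id).inv (by simp)).pow _ |>.sub analyticAt_const) (by simp)
    have hk0 : k 0 = -((I : ℂ) + 1) := by
      have h1 : HasDerivAt (fun y : ℂ => ((1 + y)⁻¹) ^ (I + 1) - 1) (-((I : ℂ) + 1)) 0 := by
        have h2 : HasDerivAt (fun y : ℂ => (1 + y)⁻¹) (-1 / (1 + 0) ^ 2) 0 :=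
          ((hasDerivAt_id (0 : ℂ)).const_add 1).inv (by simp)
        have h3 := (h2.pow (I + 1)).sub_const 1
        refine h3.congr_deriv ?_
        simp
        try ring
      have h4 : HasDerivAt (fun y : ℂ => y • k y) (k 0) 0 := by
        have := (hasDerivAt_id (0 : ℂ)).smul hk.differentiableAt.hasDerivAt
        refine this.congr_deriv ?_
        simp
      exact h4.unique (h1.congr_of_eventuallyEq (Eventually.of_forall fun y => (hk' y).symm))
    -- This choice makes the new error term vanish at `0`, so that one more factor `y` can be split
    -- off.
    set c : A := ((I : ℂ) + 1)⁻¹ • g 0 with hc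
    have hI : (I : ℂ) + 1 ≠ 0 := by exact_mod_cast Nat.succ_ne_zero I
    obtain ⟨g', hg', hg''⟩ := AnalyticAt.exists_eq_smul_of_eq_zero
      (G := fun y : ℂ => g y + k y • c - y • (h y * c))
      ((hg.add (hk.smul analyticAt_const)).sub (analyticAt_id.smul (hh.mul analyticAt_const)))
      (by simp only [hk0, hc, smul_smul, neg_mul, mul_inv_cancel₀ hI]; simp)
    refine ⟨c, g', hg', ?_⟩
    filter_upwards [hE, hχ] with y hy hy2
    rw [Finset.sum_range_succ, Finset.sum_range_succ, Function.update_self]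
    have e1 : ∀ z : ℂ, ∑ x ∈ Finset.range I, z ^ (x + 1) • Function.update f I c x =
        ∑ x ∈ Finset.range I, z ^ (x + 1) • f x := fun z => Finset.sum_congr rfl fun i hi => by
      rw [Function.update_of_ne (Finset.mem_range.mp hi).ne]
    rw [e1, e1]
    have h1 : (y / (1 + y)) ^ (I + 1) = y ^ (I + 1) + y ^ (I + 2) * k y := by
      have h2 : ((1 + y)⁻¹) ^ (I + 1) = 1 + y * k y := by
        have := hk' y
        simp only [smul_eq_mul] at this
        linear_combination this
      rw [div_eq_mul_inv, mul_pow, h2]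
      ring
    have h3 : (y / (1 + y)) ^ (I + 1) • c - χ y * (y ^ (I + 1) • c) =
        y ^ (I + 2) • (k y • c - y • (h y * c)) := by
      rw [h1, hy2]
      simp only [add_smul, add_mul, one_mul, smul_sub, smul_smul, smul_mul_smul_comm]
      rw [show y ^ 2 * y ^ (I + 1) = y ^ (I + 2) * y by ring]
      abel
    calc _ = ((1 + ∑ i ∈ Finset.range I, (y / (1 + y)) ^ (i + 1) • f i) -
        χ y * (1 + ∑ i ∈ Finset.range I, y ^ (i + 1) • f i)) +
        ((y / (1 + y)) ^ (I + 1) • c - χ y * (y ^ (I + 1) • c)) := by ring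
      _ = y ^ (I + 2) • (g y + k y • c - y • (h y * c)) := by
        rw [hy, h3, ← smul_add, add_sub_assoc]
      _ = _ := by rw [hg'', smul_smul]; ring_nf

/-- The sequence has a limit `L`, and its expansion is `L` times the formal solution. The difference
from a truncation is a null sequence that satisfies the recurrence up to `O(n^(-I-2))`. -/
theorem exists_expansion_of_recurrence [CompleteSpace A] {χ h : ℂ → A} (hh : AnalyticAt ℂ h 0)
    (hχ : ∀ᶠ y in 𝓝 0, χ y = 1 + y ^ 2 • h y) {u : ℕ → A}
    (hu : ∀ᶠ n : ℕ in atTop, u (n + 1) = χ ((n : ℂ)⁻¹) * u n) :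
    ∃ e : ℕ → A, Tendsto u atTop (𝓝 (e 0)) ∧ ∀ I : ℕ,
      (fun n : ℕ => u n - ∑ i ∈ Finset.range I, ((n : ℂ)⁻¹) ^ i • e i) =O[atTop]
        fun n => ((n : ℝ) ^ I)⁻¹ := by
  have hinv : Tendsto (fun n : ℕ => (n : ℂ)⁻¹) atTop (𝓝 0) := tendsto_inv_atTop_nhds_zero_nat
  have hnorm : ∀ j : ℕ, (fun n : ℕ => ((n : ℂ)⁻¹) ^ j) =O[atTop] fun n : ℕ => ((n : ℝ) ^ j)⁻¹ :=
    fun j => IsBigO.of_bound 1 (Eventually.of_forall fun n => by simp)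
  have hb : ∀ {g : ℂ → A}, AnalyticAt ℂ g 0 →
      (fun n : ℕ => g ((n : ℂ)⁻¹)) =O[atTop] fun _ => (1 : ℝ) := fun hg =>
    (hg.continuousAt.tendsto.comp hinv).isBigO_one ℝ
  have hsm : ∀ {g : ℂ → A} (j : ℕ), AnalyticAt ℂ g 0 →
      (fun n : ℕ => ((n : ℂ)⁻¹) ^ j • g ((n : ℂ)⁻¹)) =O[atTop] fun n : ℕ => ((n : ℝ) ^ j)⁻¹ :=
    fun j hg => by simpa using (hnorm j).smul (hb hg)
  set a : ℕ → A := fun n => ((n : ℂ)⁻¹) ^ 2 • h ((n : ℂ)⁻¹) with ha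
  have hrec : ∀ᶠ n in atTop, u (n + 1) - u n = a n * u n := by
    filter_upwards [hu, hinv.eventually hχ] with n h1 h2
    rw [h1, h2]
    ring
  obtain ⟨L, hL⟩ := exists_tendsto_of_sub_eq_mul hrec (hsm 2 hh)
  obtain ⟨f, hf⟩ := exists_formal_solution hh hχ
  -- The formal solution starts with `1`, which accounts for the entry `L` at index `0` and for the
  -- shift of `f`.
  let e : ℕ → A := fun i => Nat.casesOn i L (fun j => f j * L)
  have he : ∀ (I : ℕ) (y : ℂ), ∑ i ∈ Finset.range (I + 1), y ^ i • e i =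
      (1 + ∑ i ∈ Finset.range I, y ^ (i + 1) • f i) * L := by
    intro I y
    rw [Finset.sum_range_succ', add_mul, Finset.sum_mul, add_comm]
    simp [e]
  refine ⟨e, hL, fun I => ?_⟩
  rcases I with _ | I
  · simpa using hL.isBigO_one ℝ
  simp only [he]
  obtain ⟨g, hg, hE⟩ := hf I
  set Q : ℂ → A := fun y => 1 + ∑ i ∈ Finset.range I, y ^ (i + 1) • f i with hQ
  set w : ℕ → A := fun n => u n - Q ((n : ℂ)⁻¹) * L with hw
  have hQc : Continuous Q := by
    rw [hQ]
    fun_prop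
  have hw0 : Tendsto w atTop (𝓝 0) := by
    have h1 : Tendsto (fun n : ℕ => Q ((n : ℂ)⁻¹)) atTop (𝓝 (Q 0)) := (hQc.tendsto 0).comp hinv
    have h2 : Q 0 = 1 := by simp [hQ]
    have := hL.sub (h1.mul_const L)
    simpa [h2] using this
  have hdiff : ∀ᶠ n : ℕ in atTop, w (n + 1) - w n =
      a n * w n - (((n : ℂ)⁻¹) ^ (I + 2) • g ((n : ℂ)⁻¹)) * L := by
    filter_upwards [hrec, hinv.eventually hχ, hinv.eventually hE, eventually_ge_atTop 1]
      with n h1 h2 h3 h4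
    have h5 : ((n + 1 : ℕ) : ℂ)⁻¹ = (n : ℂ)⁻¹ / (1 + (n : ℂ)⁻¹) := by
      have : (n : ℂ) ≠ 0 := by exact_mod_cast (by omega : n ≠ 0)
      have h6 : (n : ℂ) + 1 ≠ 0 := by exact_mod_cast Nat.succ_ne_zero n
      push_cast
      field_simp
    have h7 : Q ((n + 1 : ℕ) : ℂ)⁻¹ = χ (n : ℂ)⁻¹ * Q ((n : ℂ)⁻¹) +
        ((n : ℂ)⁻¹) ^ (I + 2) • g ((n : ℂ)⁻¹) := by
      rw [h5, ← h3]
      simp only [hQ]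
      ring
    simp only [hw]
    rw [h7, h2, show u (n + 1) = u n + a n * u n by rw [← h1]; ring]
    simp only [ha]
    ring
  -- Bootstrap: if `w = O(n^(-i))`, the multiplier `a n = O(n^(-2))` makes the differences
  -- `O(n^(-i-2))`, and summation gives `w = O(n^(-i-1))`.
  have hmain : ∀ i, i ≤ I + 1 → w =O[atTop] fun n : ℕ => ((n : ℝ) ^ i)⁻¹ := by
    intro i
    induction i with
    | zero => intro _; simpa using hw0.isBigO_one ℝ
    | succ i ih =>
      intro hi
      refine isBigO_inv_pow_of_sub (by omega) hw0 ?_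
      refine IsBigO.congr' (IsBigO.sub ?_ ?_) (hdiff.mono fun n hn => hn.symm) EventuallyEq.rfl
      · refine ((hsm 2 hh).mul (ih (by omega))).congr_right fun n => ?_
        rw [← mul_inv, ← pow_add]
        ring_nf
      · have h1 := (hsm (I + 2) hg).mul (isBigO_const_const L (one_ne_zero (α := ℝ)) atTop)
        refine (h1.congr_right fun n => mul_one _).trans ?_
        refine IsBigO.of_bound 1 (eventually_atTop.mpr ⟨1, fun n hn => ?_⟩)
        have hn1 : (1 : ℝ) ≤ n := by exact_mod_cast hn
        rw [one_mul, Real.norm_of_nonneg (by positivity), Real.norm_of_nonneg (by positivity)]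
        exact inv_anti₀ (by positivity) (pow_le_pow_right₀ hn1 (by omega))
  exact hmain (I + 1) le_rfl

end Recurrence

/-! ### Binomial coefficients with argument in a commutative Banach algebra -/

section BanachBinomial

open Asymptotics

variable {A : Type*} [NormedCommRing A] [NormedAlgebra ℂ A]

/-- The coefficient of `z ^ n` in `(1 - z) ^ (X - 1)`. -/
noncomputable def binomCoeff (X : A) (n : ℕ) : A :=
  ∏ j ∈ Finset.range n, (1 - ((j : ℂ) + 1)⁻¹ • X)

/-- The binomial coefficient without the factor with index `m`, if `m < n`. -/
noncomputable def binomCoeffErase (X : A) (m n : ℕ) : A :=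
  ∏ j ∈ (Finset.range n).erase m, (1 - ((j : ℂ) + 1)⁻¹ • X)

theorem binomCoeff_eq_mul_erase (X : A) {m n : ℕ} (h : m < n) :
    binomCoeff X n = (1 - ((m : ℂ) + 1)⁻¹ • X) * binomCoeffErase X m n :=
  (Finset.mul_prod_erase _ _ (Finset.mem_range.mpr h)).symm

theorem sub_eq_mul_of_recurrence {χ h : ℂ → A} (hχ : ∀ y, χ y = 1 + y ^ 2 • h y) {u : ℕ → A}
    (hu : ∀ᶠ n : ℕ in atTop, u (n + 1) = χ ((n : ℂ)⁻¹) * u n) :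
    ∀ᶠ n : ℕ in atTop, u (n + 1) - u n = (((n : ℂ)⁻¹) ^ 2 • h ((n : ℂ)⁻¹)) * u n := by
  filter_upwards [hu] with n hn
  rw [hn, hχ]
  ring

theorem isBigO_inv_sq_smul {h : ℂ → A} (hh : AnalyticAt ℂ h 0) :
    (fun n : ℕ => ((n : ℂ)⁻¹) ^ 2 • h ((n : ℂ)⁻¹)) =O[atTop] fun n : ℕ => ((n : ℝ) ^ 2)⁻¹ := by
  have h1 : (fun n : ℕ => ((n : ℂ)⁻¹) ^ 2) =O[atTop] fun n : ℕ => ((n : ℝ) ^ 2)⁻¹ :=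
    IsBigO.of_bound 1 (Eventually.of_forall fun n => by simp)
  have h2 : (fun n : ℕ => h ((n : ℂ)⁻¹)) =O[atTop] fun _ => (1 : ℝ) :=
    (hh.continuousAt.tendsto.comp tendsto_inv_atTop_nhds_zero_nat).isBigO_one ℝ
  simpa using h1.smul h2

variable [CompleteSpace A]

theorem exp_add_complex (x y : A) :
    NormedSpace.exp (x + y) = NormedSpace.exp x * NormedSpace.exp y := by
  let _ := NormedAlgebra.restrictScalars ℚ ℂ A
  exact NormedSpace.exp_add

theorem exp_smul_analyticAt (x : A) (f : ℂ → ℂ) (y : ℂ) (hf : AnalyticAt ℂ f y) :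
    AnalyticAt ℂ (fun z => NormedSpace.exp (f z • x)) y :=
  AnalyticAt.fun_comp (f := fun z => f z • x) (NormedSpace.exp_analytic (𝕂 := ℂ) (f y • x))
    (hf.smul analyticAt_const)

/-- The ratio `n ^ X / (n - 1) ^ X * (1 - X / n)`, in terms of `y = 1 / (n - 1)`. -/
noncomputable def binomRatio (X : A) (y : ℂ) : A :=
  (1 - (y / (1 + y)) • X) * NormedSpace.exp (Complex.log (1 + y) • X)

/-- The terms of first order, `-yX` from the new factor and `+yX` from the exponential, cancel. This
is the reason for normalizing by `n^X`. -/
theorem binomRatio_expansion (X : A) : ∃ h : ℂ → A, AnalyticAt ℂ h 0 ∧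
    ∀ y, binomRatio X y = 1 + y ^ 2 • h y := by
  have hsl : (1 : ℂ) + 0 ∈ Complex.slitPlane := by simp
  have hy : AnalyticAt ℂ (fun y : ℂ => y / (1 + y)) 0 :=
    analyticAt_id.div (analyticAt_const.add analyticAt_id) (by simp)
  have hA : AnalyticAt ℂ (fun y => binomRatio X y - 1) 0 :=
    ((analyticAt_const.sub (hy.smul analyticAt_const)).mul (exp_smul_analyticAt X _ _
      ((analyticAt_const.add analyticAt_id).clog hsl))).sub analyticAt_const
  obtain ⟨g, hg, hg'⟩ := AnalyticAt.exists_eq_smul_of_eq_zero hA (by simp [binomRatio])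
  have hg0 : g 0 = 0 := by
    have h1 : HasDerivAt (fun y => binomRatio X y - 1) 0 0 := by
      have e1 : HasDerivAt (fun y : ℂ => y / (1 + y)) 1 0 := by
        have := (hasDerivAt_id (0 : ℂ)).div ((hasDerivAt_id (0 : ℂ)).const_add 1) (by simp)
        refine this.congr_deriv ?_
        simp
      have e2 : HasDerivAt (fun y : ℂ => Complex.log (1 + y)) 1 0 := by
        have := ((hasDerivAt_id (0 : ℂ)).const_add 1).clog hsl
        refine this.congr_deriv ?_
        simp
      have e3 : HasDerivAt (fun y : ℂ => NormedSpace.exp (Complex.log (1 + y) • X)) X 0 := by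
        have := HasDerivAt.scomp (0 : ℂ) (hasDerivAt_exp_smul_const (𝕂 := ℂ) X
          (Complex.log (1 + 0))) e2
        refine this.congr_deriv ?_
        simp
      have e4 := (((e1.smul_const X).const_sub 1).mul e3).sub_const 1
      refine e4.congr_deriv ?_
      simp
    have h4 : HasDerivAt (fun y : ℂ => y • g y) (g 0) 0 := by
      have := (hasDerivAt_id (0 : ℂ)).smul hg.differentiableAt.hasDerivAt
      refine this.congr_deriv ?_
      simp
    exact h4.unique (h1.congr_of_eventuallyEq (Eventually.of_forall fun y => (hg' y).symm))
  obtain ⟨h, hh, hh'⟩ := AnalyticAt.exists_eq_smul_of_eq_zero hg hg0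
  refine ⟨h, hh, fun y => ?_⟩
  have := hg' y
  rw [hh', smul_smul, ← pow_two] at this
  rw [← this]
  abel

theorem exp_log_succ_mul (X : A) (n : ℕ) (hn : 1 ≤ n) :
    NormedSpace.exp ((Real.log (n + 1 : ℕ) : ℂ) • X) * (1 - ((n : ℂ) + 1)⁻¹ • X) =
      binomRatio X ((n : ℂ)⁻¹) * NormedSpace.exp ((Real.log n : ℂ) • X) := by
  have hn0 : (n : ℂ) ≠ 0 := by exact_mod_cast (by omega : n ≠ 0)
  have hn1 : (n : ℂ) + 1 ≠ 0 := by exact_mod_cast Nat.succ_ne_zero n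
  have h1 : (n : ℂ)⁻¹ / (1 + (n : ℂ)⁻¹) = ((n : ℂ) + 1)⁻¹ := by field_simp
  have h2 : Complex.log (1 + (n : ℂ)⁻¹) = ((Real.log (n + 1 : ℕ) - Real.log n : ℝ) : ℂ) := by
    have hpos : (0 : ℝ) < n := by exact_mod_cast hn
    rw [← Real.log_div (by positivity) (by positivity), Complex.ofReal_log (by positivity)]
    congr 1
    push_cast
    field_simp
  rw [binomRatio, h1, h2, mul_assoc, ← exp_add_complex, ← add_smul]
  push_cast
  rw [sub_add_cancel, mul_comm]

theorem binomCoeff_recurrence (X : A) : ∀ᶠ n : ℕ in atTop,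
    NormedSpace.exp ((Real.log (n + 1 : ℕ) : ℂ) • X) * binomCoeff X (n + 1) =
      binomRatio X ((n : ℂ)⁻¹) * (NormedSpace.exp ((Real.log n : ℂ) • X) * binomCoeff X n) := by
  filter_upwards [eventually_ge_atTop 1] with n hn
  rw [binomCoeff, Finset.prod_range_succ, ← binomCoeff, mul_left_comm, exp_log_succ_mul X n hn]
  ring

/-- Past the erased index the new factors are unchanged. The erased product is needed when the
factor with index `m` is nilpotent. -/
theorem binomCoeffErase_recurrence (X : A) (m : ℕ) : ∀ᶠ n : ℕ in atTop,
    NormedSpace.exp ((Real.log (n + 1 : ℕ) : ℂ) • X) * binomCoeffErase X m (n + 1) =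
      binomRatio X ((n : ℂ)⁻¹) *
        (NormedSpace.exp ((Real.log n : ℂ) • X) * binomCoeffErase X m n) := by
  filter_upwards [eventually_ge_atTop (m + 1)] with n hn
  have : (Finset.range (n + 1)).erase m = insert n ((Finset.range n).erase m) := by
    ext j
    simp only [Finset.mem_erase, Finset.mem_range, Finset.mem_insert]
    omega
  rw [binomCoeffErase, this, Finset.prod_insert (by simp), ← binomCoeffErase, ← mul_assoc,
    exp_log_succ_mul X n (by omega)]
  ring

theorem iteratedDeriv_exp_log_smul (x : A) (n : ℕ) {z : ℂ} (hz : z ∈ Metric.ball (0 : ℂ) 1) :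
    iteratedDeriv n (fun z => NormedSpace.exp (Complex.log (1 - z) • x)) z =
      (((1 - z)⁻¹) ^ n • ∏ j ∈ Finset.range n, ((j : ℂ) • (1 : A) - x)) *
        NormedSpace.exp (Complex.log (1 - z) • x) := by
  induction n generalizing z with
  | zero => simp
  | succ n ih =>
    have hsl : 1 - z ∈ Complex.slitPlane := by
      have := Complex.mem_slitPlane_of_norm_lt_one (z := -z) (by simpa using hz)
      simpa [sub_eq_add_neg] using this
    have hne : 1 - z ≠ 0 := Complex.slitPlane_ne_zero hsl
    have hev : iteratedDeriv n (fun z => NormedSpace.exp (Complex.log (1 - z) • x)) =ᶠ[𝓝 z]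
        fun z => (((1 - z)⁻¹) ^ n • ∏ j ∈ Finset.range n, ((j : ℂ) • (1 : A) - x)) *
        NormedSpace.exp (Complex.log (1 - z) • x) :=
      Filter.eventuallyEq_of_mem (Metric.isOpen_ball.mem_nhds hz) fun w hw => ih hw
    rw [iteratedDeriv_succ, hev.deriv_eq]
    have d0 : HasDerivAt (fun z : ℂ => 1 - z) (-1) z := by
      simpa using (hasDerivAt_id z).const_sub 1
    have d1 := HasDerivAt.scomp z (hasDerivAt_exp_smul_const (𝕂 := ℂ) x
      (Complex.log (1 - z))) (d0.clog hsl)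
    have d2 := ((d0.inv hne).pow n).smul_const (∏ j ∈ Finset.range n, ((j : ℂ) • (1 : A) - x))
    have d3 := (d2.mul d1).deriv
    refine d3.trans ?_
    set P := ∏ j ∈ Finset.range n, ((j : ℂ) • (1 : A) - x) with hP
    rw [Finset.prod_range_succ, ← hP]
    have h5 : (n : ℂ) * ((1 - z)⁻¹) ^ (n - 1) * (-(-1) / (1 - z) ^ 2) =
        ((1 - z)⁻¹) ^ (n + 1) * n := by
      rcases n with _ | n
      · simp
      · simp only [Nat.add_sub_cancel]
        rw [neg_neg, one_div, ← inv_pow]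
        ring
    have h6 : -1 / (1 - z) = -(1 - z)⁻¹ := by rw [neg_div, one_div]
    simp only [Pi.inv_apply, Pi.pow_apply, Function.comp]
    rw [h5, h6]
    simp only [neg_smul, smul_mul_assoc, mul_neg, mul_smul_comm, smul_smul, mul_sub, sub_mul,
      smul_sub, mul_one, pow_succ]
    rw [← sub_eq_add_neg, mul_comm ((1 - z)⁻¹) (((1 - z)⁻¹) ^ n), mul_assoc P x,
      mul_comm x (NormedSpace.exp _)]

/-- The binomial series for `(1 - z)^x` with `x` in a Banach algebra. The Taylor coefficient is `∏
(j - x) / (j + 1)`, and `(j - x) / (j + 1) = 1 - (1 + x) / (j + 1)`. -/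
theorem hasSum_binomCoeff (x : A) {z : ℂ} (hz : z ∈ Metric.ball (0 : ℂ) 1) :
    HasSum (fun n => z ^ n • binomCoeff (1 + x) n)
      (NormedSpace.exp (Complex.log (1 - z) • x)) := by
  have hd : DifferentiableOn ℂ (fun z => NormedSpace.exp (Complex.log (1 - z) • x))
      (Metric.ball 0 1) := by
    intro w hw
    have hsl : 1 - w ∈ Complex.slitPlane := by
      have := Complex.mem_slitPlane_of_norm_lt_one (z := -w) (by simpa using hw)
      simpa [sub_eq_add_neg] using this
    exact (exp_smul_analyticAt x _ _ ((analyticAt_const.sub analyticAt_id).clog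
      hsl)).differentiableAt.differentiableWithinAt
  have h := Complex.hasSum_taylorSeries_on_ball hd hz
  refine h.congr_fun fun n => ?_
  rw [iteratedDeriv_exp_log_smul x n (Metric.mem_ball_self one_pos), smul_comm]
  simp only [sub_zero, inv_one, one_pow, one_smul, Complex.log_one, zero_smul,
    NormedSpace.exp_zero, mul_one]
  congr 1
  rw [binomCoeff]
  induction n with
  | zero => simp
  | succ n ih =>
    have hn : (n : ℂ) + 1 ≠ 0 := by exact_mod_cast Nat.succ_ne_zero n
    have key : 1 - ((n : ℂ) + 1)⁻¹ • (1 + x) = ((n : ℂ) + 1)⁻¹ • ((n : ℂ) • (1 : A) - x) := by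
      have h1 : (1 : A) = ((n : ℂ) + 1)⁻¹ • (((n : ℂ) + 1) • (1 : A)) := by
        rw [smul_smul, inv_mul_cancel₀ hn, one_smul]
      nth_rw 1 [h1]
      rw [← smul_sub, add_smul, one_smul]
      congr 1
      abel
    rw [Finset.prod_range_succ, Finset.prod_range_succ, ih, Nat.factorial_succ, Nat.cast_mul,
      mul_inv_rev, key, smul_mul_smul_comm]
    push_cast
    rfl

end BanachBinomial

/-! ### Truncated polynomials as a Banach algebra -/

section Jet

open Polynomial

/-- The algebra `ℂ[ε] / (ε ^ (k + 1))`. -/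
abbrev Jet (k : ℕ) : Type := AdjoinRoot (X ^ (k + 1) : ℂ[X])

attribute [local instance] Matrix.linftyOpNormedRing Matrix.linftyOpNormedAlgebra

/-- The norm is that of the matrix of multiplication; it serves only to make the jets a Banach
algebra. -/
noncomputable instance (k : ℕ) : NormedCommRing (Jet k) :=
  NormedCommRing.induced (Jet k) _
    (Algebra.leftMulMatrix (AdjoinRoot.powerBasis' (monic_X_pow (R := ℂ) (k + 1))).basis)
    (Algebra.leftMulMatrix_injective _)

noncomputable instance (k : ℕ) : NormedAlgebra ℂ (Jet k) :=
  NormedAlgebra.induced ℂ (Jet k) _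
    (Algebra.leftMulMatrix (AdjoinRoot.powerBasis' (monic_X_pow (R := ℂ) (k + 1))).basis)

instance (k : ℕ) : FiniteDimensional ℂ (Jet k) :=
  (AdjoinRoot.powerBasis' (monic_X_pow (R := ℂ) (k + 1))).finite

instance (k : ℕ) : CompleteSpace (Jet k) := FiniteDimensional.complete ℂ (Jet k)

/-- The nilpotent generator. -/
noncomputable def jetEps (k : ℕ) : Jet k := AdjoinRoot.root _

theorem jetEps_pow (k : ℕ) : jetEps k ^ (k + 1) = 0 := by
  have := AdjoinRoot.eval₂_root (X ^ (k + 1) : ℂ[X])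
  simp only [eval₂_pow, eval₂_X] at this
  exact this

theorem jetEps_pow_of_lt {k l : ℕ} (h : k < l) : jetEps k ^ l = 0 := by
  obtain ⟨m, rfl⟩ := Nat.exists_eq_add_of_lt h
  rw [show k + m + 1 = (k + 1) + m by ring, pow_add, jetEps_pow, zero_mul]

/-- The coefficient of `ε ^ k`. -/
noncomputable def jetTop (k : ℕ) : Jet k →L[ℂ] ℂ :=
  LinearMap.toContinuousLinearMap
    ((lcoeff ℂ k).comp (AdjoinRoot.modByMonicHom (monic_X_pow (R := ℂ) (k + 1))))

/-- The constant coefficient. -/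
noncomputable def jetAug (k : ℕ) : Jet k →ₐ[ℂ] ℂ :=
  AdjoinRoot.liftAlgHom _ (AlgHom.id ℂ ℂ) 0 (by simp)

theorem continuous_jetAug (k : ℕ) : Continuous (jetAug k) :=
  (LinearMap.toContinuousLinearMap (jetAug k).toLinearMap).continuous

theorem jetAug_eps (k : ℕ) : jetAug k (jetEps k) = 0 := by
  simp [jetAug, jetEps]

theorem jetTop_eps_pow (k l : ℕ) : jetTop k (jetEps k ^ l) = if l = k then 1 else 0 := by
  rcases lt_or_ge k l with h | h
  · rw [jetEps_pow_of_lt h, map_zero, if_neg h.ne']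
  · have h1 : jetTop k (jetEps k ^ l) = ((X ^ l : ℂ[X]) %ₘ X ^ (k + 1)).coeff k := by
      have : jetEps k ^ l = AdjoinRoot.mk (X ^ (k + 1) : ℂ[X]) (X ^ l) := by
        simp [jetEps]
      rw [this]
      rw [jetTop, LinearMap.coe_toContinuousLinearMap', LinearMap.comp_apply,
        AdjoinRoot.modByMonicHom_mk, lcoeff_apply]
    rw [h1, (modByMonic_eq_self_iff (monic_X_pow _)).mpr (by
      rw [degree_X_pow, degree_X_pow]; exact_mod_cast Nat.lt_succ_of_le h), coeff_X_pow]
    simp [eq_comm]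

/-- Multiplication by `ε^k` kills everything except the constant term, which it moves to the top. -/
theorem jetTop_eps_pow_mul (k : ℕ) (y : Jet k) : jetTop k (jetEps k ^ k * y) = jetAug k y := by
  obtain ⟨p, rfl⟩ := AdjoinRoot.mk_surjective y
  induction p using Polynomial.induction_on' with
  | add p q hp hq => rw [map_add, mul_add, map_add, map_add, hp, hq]
  | monomial n a =>
    have : AdjoinRoot.mk (X ^ (k + 1) : ℂ[X]) (monomial n a) = a • jetEps k ^ n := by
      rw [← smul_X_eq_monomial]
      simp [jetEps, Algebra.smul_def]
    rw [this, mul_smul_comm, map_smul, map_smul, ← pow_add, jetTop_eps_pow, map_pow, jetAug_eps]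
    rcases n with _ | n <;> simp

theorem exp_smul_jetEps (k : ℕ) (t : ℂ) : NormedSpace.exp (t • jetEps k) =
    ∑ l ∈ Finset.range (k + 1), ((l.factorial : ℂ)⁻¹ * t ^ l) • jetEps k ^ l := by
  have h1 := NormedSpace.exp_series_hasSum_exp' (𝕂 := ℂ) (t • jetEps k)
  have h2 := hasSum_sum_of_ne_finset_zero (L := SummationFilter.unconditional ℕ)
    (f := fun n : ℕ => ((n.factorial : ℂ)⁻¹) • (t • jetEps k) ^ n) (s := Finset.range (k + 1))
    (fun n hn => by
      rw [_root_.smul_pow, jetEps_pow_of_lt (by simpa using hn), smul_zero, smul_zero])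
  rw [h1.unique h2]
  refine Finset.sum_congr rfl fun l _ => ?_
  rw [_root_.smul_pow, smul_smul]

theorem exp_smul_one (k : ℕ) (t : ℂ) :
    NormedSpace.exp (t • (1 : Jet k)) = Complex.exp t • (1 : Jet k) := by
  have := NormedSpace.algebraMap_exp_comm (𝕂 := ℂ) (𝔸 := Jet k) t
  rw [Algebra.algebraMap_eq_smul_one, Algebra.algebraMap_eq_smul_one] at this
  rw [← this, Complex.exp_eq_exp_ℂ]

/-- This is where logarithms come from: `t = log (1 - z)` gives the powers of `log (1 - z)`, and `t
= -log n` those of `log n`. -/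
theorem exp_smul_add_jetEps (k : ℕ) (t s : ℂ) :
    NormedSpace.exp (t • (s • (1 : Jet k) + jetEps k)) =
      Complex.exp (t * s) • ∑ l ∈ Finset.range (k + 1),
        ((l.factorial : ℂ)⁻¹ * t ^ l) • jetEps k ^ l := by
  rw [smul_add, exp_add_complex, smul_smul, exp_smul_one, exp_smul_jetEps, smul_mul_assoc, one_mul]

end Jet

/-! ### Coefficients of `(1 - z) ^ s * log (1 - z) ^ k` -/

section Coefficients

open Asymptotics

/-- The base point of the jet of binomial coefficients. -/
noncomputable def jetPoint (s : ℝ) (k : ℕ) : Jet k := (s : ℂ) • 1 + jetEps k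

/-- The coefficient of `z ^ n` in `(1 - z) ^ s * log (1 - z) ^ k`. -/
noncomputable def logCoeff (s : ℝ) (k n : ℕ) : ℂ :=
  k.factorial * jetTop k (binomCoeff (1 + jetPoint s k) n)

/-- Read off the coefficient of `ε^k` in the binomial series of `(1 - z)^(s + ε)`. -/
theorem hasSum_logCoeff (s : ℝ) (k : ℕ) {z : ℂ} (hz : z ∈ Metric.ball (0 : ℂ) 1) :
    HasSum (fun n => logCoeff s k n * z ^ n)
      (Complex.log (1 - z) ^ k * Complex.exp (s * Complex.log (1 - z))) := by
  have h1 := ((hasSum_binomCoeff (jetPoint s k) hz).mapL (jetTop k)).mul_left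
    (k.factorial : ℂ)
  rw [jetPoint, exp_smul_add_jetEps, map_smul, map_sum] at h1
  simp only [map_smul, jetTop_eps_pow, smul_eq_mul] at h1
  rw [Finset.sum_eq_single k (fun l _ hl => by simp [hl])
    (fun h => absurd (Finset.mem_range.mpr (Nat.lt_succ_self k)) h)] at h1
  have hk : (k.factorial : ℂ) ≠ 0 := by exact_mod_cast k.factorial_ne_zero
  have h2 : (k.factorial : ℂ) * (Complex.exp (Complex.log (1 - z) * s) *
      ((k.factorial : ℂ)⁻¹ * Complex.log (1 - z) ^ k * if k = k then 1 else 0)) =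
      Complex.log (1 - z) ^ k * Complex.exp (s * Complex.log (1 - z)) := by
    rw [if_pos rfl, mul_comm (s : ℂ)]
    field_simp
  rw [h2] at h1
  refine h1.congr_fun fun n => ?_
  rw [logCoeff, jetPoint, mul_assoc, mul_comm (z ^ n)]

theorem exp_neg_log_smul (s : ℝ) (k : ℕ) {n : ℕ} (hn : 1 ≤ n) :
    NormedSpace.exp (-(Real.log n : ℂ) • (1 + jetPoint s k)) =
      ((((n : ℝ) ^ (s + 1))⁻¹ : ℝ) : ℂ) • ∑ l ∈ Finset.range (k + 1),
        ((l.factorial : ℂ)⁻¹ * (-(Real.log n : ℂ)) ^ l) • jetEps k ^ l := by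
  have h1 : (1 : Jet k) + jetPoint s k = ((s + 1 : ℝ) : ℂ) • 1 + jetEps k := by
    rw [jetPoint]
    push_cast
    rw [add_smul, one_smul]
    abel
  have h2 : Complex.exp (-(Real.log n : ℂ) * ((s + 1 : ℝ) : ℂ)) =
      (((n : ℝ) ^ (s + 1))⁻¹ : ℝ) := by
    rw [Real.rpow_def_of_pos (by exact_mod_cast hn), ← Real.exp_neg]
    push_cast
    ring_nf
  rw [h1, exp_smul_add_jetEps, h2]

/-- The normalized binomial coefficients, in jets. -/
noncomputable def normCoeff (s : ℝ) (k n : ℕ) : Jet k :=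
  NormedSpace.exp ((Real.log n : ℂ) • (1 + jetPoint s k)) * binomCoeff (1 + jetPoint s k) n

/-- The binomial coefficient is `n^(-(1 + s + ε))` times the normalized one, which has an expansion
in `1 / n`; the first factor is expanded in `ε`. -/
theorem logCoeff_eq (s : ℝ) (k : ℕ) {n : ℕ} (hn : 1 ≤ n) :
    logCoeff s k n = (((n : ℝ) ^ (s + 1))⁻¹ : ℝ) * ∑ l ∈ Finset.range (k + 1),
      (k.factorial * (l.factorial : ℂ)⁻¹ * (-(Real.log n : ℂ)) ^ l) *
        jetTop k (jetEps k ^ l * normCoeff s k n) := by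
  have h1 : binomCoeff (1 + jetPoint s k) n =
      NormedSpace.exp (-(Real.log n : ℂ) • (1 + jetPoint s k)) * normCoeff s k n := by
    rw [normCoeff, ← mul_assoc, ← exp_add_complex, ← add_smul]
    simp
  rw [logCoeff, h1, exp_neg_log_smul s k hn, smul_mul_assoc, Finset.sum_mul,
    map_smul (jetTop k), map_sum, smul_eq_mul, mul_left_comm, Finset.mul_sum]
  congr 1
  refine Finset.sum_congr rfl fun l _ => ?_
  rw [smul_mul_assoc, map_smul, smul_eq_mul]
  ring

theorem jetAug_one_add (s : ℝ) (k : ℕ) : jetAug k (1 + jetPoint s k) = ((s + 1 : ℝ) : ℂ) := by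
  rw [jetPoint, map_add, map_add, map_smul, jetAug_eps, map_one]
  push_cast
  simp [add_comm]

/-- Modulo `ε` the factor is `(j - s) / (j + 1)`. -/
theorem jetAug_factor (s : ℝ) (k j : ℕ) (h : s ≠ j) :
    jetAug k (1 - ((j : ℂ) + 1)⁻¹ • (1 + jetPoint s k)) ≠ 0 := by
  rw [map_sub, map_one, map_smul, jetAug_one_add, smul_eq_mul]
  have hj : (j : ℂ) + 1 ≠ 0 := by exact_mod_cast Nat.succ_ne_zero j
  intro h0
  have h1 : (j : ℂ) + 1 = ((s + 1 : ℝ) : ℂ) := by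
    field_simp at h0
    linear_combination h0
  have h2 : (j : ℝ) + 1 = s + 1 := by exact_mod_cast h1
  exact h (by linarith)

theorem jetAug_exp_ne_zero (k : ℕ) (x : Jet k) : jetAug k (NormedSpace.exp x) ≠ 0 := by
  have h : NormedSpace.exp x * NormedSpace.exp (-x) = 1 := by
    rw [← exp_add_complex]; simp
  intro h0
  have := congrArg (jetAug k) h
  rw [map_mul, h0] at this
  simp at this

/-- Modulo `ε` the recurrence becomes a scalar one, whose eventually nonzero solutions have nonzero
limits. -/
theorem jetAug_limit_ne_zero {k : ℕ} (X : Jet k) {u : ℕ → Jet k} {L : Jet k}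
    (hu : ∀ᶠ n : ℕ in atTop, u (n + 1) = binomRatio X ((n : ℂ)⁻¹) * u n)
    (hne : ∀ᶠ n in atTop, jetAug k (u n) ≠ 0) (hL : Tendsto u atTop (𝓝 L)) :
    jetAug k L ≠ 0 := by
  obtain ⟨h, hh, hχ⟩ := binomRatio_expansion X
  have h1 := sub_eq_mul_of_recurrence hχ hu
  have hθ : AnalyticAt ℂ (fun y => jetAug k (h y)) 0 :=
    AnalyticAt.fun_comp ((LinearMap.toContinuousLinearMap (jetAug k).toLinearMap).analyticAt _) hh
  refine ne_zero_of_tendsto_of_sub_eq_mul (u := fun n => jetAug k (u n))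
    (a := fun n : ℕ => ((n : ℂ)⁻¹) ^ 2 • jetAug k (h ((n : ℂ)⁻¹))) ?_ (isBigO_inv_sq_smul hθ) hne
    (((continuous_jetAug k).tendsto L).comp hL)
  filter_upwards [h1] with n hn
  rw [← map_sub, hn, map_mul, map_smul]

theorem isBigO_log_pow_mul {E : Type*} [NormedAddCommGroup E] [NormedSpace ℂ E] {r : ℕ → E}
    {I l k : ℕ} (hl : l ≤ k)
    (hr : r =O[atTop] fun n : ℕ => ((n : ℝ) ^ I)⁻¹) :
    (fun n : ℕ => ((-(Real.log n : ℂ)) ^ l) • r n) =O[atTop]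
      fun n : ℕ => Real.log n ^ k * ((n : ℝ) ^ I)⁻¹ := by
  have h1 : (fun n : ℕ => (-(Real.log n : ℂ)) ^ l) =O[atTop] fun n : ℕ => Real.log n ^ k := ?_
  · exact h1.smul hr
  refine IsBigO.of_bound 1 ?_
  have : ∀ᶠ n : ℕ in atTop, 1 ≤ Real.log n :=
    (Real.tendsto_log_atTop.comp tendsto_natCast_atTop_atTop).eventually_ge_atTop 1
  filter_upwards [this] with n hn
  rw [norm_pow, norm_neg, Complex.norm_real, Real.norm_of_nonneg (by linarith), one_mul,
    Real.norm_of_nonneg (by positivity)]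
  exact pow_le_pow_right₀ hn hl

/-- The coefficients of `(1 - z) ^ s * log (1 - z) ^ k` have a full asymptotic expansion, whose
leading term is given. -/
theorem exists_logCoeff_expansion (s : ℝ) (k : ℕ) : ∃ e : ℕ → ℕ → ℂ,
    (∀ I : ℕ, (fun n : ℕ => logCoeff s k n - ∑ i ∈ Finset.range I, ∑ l ∈ Finset.range (k + 1),
      e i l * ((Real.log n ^ l / (n : ℝ) ^ (s + 1 + i) : ℝ) : ℂ)) =O[atTop]
        fun n : ℕ => Real.log n ^ k / (n : ℝ) ^ (s + 1 + I)) ∧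
    (∀ i l, k < l → e i l = 0) ∧
    ((∀ m : ℕ, s ≠ m) → e 0 k ≠ 0) ∧
    ((∃ m : ℕ, s = m) → e 0 k = 0 ∧ (1 ≤ k → e 0 (k - 1) ≠ 0) ∧ (k = 0 → ∀ i l, e i l = 0)) := by
  set X := 1 + jetPoint s k with hX
  obtain ⟨h, hh, hχ⟩ := binomRatio_expansion X
  have hrec := binomCoeff_recurrence X
  obtain ⟨e, he0, he⟩ := exists_expansion_of_recurrence (u := normCoeff s k) hh
    (Eventually.of_forall hχ) hrec
  -- The `l`-th term in the expansion of `n^(-ε)` multiplies `e i` by `(-log n)^l ε^l / l!`.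
  let E : ℕ → ℕ → ℂ := fun i l =>
    k.factorial * (l.factorial : ℂ)⁻¹ * (-1) ^ l * jetTop k (jetEps k ^ l * e i)
  have hE : ∀ I : ℕ, (fun n : ℕ => logCoeff s k n - ∑ i ∈ Finset.range I,
      ∑ l ∈ Finset.range (k + 1),
      E i l * ((Real.log n ^ l / (n : ℝ) ^ (s + 1 + i) : ℝ) : ℂ)) =O[atTop]
        fun n : ℕ => Real.log n ^ k / (n : ℝ) ^ (s + 1 + I) := by
    intro I
    have h1 : (fun n : ℕ => (((n : ℝ) ^ (s + 1))⁻¹ : ℝ) • ∑ l ∈ Finset.range (k + 1),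
        ((-(Real.log n : ℂ)) ^ l) • (((k.factorial : ℂ) * (l.factorial : ℂ)⁻¹) *
        jetTop k (jetEps k ^ l * (normCoeff s k n -
          ∑ i ∈ Finset.range I, ((n : ℂ)⁻¹) ^ i • e i)))) =O[atTop]
        fun n : ℕ => ((n : ℝ) ^ (s + 1))⁻¹ * (Real.log n ^ k * ((n : ℝ) ^ I)⁻¹) := by
      refine IsBigO.smul (isBigO_refl (fun n : ℕ => ((n : ℝ) ^ (s + 1))⁻¹) _)
        (IsBigO.fun_sum fun l hl => ?_)
      refine isBigO_log_pow_mul (by simpa [Nat.lt_succ_iff] using hl) ?_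
      refine IsBigO.const_mul_left ?_ _
      refine ((jetTop k).isBigO_comp _ _).trans ?_
      have := (isBigO_const_const (jetEps k ^ l) (one_ne_zero (α := ℝ)) atTop).mul (he I)
      simpa using this
    refine h1.congr' ?_ ?_
    · filter_upwards [eventually_ge_atTop 1] with n hn
      have hn' : (0 : ℝ) < n := by exact_mod_cast hn
      rw [logCoeff_eq s k hn, Finset.sum_comm, Complex.real_smul, Finset.mul_sum, Finset.mul_sum,
        ← Finset.sum_sub_distrib]
      refine Finset.sum_congr rfl fun l _ => ?_
      rw [mul_sub, map_sub, Finset.mul_sum, map_sum, mul_sub, smul_sub, mul_sub]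
      congr 1
      · simp only [smul_eq_mul]; ring
      · rw [Finset.mul_sum, Finset.smul_sum, Finset.mul_sum]
        refine Finset.sum_congr rfl fun i _ => ?_
        rw [mul_smul_comm _ (jetEps k ^ l), map_smul (jetTop k), Real.rpow_add hn' (s + 1), Real.rpow_natCast]
        simp only [E, smul_eq_mul]
        push_cast
        rw [neg_pow, inv_pow]
        field_simp
    · filter_upwards [eventually_ge_atTop 1] with n hn
      have hn' : (0 : ℝ) < n := by exact_mod_cast hn
      rw [Real.rpow_add hn' (s + 1), Real.rpow_natCast]
      field_simp
  have hfac : ∀ l : ℕ, (k.factorial : ℂ) * (l.factorial : ℂ)⁻¹ * (-1) ^ l ≠ 0 := by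
    intro l
    have h1 : (k.factorial : ℂ) ≠ 0 := by exact_mod_cast k.factorial_ne_zero
    have h2 : (l.factorial : ℂ) ≠ 0 := by exact_mod_cast l.factorial_ne_zero
    simp [h1, h2]
  have hEl : ∀ i l, k < l → E i l = 0 := fun i l hl => by
    simp [E, jetEps_pow_of_lt hl]
  by_cases hs : ∃ m : ℕ, s = m
  · obtain ⟨m, hm⟩ := hs
    -- For `s = m` the factor with index `m` is a multiple of `ε`, so one power of the logarithm is
    -- lost; the other factors are units.
    have hfact : 1 - ((m : ℂ) + 1)⁻¹ • X = -((m : ℂ) + 1)⁻¹ • jetEps k := by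
      have hm1 : (m : ℂ) + 1 ≠ 0 := by exact_mod_cast Nat.succ_ne_zero m
      have : X = ((m : ℂ) + 1) • (1 : Jet k) + jetEps k := by
        rw [hX, jetPoint, hm, add_smul, one_smul]
        push_cast
        abel
      rw [this, smul_add, smul_smul, inv_mul_cancel₀ hm1, one_smul, neg_smul]
      abel
    set v : ℕ → Jet k := fun n =>
      NormedSpace.exp ((Real.log n : ℂ) • X) * binomCoeffErase X m n with hv
    have hvrec := binomCoeffErase_recurrence X m
    obtain ⟨V, hV⟩ := exists_tendsto_of_sub_eq_mul (u := v)
      (sub_eq_mul_of_recurrence hχ hvrec) (isBigO_inv_sq_smul hh)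
    have hVne : jetAug k V ≠ 0 := by
      refine jetAug_limit_ne_zero X hvrec (Eventually.of_forall fun n => ?_) hV
      rw [map_mul, binomCoeffErase, map_prod]
      refine mul_ne_zero (jetAug_exp_ne_zero _ _) (Finset.prod_ne_zero_iff.mpr fun j hj => ?_)
      refine jetAug_factor s k j ?_
      rw [hm]
      exact_mod_cast (Finset.ne_of_mem_erase hj).symm
    have huv : ∀ n, m < n → normCoeff s k n = (-((m : ℂ) + 1)⁻¹ • jetEps k) * v n := by
      intro n hn
      rw [normCoeff, ← hX, binomCoeff_eq_mul_erase X hn, hfact]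
      ring
    have hL : e 0 = (-((m : ℂ) + 1)⁻¹ • jetEps k) * V := by
      refine tendsto_nhds_unique he0 ((hV.const_mul _).congr' ?_)
      filter_upwards [eventually_gt_atTop m] with n hn using (huv n hn).symm
    have hm1 : -((m : ℂ) + 1)⁻¹ ≠ 0 := by
      refine neg_ne_zero.mpr (inv_ne_zero ?_)
      exact_mod_cast Nat.succ_ne_zero m
    -- If `k = 0`, then `ε = 0` and the coefficients vanish for `n > m`: the function is the
    -- polynomial `(1 - z)^m`. If `k ≥ 1`, then `e 0` is a nonzero multiple of `ε V` with `V` a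
    -- unit, so `ε^k e 0 = 0` while `ε^(k-1) e 0` has nonzero top part.
    rcases Nat.eq_zero_or_pos k with hk | hk
    · refine ⟨fun _ _ => 0, fun I => ?_, fun _ _ _ => rfl, fun hs => absurd hm (hs m),
        fun _ => ⟨rfl, fun h => by omega, fun _ _ _ => rfl⟩⟩
      refine (isBigO_zero _ _).congr' ?_ EventuallyEq.rfl
      filter_upwards [eventually_gt_atTop m] with n hn
      have h0 : jetEps k = 0 := by
        simpa using jetEps_pow_of_lt (k := k) (l := 1) (by omega)
      rw [logCoeff_eq s k (by omega), huv n hn, h0]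
      simp
    · refine ⟨E, hE, hEl, fun hs => absurd hm (hs m), fun _ => ⟨?_, fun _ => ?_, fun h => by omega⟩⟩
      · simp only [E, hL, smul_mul_assoc, mul_smul_comm, map_smul, ← mul_assoc, ← pow_succ]
        rw [jetEps_pow]
        simp
      · simp only [E, hL, smul_mul_assoc, mul_smul_comm, map_smul, ← mul_assoc, ← pow_succ]
        rw [Nat.sub_add_cancel hk, jetTop_eps_pow_mul, smul_eq_mul]
        exact mul_ne_zero hm1 (mul_ne_zero (hfac _) hVne)
  · push Not at hs
    refine ⟨E, hE, hEl, fun _ => ?_, fun ⟨m, hm⟩ => absurd hm (hs m)⟩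
    simp only [E]
    rw [jetTop_eps_pow_mul]
    refine mul_ne_zero (hfac _) (jetAug_limit_ne_zero X hrec (Eventually.of_forall fun n => ?_) he0)
    rw [normCoeff, map_mul, binomCoeff, map_prod]
    exact mul_ne_zero (jetAug_exp_ne_zero _ _)
      (Finset.prod_ne_zero_iff.mpr fun j _ => jetAug_factor s k j (hs j))

end Coefficients

/-! ### Quasi-unipotent functions of moderate growth on a half-plane -/

section HalfPlane

open Asymptotics

/-- The filter of going to infinity to the left in the strip `|Im w| ≤ A`. -/
def stripEnd (A : ℝ) : Filter ℂ := comap Complex.re atBot ⊓ 𝓟 {w | |w.im| ≤ A}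

theorem eventually_stripEnd_re_lt (A x : ℝ) : ∀ᶠ w in stripEnd A, w.re < x :=
  mem_inf_of_left (preimage_mem_comap (Iio_mem_atBot x))

theorem eventually_stripEnd_im_le (A : ℝ) : ∀ᶠ w in stripEnd A, |w.im| ≤ A :=
  mem_inf_of_right (mem_principal_self _)

theorem eventually_stripEnd_iff {A : ℝ} {p : ℂ → Prop} :
    (∀ᶠ w in stripEnd A, p w) ↔ ∃ x : ℝ, ∀ w : ℂ, w.re < x → |w.im| ≤ A → p w := by
  constructor
  · intro h
    rw [stripEnd, eventually_inf_principal, eventually_comap] at h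
    obtain ⟨x, hx⟩ := eventually_atBot.mp h
    exact ⟨x, fun w hw hA => hx w.re hw.le w rfl hA⟩
  · rintro ⟨x, hx⟩
    filter_upwards [eventually_stripEnd_re_lt A x, eventually_stripEnd_im_le A] with w h1 h2
      using hx w h1 h2

/-- Moderate growth to the left, in horizontal strips. -/
def ModGrowth (f : ℂ → ℂ) : Prop :=
  ∀ A : ℝ, ∃ K : ℝ, f =O[stripEnd A] fun w => Real.exp (-K * w.re)

theorem exp_isBigO_stripEnd (A : ℝ) {K K' : ℝ} (h : K ≤ K') :
    (fun w : ℂ => Real.exp (-K * w.re)) =O[stripEnd A] fun w => Real.exp (-K' * w.re) := by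
  refine IsBigO.of_bound 1 ?_
  filter_upwards [eventually_stripEnd_re_lt A 0] with w hw
  rw [Real.norm_eq_abs, Real.norm_eq_abs, Real.abs_exp, Real.abs_exp, one_mul, Real.exp_le_exp]
  nlinarith

theorem ModGrowth.sub {f g : ℂ → ℂ} (hf : ModGrowth f) (hg : ModGrowth g) :
    ModGrowth fun w => f w - g w := by
  intro A
  obtain ⟨K, hK⟩ := hf A
  obtain ⟨K', hK'⟩ := hg A
  exact ⟨max K K', (hK.trans (exp_isBigO_stripEnd A (le_max_left _ _))).sub
    (hK'.trans (exp_isBigO_stripEnd A (le_max_right _ _)))⟩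

theorem ModGrowth.mul {f g : ℂ → ℂ} (hf : ModGrowth f) (hg : ModGrowth g) :
    ModGrowth fun w => f w * g w := by
  intro A
  obtain ⟨K, hK⟩ := hf A
  obtain ⟨K', hK'⟩ := hg A
  refine ⟨K + K', (hK.mul hK').congr_right fun w => ?_⟩
  rw [← Real.exp_add]
  ring_nf

theorem ModGrowth.const (c : ℂ) : ModGrowth fun _ => c := fun A =>
  ⟨0, by simpa using isBigO_const_const c (one_ne_zero (α := ℝ)) (stripEnd A)⟩

theorem ModGrowth.id : ModGrowth fun w => w := by
  intro A
  refine ⟨1, IsBigO.of_bound (1 + |A|) ?_⟩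
  filter_upwards [eventually_stripEnd_re_lt A 0, eventually_stripEnd_im_le A] with w h1 h2
  rw [Real.norm_eq_abs, Real.abs_exp]
  have h3 := Real.add_one_le_exp (-1 * w.re)
  have h4 := Complex.norm_le_abs_re_add_abs_im w
  rw [abs_of_neg h1] at h4
  have h5 : A ≤ |A| := le_abs_self A
  nlinarith [abs_nonneg A]

theorem ModGrowth.pow {f : ℂ → ℂ} (hf : ModGrowth f) (n : ℕ) : ModGrowth fun w => f w ^ n := by
  induction n with
  | zero => simpa using ModGrowth.const 1
  | succ n ih => simpa [pow_succ] using ih.mul hf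

theorem ModGrowth.comp_add {f : ℂ → ℂ} (hf : ModGrowth f) (c : ℂ) :
    ModGrowth fun w => f (w + c) := by
  intro A
  obtain ⟨K, hK⟩ := hf (A + |c.im|)
  have ht : Tendsto (fun w : ℂ => w + c) (stripEnd A) (stripEnd (A + |c.im|)) := by
    intro s hs
    obtain ⟨x, hx⟩ := eventually_stripEnd_iff.mp (show ∀ᶠ w in stripEnd (A + |c.im|), w ∈ s from hs)
    refine eventually_stripEnd_iff.mpr ⟨x - c.re, fun w h1 h2 => hx _ ?_ ?_⟩
    · rw [Complex.add_re]; linarith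
    · rw [Complex.add_im]; exact (abs_add_le _ _).trans (by linarith)
  refine ⟨K, (hK.comp_tendsto ht).trans (IsBigO.of_bound (Real.exp (-K * c.re)) ?_)⟩
  refine Eventually.of_forall fun w => ?_
  simp only [Function.comp, Complex.add_re, Real.norm_eq_abs, Real.abs_exp]
  rw [← Real.exp_add]
  exact le_of_eq (by ring_nf)

theorem ModGrowth.fwdDiff {f : ℂ → ℂ} (hf : ModGrowth f) (τ : ℂ) : ModGrowth (fwdDiff τ f) :=
  (hf.comp_add τ).sub hf

theorem ModGrowth.fwdDiff_iter {f : ℂ → ℂ} (hf : ModGrowth f) (τ : ℂ) (m : ℕ) :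
    ModGrowth ((_root_.fwdDiff τ)^[m] f) := by
  induction m with
  | zero => exact hf
  | succ m ih => rw [Function.iterate_succ_apply']; exact ih.fwdDiff τ

/-! ### Finite differences with a purely imaginary step. -/

theorem isOpen_re_lt (c : ℝ) : IsOpen {w : ℂ | w.re < c} :=
  isOpen_lt Complex.continuous_re continuous_const

theorem differentiableOn_fwdDiff_iter {c : ℝ} {τ : ℂ} (hτ : τ.re = 0) {f : ℂ → ℂ}
    (hf : DifferentiableOn ℂ f {w | w.re < c}) (m : ℕ) :
    DifferentiableOn ℂ ((fwdDiff τ)^[m] f) {w | w.re < c} := by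
  induction m with
  | zero => exact hf
  | succ m ih =>
    rw [Function.iterate_succ_apply']
    refine DifferentiableOn.sub (ih.comp (differentiableOn_id.add_const τ) fun w hw => ?_) ih
    simpa [hτ] using hw

/-- Periodic functions are scalars for the difference operator. Since `τ` is imaginary, the
half-plane is stable under the shift. -/
theorem fwdDiff_iter_mul_periodic {c : ℝ} {τ : ℂ} (hτ : τ.re = 0) {u : ℂ → ℂ}
    (hu : ∀ w : ℂ, w.re < c → u (w + τ) = u w) (p : ℂ → ℂ) (j : ℕ) (w : ℂ) (hw : w.re < c) :
    (fwdDiff τ)^[j] (fun w => p w * u w) w = (fwdDiff τ)^[j] p w * u w := by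
  induction j generalizing w with
  | zero => rfl
  | succ j ih =>
    rw [Function.iterate_succ_apply', Function.iterate_succ_apply', fwdDiff, fwdDiff, ih w hw,
      ih (w + τ) (by simpa [hτ] using hw), hu w hw]
    ring

theorem fwdDiff_iter_pow_self (τ : ℂ) (m : ℕ) (t : ℂ) :
    (fwdDiff τ)^[m] (fun w => w ^ m) (τ * t) = τ ^ m * m.factorial := by
  have h1 : ∀ (j : ℕ) (p : ℂ → ℂ) (t : ℂ),
      (fwdDiff τ)^[j] p (τ * t) = (fwdDiff (1 : ℂ))^[j] (fun t => p (τ * t)) t := by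
    intro j p
    induction j with
    | zero => intro t; rfl
    | succ j ih =>
      intro t
      rw [Function.iterate_succ_apply', Function.iterate_succ_apply', fwdDiff, fwdDiff, ← ih,
        ← ih, mul_add, mul_one]
  rw [h1]
  have h2 : (fun t : ℂ => (τ * t) ^ m) = τ ^ m • fun t : ℂ => t ^ m := by
    ext t
    simp [mul_pow]
  rw [h2, fwdDiff_iter_const_smul, fwdDiff_iter_eq_factorial]
  simp

theorem fwdDiff_iter_sub' (τ : ℂ) (f g : ℂ → ℂ) (j : ℕ) (w : ℂ) :
    (fwdDiff τ)^[j] (fun w => f w - g w) w = (fwdDiff τ)^[j] f w - (fwdDiff τ)^[j] g w := by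
  induction j generalizing w with
  | zero => rfl
  | succ j ih =>
    simp only [Function.iterate_succ_apply', fwdDiff, ih]
    ring

/-- Induction on `m`: if `Δ^(m+1) f = 0`, then `v = Δ^m f` is periodic, and `w^m v / (τ^m m!)` has
the same `m`-th difference as `f`. Subtracting it leaves a function killed by `Δ^m`. -/
theorem exists_periodic_decomposition {c : ℝ} {τ : ℂ} (hτ : τ.re = 0) (hτ0 : τ ≠ 0) (m : ℕ)
    (f : ℂ → ℂ) (hd : DifferentiableOn ℂ f {w | w.re < c}) (hg : ModGrowth f)
    (h : ∀ w : ℂ, w.re < c → (fwdDiff τ)^[m] f w = 0) :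
    ∃ u : ℕ → ℂ → ℂ, (∀ k, DifferentiableOn ℂ (u k) {w | w.re < c} ∧ ModGrowth (u k) ∧
      ∀ w : ℂ, w.re < c → u k (w + τ) = u k w) ∧
      ∀ w : ℂ, w.re < c → f w = ∑ k ∈ Finset.range m, w ^ k * u k w := by
  induction m generalizing f with
  | zero =>
    refine ⟨fun _ _ => 0, fun _ => ⟨differentiableOn_const _, ModGrowth.const 0, fun _ _ => rfl⟩,
      fun w hw => ?_⟩
    simpa using h w hw
  | succ m ih =>
    set v := (fwdDiff τ)^[m] f with hv
    have hvp : ∀ w : ℂ, w.re < c → v (w + τ) = v w := by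
      intro w hw
      have := h w hw
      rw [Function.iterate_succ_apply', fwdDiff] at this
      exact sub_eq_zero.mp this
    set b : ℂ := (τ ^ m * m.factorial)⁻¹ with hb
    have hb0 : τ ^ m * (m.factorial : ℂ) ≠ 0 :=
      mul_ne_zero (pow_ne_zero _ hτ0) (by exact_mod_cast m.factorial_ne_zero)
    have hvd : DifferentiableOn ℂ v {w | w.re < c} := differentiableOn_fwdDiff_iter hτ hd m
    have hvg : ModGrowth v := hg.fwdDiff_iter τ m
    have hup : ∀ w : ℂ, w.re < c → b * v (w + τ) = b * v w := fun w hw => by rw [hvp w hw]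
    obtain ⟨u, hu, hu'⟩ := ih (fun w => f w - w ^ m * (b * v w))
      (hd.sub ((differentiableOn_id.pow m).mul (hvd.const_mul b)))
      (hg.sub ((ModGrowth.id.pow m).mul ((ModGrowth.const b).mul hvg)))
      (fun w hw => by
        rw [fwdDiff_iter_sub', fwdDiff_iter_mul_periodic hτ (u := fun w => b * v w) hup _ _ _ hw]
        have h1 := fwdDiff_iter_pow_self τ m (w / τ)
        rw [mul_div_cancel₀ _ hτ0] at h1
        rw [h1, ← hv, hb, ← mul_assoc, mul_inv_cancel₀ hb0, one_mul, sub_self])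
    refine ⟨fun k => if k = m then fun w => b * v w else u k, fun k => ?_, fun w hw => ?_⟩
    · dsimp only
      split_ifs with hk
      · exact ⟨hvd.const_mul b, (ModGrowth.const b).mul hvg, hup⟩
      · exact hu k
    · dsimp only
      rw [Finset.sum_range_succ, if_pos rfl]
      have := hu' w hw
      rw [sub_eq_iff_eq_add] at this
      rw [this]
      congr 1
      refine Finset.sum_congr rfl fun k hk => ?_
      rw [if_neg (Finset.mem_range.mp hk).ne]

/-- This is the `q`-expansion at a cusp, with `q = exp (w / N)`. The growth bound makes `q^M u`
bounded for large `M`, and the singularity at `q = 0` is then removable. All large `M` are allowed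
so that a common one can be chosen later. -/
theorem exists_analyticAt_of_periodic {c : ℝ} {N : ℕ} (hN : 0 < N) {u : ℂ → ℂ}
    (hd : DifferentiableOn ℂ u {w | w.re < c}) (hg : ModGrowth u)
    (hp : ∀ w : ℂ, w.re < c → u (w + N * (2 * Real.pi * Complex.I)) = u w) :
    ∃ M₀ : ℕ, ∀ M ≥ M₀, ∃ H : ℂ → ℂ, AnalyticAt ℂ H 0 ∧ ∃ x : ℝ, ∀ w : ℂ, w.re < x →
      u w = Complex.exp (-(M / N) * w) * H (Complex.exp (w / N)) := by
  -- A strip of this half-width contains a full period.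
  obtain ⟨K, hK⟩ := hg (2 * Real.pi * N)
  obtain ⟨C, hC0, hC⟩ := hK.exists_nonneg
  obtain ⟨x₀, hx₀⟩ := eventually_stripEnd_iff.mp hC.bound
  have hN' : (0 : ℝ) < N := by exact_mod_cast hN
  have hNc : (N : ℂ) ≠ 0 := by exact_mod_cast hN.ne'
  refine ⟨⌈K * N⌉₊, fun M hM => ?_⟩
  have hM' : K * N ≤ M := (Nat.le_ceil _).trans (by exact_mod_cast hM)
  -- This substitution makes the period `1` and carries the upper half-plane to the left one.
  set W : ℂ → ℂ := fun z => N * (2 * Real.pi * Complex.I) * z with hW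
  have hWre : ∀ z, (W z).re = -(2 * Real.pi * N) * z.im := fun z => by
    simp [hW, Complex.mul_re, Complex.mul_im]; left; ring
  have hWim : ∀ z, (W z).im = 2 * Real.pi * N * z.re := fun z => by
    simp [hW, Complex.mul_re, Complex.mul_im]; left; ring
  classical
  -- The value `0` outside the half-plane makes `f` periodic on all of `ℂ`. The exponential factor
  -- keeps the period because `M` is an integer.
  set f : ℂ → ℂ := fun z => if (W z).re < c then
    Complex.exp ((M / N) * W z) * u (W z) else 0 with hf
  have hfp : Function.Periodic f (1 : ℝ) := by
    intro z
    have h1 : W (z + (1 : ℝ)) = W z + N * (2 * Real.pi * Complex.I) := by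
      simp only [hW]; push_cast; ring
    have h2 : (W (z + (1 : ℝ))).re = (W z).re := by rw [hWre, hWre]; simp
    simp only [hf, h2]
    split_ifs with h3
    · rw [h1, hp _ h3]
      congr 1
      have : (M / N : ℂ) * (W z + N * (2 * Real.pi * Complex.I)) =
          M / N * W z + M * (2 * Real.pi * Complex.I) := by field_simp
      rw [this, Complex.exp_add]
      have h4 := Complex.exp_nat_mul (2 * Real.pi * Complex.I) M
      rw [h4, Complex.exp_two_pi_mul_I, one_pow, mul_one]
    · rfl
  have him : ∀ x : ℝ, ∀ᶠ z in comap Complex.im atTop, (W z).re < x := by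
    intro x
    have : ∀ᶠ y : ℝ in atTop, -(2 * Real.pi * N) * y < x := by
      have h1 : Tendsto (fun y : ℝ => -(2 * Real.pi * N) * y) atTop atBot :=
        tendsto_id.const_mul_atTop_of_neg (by have := Real.pi_pos; simp; positivity)
      exact h1.eventually (Iio_mem_atBot x)
    filter_upwards [preimage_mem_comap this] with z hz
    rw [hWre]
    exact hz
  have hhol : ∀ᶠ z in comap Complex.im atTop, DifferentiableAt ℂ f z := by
    filter_upwards [him c] with z hz
    have hWd : Differentiable ℂ W := by simp only [hW]; fun_prop
    have h1 : f =ᶠ[𝓝 z] fun z => Complex.exp ((M / N) * W z) * u (W z) := by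
      have h2 : IsOpen {z | (W z).re < c} := (isOpen_re_lt c).preimage hWd.continuous
      filter_upwards [h2.mem_nhds hz] with y hy
      simp only [hf]
      rw [if_pos hy]
    refine DifferentiableAt.congr_of_eventuallyEq ?_ h1
    refine DifferentiableAt.mul (by fun_prop) ?_
    exact ((hd.differentiableAt ((isOpen_re_lt c).mem_nhds hz))).comp z (hWd z)
  have hbd : BoundedAtFilter (comap Complex.im atTop) f := by
    refine IsBigO.of_bound C ?_
    filter_upwards [him x₀, him 0] with z hz hz0
    -- The growth bound holds only in a strip, so the real part is first moved to `[0, 1)`.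
    have h1 : f z = f (z - (⌊z.re⌋ : ℤ)) := by
      have := hfp.sub_int_mul_eq ⌊z.re⌋ (x := z)
      simpa using this.symm
    rw [h1]
    set y := z - (⌊z.re⌋ : ℤ) with hy
    have hyim : y.im = z.im := by simp [hy]
    have hyre : y.re = Int.fract z.re := by simp [hy]
    have hyW : (W y).re = (W z).re := by rw [hWre, hWre, hyim]
    simp only [hf]
    split_ifs with h2
    · have h3 := hx₀ (W y) (by rw [hyW]; exact hz) (by
        rw [hWim, hyre, abs_of_nonneg (mul_nonneg (by have := Real.pi_pos; positivity)
          (Int.fract_nonneg _))]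
        exact mul_le_of_le_one_right (by have := Real.pi_pos; positivity) (Int.fract_lt_one _).le)
      rw [norm_mul, Complex.norm_exp]
      rw [Real.norm_eq_abs, Real.abs_exp] at h3
      have h4 : ((M / N : ℂ) * W y).re = M / N * (W y).re := by
        have : (M / N : ℂ) = ((M / N : ℝ) : ℂ) := by push_cast; rfl
        rw [this, Complex.re_ofReal_mul]
      rw [h4]
      have h5 : (W y).re < 0 := by rw [hyW]; exact hz0
      have h6 : K ≤ M / N := by rw [le_div_iff₀ hN']; exact hM'
      calc _ ≤ Real.exp (M / N * (W y).re) * (C * Real.exp (-K * (W y).re)) := by gcongr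
        _ = C * Real.exp ((M / N - K) * (W y).re) := by
          rw [mul_left_comm, ← Real.exp_add]; ring_nf
        _ ≤ C * 1 := by
          gcongr
          rw [Real.exp_le_one_iff]
          nlinarith
        _ = _ := by simp
    · simp [hC0]
  have hdiff0 := Function.Periodic.differentiableAt_cuspFunction_zero one_pos hfp hhol hbd
  have hdne := Function.Periodic.eventually_differentiableAt_cuspFunction_nhds_ne_zero
    one_pos hfp hhol
  refine ⟨Function.Periodic.cuspFunction 1 f, ?_, c, fun w hw => ?_⟩
  · rw [Complex.analyticAt_iff_eventually_differentiableAt]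
    have := eventually_nhdsWithin_iff.mp hdne
    filter_upwards [this] with q hq
    by_cases h0 : q = 0
    · rw [h0]; exact hdiff0
    · exact hq h0
  · have hpi : (2 * Real.pi * Complex.I : ℂ) ≠ 0 := Complex.two_pi_I_ne_zero
    set z := w / (N * (2 * Real.pi * Complex.I)) with hz
    have hWz : W z = w := by
      simp only [hW, hz]
      field_simp
    have h1 := Function.Periodic.eq_cuspFunction one_ne_zero hfp z
    have h2 : Function.Periodic.qParam 1 z = Complex.exp (w / N) := by
      rw [Function.Periodic.qParam]
      congr 1
      rw [hz]
      push_cast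
      field_simp
    rw [← h2, h1]
    simp only [hf]
    rw [hWz, if_pos hw, ← mul_assoc, ← Complex.exp_add]
    simp

theorem exists_log_expansion {c : ℝ} {N : ℕ} (hN : 0 < N) (m : ℕ) {f : ℂ → ℂ}
    (hd : DifferentiableOn ℂ f {w | w.re < c}) (hg : ModGrowth f)
    (h : ∀ w : ℂ, w.re < c → (fwdDiff (N * (2 * Real.pi * Complex.I)))^[m] f w = 0) :
    ∃ M₀ : ℕ, ∀ M ≥ M₀, ∃ H : ℕ → ℂ → ℂ, (∀ k, AnalyticAt ℂ (H k) 0) ∧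
      ∃ x : ℝ, ∀ w : ℂ, w.re < x → f w = ∑ k ∈ Finset.range m,
        w ^ k * (Complex.exp (-(M / N) * w) * H k (Complex.exp (w / N))) := by
  have hNc : (N : ℂ) ≠ 0 := by exact_mod_cast hN.ne'
  obtain ⟨u, hu, hu'⟩ := exists_periodic_decomposition (τ := N * (2 * Real.pi * Complex.I))
    (by simp) (mul_ne_zero hNc Complex.two_pi_I_ne_zero) m f hd hg h
  choose M₀ hM₀ using fun k => exists_analyticAt_of_periodic hN (hu k).1 (hu k).2.1 (hu k).2.2
  refine ⟨(Finset.range m).sup M₀, fun M hM => ?_⟩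
  have : ∀ k, ∃ H : ℂ → ℂ, AnalyticAt ℂ H 0 ∧ ∃ x : ℝ, k ∈ Finset.range m → ∀ w : ℂ, w.re < x →
      u k w = Complex.exp (-(M / N) * w) * H (Complex.exp (w / N)) := by
    intro k
    by_cases hk : k ∈ Finset.range m
    · obtain ⟨H, hH, x, hx⟩ := hM₀ k M ((Finset.le_sup hk).trans hM)
      exact ⟨H, hH, x, fun _ => hx⟩
    · exact ⟨0, analyticAt_const, 0, fun h => absurd h hk⟩
  choose H hH x hx using this
  obtain ⟨y, hy⟩ := (Finset.range m).finite_toSet.image x |>.bddBelow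
  refine ⟨H, hH, min c y, fun w hw => ?_⟩
  rw [hu' w (lt_of_lt_of_le hw (min_le_left _ _))]
  refine Finset.sum_congr rfl fun k hk => ?_
  rw [← hx k hk w (lt_of_lt_of_le hw ((min_le_right _ _).trans
    (hy (Set.mem_image_of_mem x hk))))]

/-- Restriction to the half-plane. -/
def resHalfPlane (δ : ℝ) (f : ℂ → ℂ) : logHalfPlane δ → ℂ := fun w => f w

/-! ### Monodromy as a difference operator. -/

theorem localMonodromy_pow_res (δ : ℝ) (N : ℕ) (f : ℂ → ℂ) :
    (localMonodromy δ ^ N) (resHalfPlane δ f) =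
      resHalfPlane δ fun w => f (w + N * (2 * Real.pi * Complex.I)) := by
  induction N with
  | zero => simp
  | succ N ih =>
    rw [pow_succ', Module.End.mul_apply, ih]
    ext w
    simp only [localMonodromy, LinearMap.funLeft_apply, resHalfPlane, logShift]
    congr 1
    push_cast
    ring

theorem localMonodromy_sub_one_pow_res (δ : ℝ) (N m : ℕ) (f : ℂ → ℂ) :
    ((localMonodromy δ ^ N - 1) ^ m) (resHalfPlane δ f) =
      resHalfPlane δ ((fwdDiff (N * (2 * Real.pi * Complex.I)))^[m] f) := by
  induction m with
  | zero => rfl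
  | succ m ih =>
    rw [pow_succ', Module.End.mul_apply, ih, Function.iterate_succ_apply', LinearMap.sub_apply,
      localMonodromy_pow_res]
    rfl

/-- For `N` a common multiple of the exponents, every linear factor of `P` divides `X^N - 1`, and
there are `P.roots.card` factors. Letting `N` and `m` grow makes it possible to treat several
singular points together. -/
theorem exists_poly_dvd (P : Polynomial ℂ) (hP : P ≠ 0)
    (h : ∀ μ, P.IsRoot μ → ∃ N : ℕ, 0 < N ∧ μ ^ N = 1) :
    ∃ N₀ m₀ : ℕ, 0 < N₀ ∧ ∀ N, N₀ ∣ N → ∀ m ≥ m₀, P ∣ (Polynomial.X ^ N - 1) ^ m := by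
  choose! n hn0 hn1 using h
  refine ⟨∏ μ ∈ P.roots.toFinset, n μ, P.roots.card, Finset.prod_pos fun μ hμ =>
    hn0 μ (Polynomial.isRoot_of_mem_roots (Multiset.mem_toFinset.mp hμ)), fun N hN m hm => ?_⟩
  have h1 := (IsAlgClosed.splits P).eq_prod_roots
  refine dvd_trans ?_ (pow_dvd_pow _ hm)
  rw [h1]
  have hl : IsUnit (Polynomial.C P.leadingCoeff) :=
    Polynomial.isUnit_C.mpr (isUnit_iff_ne_zero.mpr (Polynomial.leadingCoeff_ne_zero.mpr hP))
  refine hl.mul_left_dvd.mpr ?_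
  have h2 : (Polynomial.X ^ N - 1 : Polynomial ℂ) ^ P.roots.card =
      (P.roots.map fun _ => (Polynomial.X ^ N - 1 : Polynomial ℂ)).prod := by simp
  rw [← h1, h2]
  refine Multiset.prod_dvd_prod_of_dvd _ _ fun μ hμ => ?_
  rw [Polynomial.dvd_iff_isRoot, Polynomial.IsRoot.def]
  have h3 : n μ ∣ N := (Finset.dvd_prod_of_mem n (Multiset.mem_toFinset.mpr hμ)).trans hN
  obtain ⟨k, rfl⟩ := h3
  simp [pow_mul, hn1 μ (Polynomial.isRoot_of_mem_roots hμ)]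

/-- The minimal polynomial of the monodromy on the space of determinations has only roots of unity
as roots, so it divides some `(X^N - 1)^m`; and `T^N - 1` is the difference operator with step
`2πiN`. -/
theorem IsQuasiUnipotent.exists_fwdDiff_eq_zero {δ : ℝ} {F : ℂ → ℂ} (hF : IsQuasiUnipotent δ F) :
    ∃ N₀ m₀ : ℕ, 0 < N₀ ∧ ∀ N, N₀ ∣ N → ∀ m ≥ m₀, ∀ w : ℂ, w.re < Real.log δ →
      (fwdDiff (N * (2 * Real.pi * Complex.I)))^[m] F w = 0 := by
  obtain ⟨hfd, hev⟩ := hF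
  set V := determinations δ F with hV
  set T := localMonodromy δ with hT
  have hTV : ∀ v ∈ V, T v ∈ V := by
    intro v hv
    have : V ≤ V.comap T := by
      rw [hV, determinations, Submodule.span_le]
      rintro _ ⟨k, rfl⟩
      refine Submodule.subset_span ⟨k + 1, ?_⟩
      ext w
      simp only [hT, localMonodromy, LinearMap.funLeft_apply, logShift]
      congr 1
      push_cast
      ring
    exact this hv
  set TV : Module.End ℂ V := T.restrict hTV with hTVdef
  have hint : IsIntegral ℂ TV := Algebra.IsIntegral.isIntegral TV
  obtain ⟨N₀, m₀, hN₀, hdvd⟩ := exists_poly_dvd (minpoly ℂ TV) (minpoly.ne_zero hint) (by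
    intro μ hμ
    have h1 : TV.HasEigenvalue μ := Module.End.hasEigenvalue_iff_isRoot.mpr hμ
    obtain ⟨v, hv⟩ := h1.exists_hasEigenvector
    refine hev μ v v.2 (fun h => hv.2 (Subtype.ext h)) ?_
    have := congrArg Subtype.val hv.apply_eq_smul
    simpa [hTVdef] using this)
  refine ⟨N₀, m₀, hN₀, fun N hN m hm w hw => ?_⟩
  have h0 : (TV ^ N - 1) ^ m = 0 := by
    simpa using minpoly.dvd_iff.mp (hdvd N hN m hm)
  have hFV : resHalfPlane δ F ∈ V := by
    refine Submodule.subset_span ⟨0, ?_⟩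
    ext w
    simp [logShift, resHalfPlane]
  have h1 : ∀ (j : ℕ) (v : V), (((TV ^ N - 1) ^ j) v : logHalfPlane δ → ℂ) =
      ((T ^ N - 1) ^ j) (v : logHalfPlane δ → ℂ) := by
    have h2 : ∀ (j : ℕ) (v : V), ((TV ^ j) v : logHalfPlane δ → ℂ) =
        (T ^ j) (v : logHalfPlane δ → ℂ) := by
      intro j
      induction j with
      | zero => intro v; rfl
      | succ j ih =>
        intro v
        rw [pow_succ', pow_succ', Module.End.mul_apply, Module.End.mul_apply, ← ih]
        rfl
    intro j
    induction j with
    | zero => intro v; rfl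
    | succ j ih =>
      intro v
      rw [pow_succ', pow_succ', Module.End.mul_apply, Module.End.mul_apply, ← ih,
        LinearMap.sub_apply, LinearMap.sub_apply, ← h2]
      rfl
  have h2 := h1 m ⟨_, hFV⟩
  rw [h0, hT, localMonodromy_sub_one_pow_res] at h2
  exact (congrFun h2 ⟨w, hw⟩).symm

theorem HasModerateGrowth.modGrowth {δ : ℝ} {F : ℂ → ℂ} (hF : HasModerateGrowth δ F) :
    ModGrowth F := by
  intro A
  obtain ⟨C, K, ε, hε, -, h⟩ := hF A
  refine ⟨K, IsBigO.of_bound C (eventually_stripEnd_iff.mpr ⟨Real.log ε, fun w h1 h2 => ?_⟩)⟩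
  rw [Real.norm_eq_abs, Real.abs_exp]
  exact h w h1 h2

/-- A quasi-unipotent function of moderate growth, in a translate of the logarithmic coordinate,
is a polynomial in the coordinate with coefficients that are convergent Puiseux series. -/
theorem exists_puiseux_log_expansion {δ : ℝ} {F : ℂ → ℂ} (κ : ℂ)
    (hd : DifferentiableOn ℂ F (logHalfPlane δ)) (hF : IsQuasiUnipotent δ F)
    (hg : HasModerateGrowth δ F) :
    ∃ N₀ m₀ : ℕ, 0 < N₀ ∧ ∀ N, 0 < N → N₀ ∣ N → ∀ m ≥ m₀, ∃ M₀ : ℕ, ∀ M ≥ M₀,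
      ∃ H : ℕ → ℂ → ℂ, (∀ k, AnalyticAt ℂ (H k) 0) ∧ ∃ x : ℝ, ∀ w : ℂ, w.re < x →
        F (w + κ) = ∑ k ∈ Finset.range m,
          w ^ k * (Complex.exp (-(M / N) * w) * H k (Complex.exp (w / N))) := by
  obtain ⟨N₀, m₀, hN₀, h⟩ := hF.exists_fwdDiff_eq_zero
  refine ⟨N₀, m₀, hN₀, fun N hN hdvd m hm => ?_⟩
  have hκ : ∀ w : ℂ, w.re < Real.log δ - κ.re → (w + κ).re < Real.log δ := fun w hw => by
    rw [Complex.add_re]; linarith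
  refine exists_log_expansion (c := Real.log δ - κ.re) hN m (f := fun w => F (w + κ)) ?_
    (hg.modGrowth.comp_add κ) fun w hw => ?_
  · exact hd.comp (differentiableOn_id.add_const κ) fun w hw => hκ w hw
  · rw [fwdDiff_iter_comp_add]
    exact h N hdvd m hm _ (hκ w hw)

end HalfPlane

/-! ### Analytic continuation along paths -/

section Continuation

/-- Analytic continuation along a path defined on a set of real parameters. -/
def ContinuationOn (γ : ℝ → ℂ) (f : ℝ → ℂ → ℂ) (I : Set ℝ) : Prop :=
  ∀ t ∈ I, AnalyticAt ℂ (f t) (γ t) ∧ ∀ᶠ s in 𝓝[I] t, f s =ᶠ[𝓝 (γ s)] f t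

theorem ContinuationOn.mono {γ : ℝ → ℂ} {f : ℝ → ℂ → ℂ} {I J : Set ℝ} (h : ContinuationOn γ f I)
    (hJ : J ⊆ I) : ContinuationOn γ f J := fun t ht =>
  ⟨(h t (hJ ht)).1, (h t (hJ ht)).2.filter_mono (nhdsWithin_mono t hJ)⟩

theorem continuationOn_const {γ : ℝ → ℂ} {g : ℂ → ℂ} {I : Set ℝ}
    (h : ∀ t ∈ I, AnalyticAt ℂ g (γ t)) : ContinuationOn γ (fun _ => g) I := fun t ht =>
  ⟨h t ht, Eventually.of_forall fun _ => EventuallyEq.rfl⟩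

theorem eventuallyEq_transfer {U : Set ℂ} (hU : IsOpen U) (hc : IsPreconnected U) {f g : ℂ → ℂ}
    (hf : AnalyticOnNhd ℂ f U) (hg : AnalyticOnNhd ℂ g U) {x y : ℂ} (hx : x ∈ U) (hy : y ∈ U)
    (h : f =ᶠ[𝓝 x] g) : f =ᶠ[𝓝 y] g :=
  Filter.eventuallyEq_of_mem (hU.mem_nhds hy)
    (hf.eqOn_of_preconnected_of_eventuallyEq hg hc hx h)

theorem AnalyticAt.exists_ball {f : ℂ → ℂ} {z : ℂ} (hf : AnalyticAt ℂ f z) :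
    ∃ r > 0, AnalyticOnNhd ℂ f (Metric.ball z r) := by
  obtain ⟨r, hr, h⟩ := Metric.eventually_nhds_iff_ball.mp hf.eventually_analyticAt
  exact ⟨r, hr, h⟩

/-- By the identity theorem on a small disk, agreement of the two germs is a locally constant
property of the parameter. -/
theorem ContinuationOn.unique {γ : ℝ → ℂ} {f f' : ℝ → ℂ → ℂ} {I : Set ℝ}
    (hf : ContinuationOn γ f I) (hf' : ContinuationOn γ f' I) (hI : IsPreconnected I)
    (hγ : ContinuousOn γ I) {s t : ℝ} (hs : s ∈ I) (ht : t ∈ I) (h : f s =ᶠ[𝓝 (γ s)] f' s) :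
    f t =ᶠ[𝓝 (γ t)] f' t := by
  refine (hI.induction₂ (P := fun s t => f s =ᶠ[𝓝 (γ s)] f' s ↔ f t =ᶠ[𝓝 (γ t)] f' t)
    ?_ ?_ ?_ hs ht).mp h
  · intro t ht
    obtain ⟨r, hr, h1⟩ := (hf t ht).1.exists_ball
    obtain ⟨r', hr', h2⟩ := (hf' t ht).1.exists_ball
    set B := Metric.ball (γ t) (min r r')
    have hB1 : AnalyticOnNhd ℂ (f t) B := h1.mono (Metric.ball_subset_ball (min_le_left _ _))
    have hB2 : AnalyticOnNhd ℂ (f' t) B := h2.mono (Metric.ball_subset_ball (min_le_right _ _))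
    have hB0 : γ t ∈ B := Metric.mem_ball_self (lt_min hr hr')
    have hBo : IsOpen B := Metric.isOpen_ball
    have hBc : IsPreconnected B := (convex_ball _ _).isPreconnected
    filter_upwards [(hf t ht).2, (hf' t ht).2, hγ t ht (hBo.mem_nhds hB0)] with s e1 e2 hs
    constructor
    · intro h
      exact e1.trans ((eventuallyEq_transfer hBo hBc hB1 hB2 hB0 hs h).trans e2.symm)
    · intro h
      exact eventuallyEq_transfer hBo hBc hB1 hB2 hs hB0 (e1.symm.trans (h.trans e2))
  · intro x y z _ _ _ h1 h2
    exact h1.trans h2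
  · intro x y _ _ h
    exact h.symm

/-- Compactness gives one radius that serves all germs along the path. -/
theorem ContinuationOn.exists_radius {γ : ℝ → ℂ} {f : ℝ → ℂ → ℂ} {I : Set ℝ}
    (hf : ContinuationOn γ f I) (hI : IsCompact I) (hγ : ContinuousOn γ I) :
    ∃ r > 0, ∀ t ∈ I, ∃ h : ℂ → ℂ, AnalyticOnNhd ℂ h (Metric.ball (γ t) r) ∧
      h =ᶠ[𝓝 (γ t)] f t := by
  refine hI.induction_on (p := fun s => ∃ r > 0, ∀ t ∈ s, ∃ h : ℂ → ℂ,
    AnalyticOnNhd ℂ h (Metric.ball (γ t) r) ∧ h =ᶠ[𝓝 (γ t)] f t) ?_ ?_ ?_ ?_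
  · exact ⟨1, one_pos, fun t ht => absurd ht (Set.notMem_empty t)⟩
  · rintro s s' hss ⟨r, hr, h⟩
    exact ⟨r, hr, fun t ht => h t (hss ht)⟩
  · rintro s s' ⟨r, hr, h⟩ ⟨r', hr', h'⟩
    refine ⟨min r r', lt_min hr hr', fun t ht => ?_⟩
    rcases ht with ht | ht
    · obtain ⟨k, hk, e⟩ := h t ht
      exact ⟨k, hk.mono (Metric.ball_subset_ball (min_le_left _ _)), e⟩
    · obtain ⟨k, hk, e⟩ := h' t ht
      exact ⟨k, hk.mono (Metric.ball_subset_ball (min_le_right _ _)), e⟩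
  · intro t ht
    obtain ⟨r, hr, h1⟩ := (hf t ht).1.exists_ball
    refine ⟨_, inter_mem (hf t ht).2 (hγ t ht (Metric.ball_mem_nhds (γ t) (half_pos hr))),
      r / 2, half_pos hr, fun s hs => ⟨f t, h1.mono ?_, hs.1.symm⟩⟩
    refine Metric.ball_subset_ball' ?_
    have : dist (γ s) (γ t) < r / 2 := hs.2
    linarith

/-- Continuation along a segment is given by one function near the segment. -/
theorem ContinuationOn.exists_thickening {w₀ w : ℂ} {f : ℝ → ℂ → ℂ}
    (hf : ContinuationOn (AffineMap.lineMap (k := ℝ) w₀ w) f (Set.Icc (0 : ℝ) 1)) :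
    ∃ r > 0, ∃ H : ℂ → ℂ,
      AnalyticOnNhd ℂ H
        (Metric.thickening r (AffineMap.lineMap (k := ℝ) w₀ w '' Set.Icc (0 : ℝ) 1)) ∧
      ∀ t ∈ Set.Icc (0 : ℝ) 1, H =ᶠ[𝓝 (AffineMap.lineMap (k := ℝ) w₀ w t)] f t := by
  set γ : ℝ → ℂ := ⇑(AffineMap.lineMap (k := ℝ) w₀ w) with hγdef
  have hγ : Continuous γ := AffineMap.lineMap_continuous (R := ℝ) (p := w₀) (q := w)
  obtain ⟨r, hr, h⟩ := hf.exists_radius isCompact_Icc hγ.continuousOn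
  choose! h hA hE using h
  -- The functions on the disks agree wherever two disks meet: because the path is affine, the
  -- parameters whose disk contains `z` form an interval, and along it the value at `z` is locally
  -- constant.
  have hwd : ∀ z : ℂ, ∀ s ∈ Set.Icc (0 : ℝ) 1, ∀ t ∈ Set.Icc (0 : ℝ) 1,
      z ∈ Metric.ball (γ s) r → z ∈ Metric.ball (γ t) r → h s z = h t z := by
    intro z s hs t ht hzs hzt
    set J := {u : ℝ | u ∈ Set.Icc (0 : ℝ) 1 ∧ z ∈ Metric.ball (γ u) r} with hJ
    have hJc : Convex ℝ J := by
      have h1 : J = Set.Icc (0 : ℝ) 1 ∩ γ ⁻¹' Metric.ball z r := by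
        ext u
        simp only [hJ, Set.mem_inter_iff, Set.mem_preimage, Metric.mem_ball, Set.mem_ofPred_eq,
          dist_comm]
      rw [h1]
      exact (convex_Icc 0 1).inter ((convex_ball z r).affine_preimage
        (AffineMap.lineMap w₀ w : ℝ →ᵃ[ℝ] ℂ))
    refine hJc.isPreconnected.induction₂ (P := fun s t => h s z = h t z) ?_
      (fun x y z _ _ _ h1 h2 => h1.trans h2) (fun x y _ _ h => h.symm) ⟨hs, hzs⟩ ⟨ht, hzt⟩
    intro u hu
    have h1 := (hf u hu.1).2.filter_mono (nhdsWithin_mono u (show J ⊆ _ from fun v hv => hv.1))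
    have h2 : ∀ᶠ v in 𝓝[J] u, γ v ∈ Metric.ball (γ u) r :=
      (hγ.continuousAt.eventually (Metric.ball_mem_nhds _ hr)).filter_mono nhdsWithin_le_nhds
    have h3 : ∀ᶠ v in 𝓝[J] u, h u =ᶠ[𝓝 (γ v)] f u :=
      (hγ.continuousAt.eventually (hE u hu.1).eventually_nhds).filter_mono nhdsWithin_le_nhds
    filter_upwards [h1, h2, h3, self_mem_nhdsWithin] with v e1 e2 e4 hv
    have hUc : IsPreconnected (Metric.ball (γ u) r ∩ Metric.ball (γ v) r) :=
      ((convex_ball _ _).inter (convex_ball _ _)).isPreconnected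
    have e3 : h u =ᶠ[𝓝 (γ v)] h v := e4.trans (e1.symm.trans (hE v hv.1).symm)
    exact ((hA u hu.1).mono Set.inter_subset_left).eqOn_of_preconnected_of_eventuallyEq
      ((hA v hv.1).mono Set.inter_subset_right) hUc ⟨e2, Metric.mem_ball_self hr⟩ e3
      ⟨hu.2, hv.2⟩
  classical
  set T := Metric.thickening r (γ '' Set.Icc (0 : ℝ) 1) with hT
  have hex : ∀ z ∈ T, ∃ t ∈ Set.Icc (0 : ℝ) 1, z ∈ Metric.ball (γ t) r := by
    intro z hz
    obtain ⟨_, ⟨t, ht, rfl⟩, hd⟩ := Metric.mem_thickening_iff.mp hz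
    exact ⟨t, ht, hd⟩
  choose! τ hτ1 hτ2 using hex
  have key : ∀ t ∈ Set.Icc (0 : ℝ) 1, ∀ z ∈ Metric.ball (γ t) r, h (τ z) z = h t z := by
    intro t ht z hz
    have hzT : z ∈ T := Metric.mem_thickening_iff.mpr ⟨γ t, ⟨t, ht, rfl⟩, hz⟩
    exact hwd z _ (hτ1 z hzT) _ ht (hτ2 z hzT) hz
  refine ⟨r, hr, fun z => h (τ z) z, fun z hz => ?_, fun t ht => ?_⟩
  · have h1 := hτ2 z hz
    refine (hA _ (hτ1 z hz) z h1).congr ?_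
    filter_upwards [Metric.isOpen_ball.mem_nhds h1] with y hy using (key _ (hτ1 z hz) y hy).symm
  · refine EventuallyEq.trans ?_ (hE t ht)
    filter_upwards [Metric.ball_mem_nhds (γ t) hr] with y hy using key t ht y hy

/-- The monodromy theorem on star-shaped open sets. -/
theorem exists_analytic_of_continuation {U : Set ℂ} (hU : IsOpen U) {w₀ : ℂ} (hw₀ : w₀ ∈ U)
    {φ : ℂ → ℂ} (h : ∀ w ∈ U, ∃ f : ℝ → ℂ → ℂ,
      ContinuationOn (AffineMap.lineMap w₀ w) f (Set.Icc (0 : ℝ) 1) ∧ f 0 =ᶠ[𝓝 w₀] φ) :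
    ∃ F : ℂ → ℂ, AnalyticOnNhd ℂ F U ∧ F =ᶠ[𝓝 w₀] φ := by
  choose! f hf hf0 using h
  have h01 : (0 : ℝ) ∈ Set.Icc (0 : ℝ) 1 := ⟨le_rfl, zero_le_one⟩
  have h11 : (1 : ℝ) ∈ Set.Icc (0 : ℝ) 1 := ⟨zero_le_one, le_rfl⟩
  have key : ∀ w ∈ U, ∃ H : ℂ → ℂ, AnalyticAt ℂ H w ∧ H =ᶠ[𝓝 w₀] φ ∧
      ∀ᶠ v in 𝓝 w, f v 1 v = H v := by
    intro w hw
    obtain ⟨r, hr, H, hH, hHf⟩ := (hf w hw).exists_thickening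
    have h0 := hHf 0 h01
    rw [AffineMap.lineMap_apply_zero] at h0
    have hHφ := h0.trans (hf0 w hw)
    refine ⟨H, hH w (Metric.mem_thickening_iff.mpr ⟨w, ⟨1, h11, by simp⟩, by simpa using hr⟩),
      hHφ, ?_⟩
    filter_upwards [Metric.ball_mem_nhds w hr, hU.mem_nhds hw] with v hv hvU
    -- The segment to a nearby `v` stays within `r` of the segment to `w`, so the same `H` continues
    -- `φ` along both.
    have h1 : ContinuationOn (AffineMap.lineMap w₀ v) (fun _ => H) (Set.Icc (0 : ℝ) 1) := by
      refine continuationOn_const fun t ht => hH _ (Metric.mem_thickening_iff.mpr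
        ⟨AffineMap.lineMap w₀ w t, ⟨t, ht, rfl⟩, ?_⟩)
      have h2 : (AffineMap.lineMap w₀ v t : ℂ) - AffineMap.lineMap w₀ w t = t • (v - w) := by
        simp only [AffineMap.lineMap_apply, vsub_eq_sub, vadd_eq_add, smul_sub]
        ring
      rw [dist_eq_norm, h2, norm_smul, Real.norm_of_nonneg ht.1, ← dist_eq_norm]
      have : dist v w < r := hv
      nlinarith [ht.2, ht.1, dist_nonneg (x := v) (y := w)]
    have h3 := (hf v hvU).unique h1 isPreconnected_Icc AffineMap.lineMap_continuous.continuousOn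
      h01 h11 (by
        rw [AffineMap.lineMap_apply_zero]
        exact (hf0 v hvU).trans hHφ.symm)
    have h4 := h3.eq_of_nhds
    rwa [AffineMap.lineMap_apply_one] at h4
  refine ⟨fun w => f w 1 w, fun w hw => ?_, ?_⟩
  · obtain ⟨H, hH, -, he⟩ := key w hw
    exact hH.congr (EventuallyEq.symm he)
  · obtain ⟨H, -, hφ, he⟩ := key w₀ hw₀
    exact EventuallyEq.trans he hφ

end Continuation

/-! ### Branches near the circle of convergence -/

section Branches

/-- A starting point is bad only if it lies on a real line through `z` and a point of `Λ`; finitely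
many lines are a null set and cannot cover a disk. This is needed because `Λ` may meet the disk of
convergence. -/
theorem exists_segment_avoiding (Λ : Finset ℂ) {ρ : ℝ} (hρ : 0 < ρ) {z : ℂ} (hz : z ∉ Λ) :
    ∃ w ∈ Metric.ball (0 : ℂ) ρ, ∀ t ∈ Set.Icc (0 : ℝ) 1,
      (AffineMap.lineMap w z t : ℂ) ∉ Λ := by
  by_contra! hcon
  have hsub : Metric.ball (0 : ℂ) ρ ⊆
      ⋃ q ∈ Λ, (AffineSubspace.mk' z (Submodule.span ℝ {q - z}) : Set ℂ) := by
    intro w hw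
    obtain ⟨t, ht, hq⟩ := hcon w hw
    simp only [Set.mem_iUnion]
    refine ⟨_, hq, ?_⟩
    have h1 : (AffineMap.lineMap w z t : ℂ) - z = (1 - t) • (w - z) := by
      simp only [AffineMap.lineMap_apply, vsub_eq_sub, vadd_eq_add, Complex.real_smul]
      push_cast
      ring
    have h2 : 1 - t ≠ 0 := by
      intro h
      have : t = 1 := by linarith
      rw [this, AffineMap.lineMap_apply_one] at hq
      exact hz hq
    rw [SetLike.mem_coe, AffineSubspace.mem_mk', vsub_eq_sub, Submodule.mem_span_singleton]
    exact ⟨(1 - t)⁻¹, by rw [h1, smul_smul, inv_mul_cancel₀ h2, one_smul]⟩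
  have hnull : MeasureTheory.volume
      (⋃ q ∈ Λ, (AffineSubspace.mk' z (Submodule.span ℝ {q - z}) : Set ℂ)) = 0 := by
    refine (MeasureTheory.measure_biUnion_null_iff Λ.countable_toSet).mpr fun q _ => ?_
    refine MeasureTheory.Measure.addHaar_affineSubspace _ _ fun h => ?_
    have h1 := congrArg AffineSubspace.direction h
    rw [AffineSubspace.direction_mk', AffineSubspace.direction_top] at h1
    have h2 := finrank_span_le_card (R := ℝ) ({q - z} : Set ℂ)
    rw [h1, finrank_top, Complex.finrank_real_complex] at h2
    simp at h2
  exact (Metric.measure_ball_pos MeasureTheory.volume (0 : ℂ) hρ).ne'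
    (MeasureTheory.measure_mono_null hsub hnull)

variable {Λ : Finset ℂ} {ρ R : ℝ} {G g : ℂ → ℂ}

/-- Two consecutive paths, as one path. -/
noncomputable def concatPath (γ₁ γ₂ : ℝ → ℂ) (t : ℝ) : ℂ :=
  γ₁ (min (2 * t) 1) + (γ₂ (max (2 * t - 1) 0) - γ₂ 0)

theorem concatPath_of_le {γ₁ γ₂ : ℝ → ℂ} {t : ℝ} (ht : t ≤ 1 / 2) :
    concatPath γ₁ γ₂ t = γ₁ (2 * t) := by
  rw [concatPath, min_eq_left (by linarith), max_eq_right (by linarith), sub_self, add_zero]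

theorem concatPath_of_ge {γ₁ γ₂ : ℝ → ℂ} (h : γ₁ 1 = γ₂ 0) {t : ℝ} (ht : 1 / 2 ≤ t) :
    concatPath γ₁ γ₂ t = γ₂ (2 * t - 1) := by
  rw [concatPath, min_eq_right (by linarith), max_eq_left (by linarith), h]
  ring

theorem continuousOn_concatPath {γ₁ γ₂ : ℝ → ℂ} (h₁ : ContinuousOn γ₁ (Set.Icc 0 1))
    (h₂ : ContinuousOn γ₂ (Set.Icc 0 1)) : ContinuousOn (concatPath γ₁ γ₂) (Set.Icc 0 1) := by
  refine ContinuousOn.add (h₁.comp (by fun_prop) fun t ht => ?_)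
    (ContinuousOn.sub (h₂.comp (by fun_prop) fun t ht => ?_) continuousOn_const)
  · exact ⟨le_min (by linarith [ht.1]) zero_le_one, min_le_right _ _⟩
  · exact ⟨le_max_right _ _, max_le (by linarith [ht.2]) zero_le_one⟩

/-- The path is preceded by a segment from the small disk to `z`. That segment lies in the large
disk, where by uniqueness the continuation is `g`. -/
theorem exists_continuation_from (hext : ExtendsMultivalued Λ ρ G) (hρ : 0 < ρ) (hρR : ρ ≤ R)
    (hg : AnalyticOnNhd ℂ g (Metric.ball 0 R)) (hGg : ∀ z ∈ Metric.ball (0 : ℂ) ρ, G z = g z)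
    {z : ℂ} (hz : z ∈ Metric.ball 0 R) (hzΛ : z ∉ Λ) {γ : ℝ → ℂ}
    (hγ : ContinuousOn γ (Set.Icc 0 1)) (hγ0 : γ 0 = z) (hγΛ : ∀ t ∈ Set.Icc (0 : ℝ) 1, γ t ∉ Λ) :
    ∃ f : ℝ → ℂ → ℂ, ContinuationOn γ f (Set.Icc 0 1) ∧ f 0 =ᶠ[𝓝 z] g := by
  obtain ⟨w, hw, hwz⟩ := exists_segment_avoiding Λ hρ hzΛ
  set γ₁ : ℝ → ℂ := ⇑(AffineMap.lineMap (k := ℝ) w z) with hγ₁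
  have hγ₁c : Continuous γ₁ := AffineMap.lineMap_continuous
  have hj : γ₁ 1 = γ 0 := by rw [hγ₁, AffineMap.lineMap_apply_one, hγ0]
  have h00 : concatPath γ₁ γ 0 = w := by
    rw [concatPath_of_le (by norm_num), mul_zero, hγ₁, AffineMap.lineMap_apply_zero]
  have hadm : IsAdmissiblePath Λ ρ (concatPath γ₁ γ) := by
    refine ⟨continuousOn_concatPath hγ₁c.continuousOn hγ, by rw [h00]; exact hw, fun t ht => ?_⟩
    rcases le_total t (1 / 2) with h | h
    · rw [concatPath_of_le h]
      exact hwz _ ⟨by linarith [ht.1], by linarith⟩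
    · rw [concatPath_of_ge hj h]
      exact hγΛ _ ⟨by linarith, by linarith [ht.2]⟩
  obtain ⟨f, hf, hf0⟩ := hext _ hadm
  have hf' : ContinuationOn (concatPath γ₁ γ) f (Set.Icc 0 1) := hf
  have hball : ∀ t ∈ Set.Icc (0 : ℝ) (1 / 2), concatPath γ₁ γ t ∈ Metric.ball (0 : ℂ) R := by
    intro t ht
    rw [concatPath_of_le ht.2]
    exact (convex_ball (0 : ℂ) R).lineMap_mem (Metric.ball_subset_ball hρR hw) hz
      ⟨by linarith [ht.1], by linarith [ht.2]⟩
  have hsub : Set.Icc (0 : ℝ) (1 / 2) ⊆ Set.Icc 0 1 := Set.Icc_subset_Icc_right (by norm_num)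
  have hhalf := (hf'.mono hsub).unique (continuationOn_const fun t ht => hg _ (hball t ht))
    isPreconnected_Icc (hadm.1.mono hsub) (s := 0) (t := 1 / 2) ⟨le_rfl, by norm_num⟩
    ⟨by norm_num, le_rfl⟩ (by
      refine hf0.trans ?_
      rw [h00]
      filter_upwards [Metric.isOpen_ball.mem_nhds hw] with y hy using hGg y hy)
  have hmid : concatPath γ₁ γ (1 / 2) = z := by
    rw [concatPath_of_ge hj le_rfl]
    norm_num [hγ0]
  rw [hmid] at hhalf
  refine ⟨fun t => f ((t + 1) / 2), fun t ht => ?_, ?_⟩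
  · have hv : ∀ t : ℝ, t ∈ Set.Icc (0 : ℝ) 1 →
        concatPath γ₁ γ ((t + 1) / 2) = γ t ∧ (t + 1) / 2 ∈ Set.Icc (0 : ℝ) 1 := by
      intro t ht
      refine ⟨?_, by linarith [ht.1], by linarith [ht.2]⟩
      rw [concatPath_of_ge hj (by linarith [ht.1])]
      congr 1
      ring
    obtain ⟨h1, h2⟩ := hv t ht
    have h3 := hf' _ h2
    rw [h1] at h3
    refine ⟨h3.1, ?_⟩
    have h4 : Tendsto (fun s : ℝ => (s + 1) / 2) (𝓝[Set.Icc (0 : ℝ) 1] t)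
        (𝓝[Set.Icc (0 : ℝ) 1] ((t + 1) / 2)) := by
      refine tendsto_nhdsWithin_iff.mpr ⟨?_, ?_⟩
      · exact (Continuous.tendsto (by fun_prop) t).mono_left nhdsWithin_le_nhds
      · filter_upwards [self_mem_nhdsWithin] with s hs using (hv s hs).2
    filter_upwards [h4.eventually h3.2, self_mem_nhdsWithin] with s e1 hs
    rwa [(hv s hs).1] at e1
  · simpa using hhalf

theorem isBranchAt_of_mem_ball (hρ : 0 < ρ) (hρR : ρ ≤ R)
    (hg : AnalyticOnNhd ℂ g (Metric.ball 0 R)) (hGg : ∀ z ∈ Metric.ball (0 : ℂ) ρ, G z = g z)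
    {z : ℂ} (hz : z ∈ Metric.ball 0 R) (hzΛ : z ∉ Λ) : IsBranchAt Λ ρ G z g := by
  obtain ⟨w, hw, hwz⟩ := exists_segment_avoiding Λ hρ hzΛ
  refine ⟨⇑(AffineMap.lineMap (k := ℝ) w z), fun _ => g,
    ⟨AffineMap.lineMap_continuous.continuousOn, by simpa using hw, hwz⟩,
    continuationOn_const fun t ht => hg _ ((convex_ball (0 : ℂ) R).lineMap_mem
      (Metric.ball_subset_ball hρR hw) hz ht), ?_, by simp, EventuallyEq.rfl⟩
  rw [AffineMap.lineMap_apply_zero]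
  filter_upwards [Metric.isOpen_ball.mem_nhds hw] with y hy using (hGg y hy).symm

theorem exists_mem_ball_inter_ball {p : ℂ} (hp : ‖p‖ = R) (hR : 0 < R) {ε : ℝ} (hε : 0 < ε) :
    ∃ z ∈ Metric.ball (0 : ℂ) R ∩ Metric.ball p ε, z ≠ p := by
  have hcl : p ∈ closure (Metric.ball (0 : ℂ) R) := by
    rw [closure_ball _ hR.ne']
    simp [hp]
  obtain ⟨z, hz1, hz2⟩ := Metric.mem_closure_iff.mp hcl ε hε
  refine ⟨z, ⟨hz1, by rwa [Metric.mem_ball, dist_comm]⟩, fun h => ?_⟩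
  rw [h, mem_ball_zero_iff, hp] at hz1
  exact lt_irrefl _ hz1

/-- At a point of the circle of convergence outside `Λ` the function extends analytically. -/
theorem exists_analytic_extension (hext : ExtendsMultivalued Λ ρ G) (hρ : 0 < ρ) (hρR : ρ ≤ R)
    (hg : AnalyticOnNhd ℂ g (Metric.ball 0 R)) (hGg : ∀ z ∈ Metric.ball (0 : ℂ) ρ, G z = g z)
    {p : ℂ} (hp : ‖p‖ = R) (hpΛ : p ∉ Λ) :
    ∃ h : ℂ → ℂ, AnalyticAt ℂ h p ∧ ∀ᶠ z in 𝓝[Metric.ball 0 R] p, g z = h z := by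
  have hR : 0 < R := hρ.trans_le hρR
  obtain ⟨ε, hε, hεΛ⟩ := Metric.isOpen_iff.mp (Λ.finite_toSet.isClosed.isOpen_compl) p hpΛ
  obtain ⟨z, ⟨hzR, hzp⟩, -⟩ := exists_mem_ball_inter_ball hp hR hε
  have hseg : ∀ t ∈ Set.Icc (0 : ℝ) 1, (AffineMap.lineMap z p t : ℂ) ∉ Λ := fun t ht =>
    hεΛ ((convex_ball p ε).lineMap_mem hzp (Metric.mem_ball_self hε) ht)
  obtain ⟨f, hf, hf0⟩ := exists_continuation_from hext hρ hρR hg hGg hzR (hεΛ hzp)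
    (γ := ⇑(AffineMap.lineMap (k := ℝ) z p)) AffineMap.lineMap_continuous.continuousOn (by simp)
    hseg
  obtain ⟨r, hr, H, hH, hHf⟩ := hf.exists_thickening
  set T := Metric.thickening r (AffineMap.lineMap (k := ℝ) z p '' Set.Icc (0 : ℝ) 1) with hT
  have hTc : Convex ℝ T := Convex.thickening ((convex_Icc (0 : ℝ) 1).affine_image
    (AffineMap.lineMap (k := ℝ) z p)) r
  have hpT : p ∈ T := Metric.mem_thickening_iff.mpr
    ⟨p, ⟨1, ⟨zero_le_one, le_rfl⟩, by simp⟩, by simpa using hr⟩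
  have hzT : z ∈ T := Metric.mem_thickening_iff.mpr
    ⟨z, ⟨0, ⟨le_rfl, zero_le_one⟩, by simp⟩, by simpa using hr⟩
  have h0 := hHf 0 ⟨le_rfl, zero_le_one⟩
  rw [AffineMap.lineMap_apply_zero] at h0
  have hEq : Set.EqOn H g (T ∩ Metric.ball 0 R) :=
    (hH.mono Set.inter_subset_left).eqOn_of_preconnected_of_eventuallyEq
      (hg.mono Set.inter_subset_right) (hTc.inter (convex_ball 0 R)).isPreconnected
      ⟨hzT, hzR⟩ (h0.trans hf0)
  refine ⟨H, hH p hpT, ?_⟩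
  filter_upwards [self_mem_nhdsWithin,
    mem_nhdsWithin_of_mem_nhds (Metric.isOpen_thickening.mem_nhds hpT)] with y h1 h2
    using (hEq ⟨h2, h1⟩).symm

/-- Near a point of `Λ` on the circle of convergence, the function is given by a local branch. -/
theorem exists_local_branch (hext : ExtendsMultivalued Λ ρ G) (hρ : 0 < ρ) (hρR : ρ ≤ R)
    (hg : AnalyticOnNhd ℂ g (Metric.ball 0 R)) (hGg : ∀ z ∈ Metric.ball (0 : ℂ) ρ, G z = g z)
    {p : ℂ} (hp : ‖p‖ = R) {δ : ℝ} (hδ : 0 < δ) (hΛ : ∀ q ∈ Λ, q ∈ Metric.ball p δ → q = p) :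
    ∃ F : ℂ → ℂ, IsLocalBranch Λ ρ G p δ F ∧
      ∀ z ∈ Metric.ball (0 : ℂ) R ∩ Metric.ball p δ,
        g z = F (Complex.log (1 - z / p) + Complex.log (-p)) := by
  have hR : 0 < R := hρ.trans_le hρR
  have hp0 : p ≠ 0 := by
    intro h
    rw [h, norm_zero] at hp
    exact hR.ne hp
  -- On the disk `1 - z / p` avoids the cut of the logarithm, so `ℓ` is an analytic branch of `log
  -- (z - p)`.
  set ℓ : ℂ → ℂ := fun z => Complex.log (1 - z / p) + Complex.log (-p) with hℓ
  have hsl : ∀ z ∈ Metric.ball (0 : ℂ) R, 1 - z / p ∈ Complex.slitPlane := by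
    intro z hz
    have : ‖-(z / p)‖ < 1 := by
      rw [norm_neg, norm_div, hp, div_lt_one hR]
      simpa using hz
    simpa [sub_eq_add_neg] using Complex.mem_slitPlane_of_norm_lt_one this
  have hexp : ∀ z ∈ Metric.ball (0 : ℂ) R, Complex.exp (ℓ z) = z - p := by
    intro z hz
    simp only [hℓ]
    rw [Complex.exp_add, Complex.exp_log (Complex.slitPlane_ne_zero (hsl z hz)),
      Complex.exp_log (neg_ne_zero.mpr hp0)]
    field_simp
    ring
  have hℓA : AnalyticOnNhd ℂ ℓ (Metric.ball 0 R) := fun z hz =>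
    ((analyticAt_const.sub (analyticAt_id.div analyticAt_const hp0)).clog (hsl z hz)).add
      analyticAt_const
  have hmem : ∀ w : ℂ, w ∈ logHalfPlane δ ↔ p + Complex.exp w ∈ Metric.ball p δ := by
    intro w
    rw [mem_ball_iff_norm, add_sub_cancel_left, Complex.norm_exp, ← Real.lt_log_iff_exp_lt hδ]
    rfl
  have hℓm : ∀ z ∈ Metric.ball (0 : ℂ) R ∩ Metric.ball p δ, ℓ z ∈ logHalfPlane δ := by
    intro z hz
    rw [hmem, hexp z hz.1]
    simpa using hz.2
  obtain ⟨z, hz, hzp⟩ := exists_mem_ball_inter_ball hp hR hδ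
  have hzΛ : z ∉ Λ := fun h => hzp (hΛ z h hz.2)
  have hopen : IsOpen (logHalfPlane δ) := isOpen_re_lt _
  have hconv : Convex ℝ (logHalfPlane δ) := convex_halfSpace_lt Complex.reLm.isLinear _
  have hback : p + Complex.exp (ℓ z) = z := by rw [hexp z hz.1]; ring
  -- The half-plane is convex, and segments in it are mapped by `p + exp` to paths in the punctured
  -- disk, which avoid `Λ`.
  obtain ⟨F, hF, hFg⟩ := exists_analytic_of_continuation hopen (hℓm z hz)
    (φ := fun w => g (p + Complex.exp w)) (fun w hw => by
      obtain ⟨f, hf, hf0⟩ := exists_continuation_from hext hρ hρR hg hGg hz.1 hzΛ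
        (γ := fun t => p + Complex.exp (AffineMap.lineMap (k := ℝ) (ℓ z) w t))
        (Continuous.continuousOn (by fun_prop))
        (by simp [hback]) (fun t ht hq => by
          have h1 := (hmem _).mp (hconv.lineMap_mem (hℓm z hz) hw ht)
          have h2 := hΛ _ hq h1
          simp at h2)
      refine ⟨fun t w => f t (p + Complex.exp w), fun t ht => ⟨?_, ?_⟩, ?_⟩
      · exact AnalyticAt.fun_comp (f := fun w => p + Complex.exp w) (hf t ht).1
          (analyticAt_const.add analyticAt_cexp)
      · filter_upwards [(hf t ht).2] with s hs
        exact (Continuous.tendsto (by fun_prop : Continuous fun w => p + Complex.exp w) _).eventually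
          hs
      · have h1 : Tendsto (fun w => p + Complex.exp w) (𝓝 (ℓ z)) (𝓝 z) := by
          have := Continuous.tendsto (by fun_prop : Continuous fun w => p + Complex.exp w) (ℓ z)
          rwa [hback] at this
        exact h1.eventually hf0)
  refine ⟨F, ⟨hF.differentiableOn, ℓ z, hℓm z hz, g, ?_, hFg⟩, ?_⟩
  · rw [hback]
    exact isBranchAt_of_mem_ball hρ hρR hg hGg hz.1 hzΛ
  · refine (hg.mono Set.inter_subset_left).eqOn_of_preconnected_of_eventuallyEq
      (f := g) (g := fun z => F (ℓ z)) (U := Metric.ball 0 R ∩ Metric.ball p δ) (fun y hy =>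
        AnalyticAt.fun_comp (f := ℓ) (hF _ (hℓm y hy)) (hℓA y hy.1))
      ((convex_ball _ _).inter (convex_ball _ _)).isPreconnected hz ?_
    have h1 := (hℓA z hz.1).continuousAt.eventually hFg
    filter_upwards [h1, Metric.isOpen_ball.mem_nhds hz.1] with y h2 h3
    rw [h2, hexp y h3]
    ring_nf

end Branches

/-! ### Coefficients and boundary behaviour of power series on the unit disk -/

section Darboux

open Asymptotics

theorem hasFPowerSeriesAt_of_hasSum {b : ℕ → ℂ} {f : ℂ → ℂ} {r : ℝ} (hr : 0 < r)
    (hf : ∀ z ∈ Metric.ball (0 : ℂ) r, HasSum (fun n => b n * z ^ n) (f z)) :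
    HasFPowerSeriesAt f (FormalMultilinearSeries.ofScalars ℂ b) 0 := by
  rw [hasFPowerSeriesAt_iff]
  filter_upwards [Metric.ball_mem_nhds (0 : ℂ) hr] with z hz
  rw [zero_add]
  refine (hf z hz).congr_fun fun n => ?_
  rw [FormalMultilinearSeries.coeff_ofScalars, smul_eq_mul, mul_comm]

theorem iteratedDeriv_eq_of_hasFPowerSeriesAt {b : ℕ → ℂ} {f : ℂ → ℂ}
    (hf : HasFPowerSeriesAt f (FormalMultilinearSeries.ofScalars ℂ b) 0) (n : ℕ) :
    iteratedDeriv n f 0 = n.factorial * b n := by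
  obtain ⟨r, hr⟩ := hf
  have h := hr.factorial_smul 1 n
  rw [iteratedDeriv_eq_iteratedFDeriv, ← h, nsmul_eq_mul]
  congr 1
  exact FormalMultilinearSeries.coeff_ofScalars (𝕜 := ℂ) (p := b) (n := n)

theorem le_radius_ofScalars_of_summable {b : ℕ → ℂ} {t : NNReal}
    (h : Summable fun n => b n * ((t : ℝ) : ℂ) ^ n) :
    (t : ℝ≥0∞) ≤ (FormalMultilinearSeries.ofScalars ℂ b).radius := by
  refine FormalMultilinearSeries.le_radius_of_tendsto _ (l := 0) ?_
  have h1 := h.tendsto_atTop_zero.norm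
  rw [norm_zero] at h1
  refine h1.congr fun n => ?_
  rw [FormalMultilinearSeries.norm_apply_eq_norm_coef,
    FormalMultilinearSeries.coeff_ofScalars, norm_mul, norm_pow, Complex.norm_real]
  simp

theorem hasFPowerSeriesOnBall_of_hasSum {b : ℕ → ℂ} {f : ℂ → ℂ} {r : ℝ} (hr : 0 < r)
    (hf : ∀ z ∈ Metric.ball (0 : ℂ) r, HasSum (fun n => b n * z ^ n) (f z)) :
    HasFPowerSeriesOnBall f (FormalMultilinearSeries.ofScalars ℂ b) 0 (ENNReal.ofReal r) := by
  refine ⟨?_, ENNReal.ofReal_pos.mpr hr, fun {y} hy => ?_⟩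
  · refine ENNReal.le_of_forall_nnreal_lt fun t ht => le_radius_ofScalars_of_summable ?_
    have htr : (t : ℝ) < r := by
      rwa [← ENNReal.ofReal_coe_nnreal, ENNReal.ofReal_lt_ofReal_iff hr] at ht
    exact (hf _ (by simpa using htr)).summable
  · have hy' : y ∈ Metric.ball (0 : ℂ) r := by
      rwa [Metric.eball_ofReal] at hy
    rw [zero_add]
    refine (hf y hy').congr_fun fun n => ?_
    rw [FormalMultilinearSeries.ofScalars_apply_eq, smul_eq_mul]

theorem analyticOnNhd_of_hasSum {b : ℕ → ℂ} {f : ℂ → ℂ} {r : ℝ} (hr : 0 < r)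
    (hf : ∀ z ∈ Metric.ball (0 : ℂ) r, HasSum (fun n => b n * z ^ n) (f z)) :
    AnalyticOnNhd ℂ f (Metric.ball 0 r) := by
  have h := (hasFPowerSeriesOnBall_of_hasSum hr hf).analyticOnNhd
  rwa [Metric.eball_ofReal] at h

/-- The function is analytic, with bounded derivative of order `D`, in the unit disk near `p`. -/
def TameAt (D : ℕ) (f : ℂ → ℂ) (p : ℂ) : Prop :=
  ∃ C : ℝ, ∀ᶠ z in 𝓝[Metric.ball 0 1] p, AnalyticAt ℂ f z ∧ ‖iteratedDeriv D f z‖ ≤ C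

theorem AnalyticAt.tameAt {f : ℂ → ℂ} {p : ℂ} (hf : AnalyticAt ℂ f p) (D : ℕ) : TameAt D f p := by
  have h1 : ContinuousAt (iteratedDeriv D f) p := by
    rw [iteratedDeriv_eq_iterate]
    exact (hf.iterated_deriv D).continuousAt
  refine ⟨‖iteratedDeriv D f p‖ + 1, Eventually.filter_mono nhdsWithin_le_nhds ?_⟩
  filter_upwards [hf.eventually_analyticAt, h1.norm.eventually (Iio_mem_nhds (lt_add_one _))]
    with z h2 h3 using ⟨h2, le_of_lt h3⟩

theorem TameAt.add {D : ℕ} {f g : ℂ → ℂ} {p : ℂ} (hf : TameAt D f p) (hg : TameAt D g p) :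
    TameAt D (fun z => f z + g z) p := by
  obtain ⟨C, hC⟩ := hf
  obtain ⟨C', hC'⟩ := hg
  refine ⟨C + C', ?_⟩
  filter_upwards [hC, hC'] with z h1 h2
  refine ⟨h1.1.add h2.1, ?_⟩
  rw [iteratedDeriv_fun_add h1.1.contDiffAt h2.1.contDiffAt]
  exact (norm_add_le _ _).trans (add_le_add h1.2 h2.2)

theorem TameAt.sum {ι : Type*} {D : ℕ} {f : ι → ℂ → ℂ} {p : ℂ} (s : Finset ι)
    (hf : ∀ i ∈ s, TameAt D (f i) p) : TameAt D (fun z => ∑ i ∈ s, f i z) p := by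
  classical
  induction s using Finset.induction_on with
  | empty => simpa using (analyticAt_const (v := (0 : ℂ))).tameAt D
  | insert i s hi ih =>
    simp only [Finset.sum_insert hi]
    exact (hf i (Finset.mem_insert_self i s)).add
      (ih fun j hj => hf j (Finset.mem_insert_of_mem hj))

theorem TameAt.congr {D : ℕ} {f g : ℂ → ℂ} {p : ℂ} (hf : TameAt D f p)
    (h : ∀ᶠ z in 𝓝[Metric.ball 0 1] p, f z = g z) : TameAt D g p := by
  obtain ⟨C, hC⟩ := hf
  refine ⟨C, ?_⟩
  filter_upwards [hC, eventually_eventually_nhdsWithin.mpr h, self_mem_nhdsWithin] with z h1 h2 hz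
  rw [Metric.isOpen_ball.nhdsWithin_eq hz] at h2
  exact ⟨h1.1.congr h2, by rw [← EventuallyEq.iteratedDeriv_eq D h2]; exact h1.2⟩

theorem exists_bound_of_tameAt {D : ℕ} {f : ℂ → ℂ}
    (h : ∀ p ∈ Metric.closedBall (0 : ℂ) 1, TameAt D f p) :
    ∃ C : ℝ, ∀ z ∈ Metric.ball (0 : ℂ) 1, ‖iteratedDeriv D f z‖ ≤ C := by
  have h1 := (isCompact_closedBall (0 : ℂ) 1).induction_on
    (p := fun s => ∃ C : ℝ, ∀ z ∈ s ∩ Metric.ball (0 : ℂ) 1, ‖iteratedDeriv D f z‖ ≤ C)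
    ⟨0, by simp⟩ (fun s t hst ⟨C, hC⟩ => ⟨C, fun z hz => hC z ⟨hst hz.1, hz.2⟩⟩)
    (fun s t ⟨C, hC⟩ ⟨C', hC'⟩ => ⟨max C C', fun z hz => by
      rcases hz.1 with h | h
      · exact (hC z ⟨h, hz.2⟩).trans (le_max_left _ _)
      · exact (hC' z ⟨h, hz.2⟩).trans (le_max_right _ _)⟩)
    (fun p hp => by
      obtain ⟨C, hC⟩ := h p hp
      obtain ⟨U, hU, hUC⟩ := mem_nhdsWithin_iff_exists_mem_nhds_inter.mp hC
      exact ⟨U, mem_nhdsWithin_of_mem_nhds hU, C, fun z hz => (hUC hz).2⟩)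
  obtain ⟨C, hC⟩ := h1
  exact ⟨C, fun z hz => hC z ⟨Metric.ball_subset_closedBall hz, hz⟩⟩

/-- Cauchy's estimate for the derivative of order `D`, whose Taylor coefficients are `b (n + D) (n +
D)! / n!`; the quotient of factorials grows like `n^D`. -/
theorem isBigO_coeff_of_iteratedDeriv_bounded {b : ℕ → ℂ} {f : ℂ → ℂ} {D : ℕ} {C : ℝ}
    (hf : ∀ z ∈ Metric.ball (0 : ℂ) 1, HasSum (fun n => b n * z ^ n) (f z))
    (hC : ∀ z ∈ Metric.ball (0 : ℂ) 1, ‖iteratedDeriv D f z‖ ≤ C) :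
    b =O[atTop] fun n => ((n : ℝ) ^ D)⁻¹ := by
  have hA := analyticOnNhd_of_hasSum one_pos hf
  have hh : AnalyticOnNhd ℂ (iteratedDeriv D f) (Metric.ball 0 1) := by
    rw [iteratedDeriv_eq_iterate]
    exact hA.iterated_deriv D
  have hps := hasFPowerSeriesAt_of_hasSum one_pos hf
  have hC0 : 0 ≤ C := (norm_nonneg _).trans (hC 0 (Metric.mem_ball_self one_pos))
  have h1 : ∀ n : ℕ, ((n + D).factorial : ℝ) * ‖b (n + D)‖ ≤ n.factorial * C := by
    intro n
    have h2 : ∀ r : ℝ, 0 < r → r < 1 →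
        ((n + D).factorial : ℝ) * ‖b (n + D)‖ ≤ n.factorial * C / r ^ n := by
      intro r hr hr1
      have hsub : Metric.closedBall (0 : ℂ) r ⊆ Metric.ball 0 1 :=
        Metric.closedBall_subset_ball hr1
      have h3 := Complex.norm_iteratedDeriv_le_of_forall_mem_sphere_norm_le n hr
        (DifferentiableOn.diffContOnCl (by
          rw [closure_ball _ hr.ne']
          exact (hh.mono hsub).differentiableOn))
        (fun z hz => hC z (hsub (Metric.sphere_subset_closedBall hz)))
      have h4 : iteratedDeriv n (iteratedDeriv D f) 0 = (n + D).factorial * b (n + D) := by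
        rw [← iteratedDeriv_eq_of_hasFPowerSeriesAt hps, iteratedDeriv_eq_iterate,
          iteratedDeriv_eq_iterate, iteratedDeriv_eq_iterate, ← Function.iterate_add_apply]
      rw [h4, norm_mul, Complex.norm_natCast] at h3
      exact h3
    have h5 : Tendsto (fun r : ℝ => n.factorial * C / r ^ n) (𝓝[<] 1)
        (𝓝 (n.factorial * C / 1 ^ n)) := by
      refine Tendsto.mono_left ?_ nhdsWithin_le_nhds
      refine ContinuousAt.tendsto (f := fun r : ℝ => n.factorial * C / r ^ n) ?_
      exact continuousAt_const.div (continuousAt_id.pow n) (by simp)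
    rw [one_pow, div_one] at h5
    refine ge_of_tendsto h5 ?_
    filter_upwards [Ioo_mem_nhdsLT (show (0 : ℝ) < 1 from one_pos)] with r hr using h2 r hr.1 hr.2
  refine IsBigO.of_bound (C * (D + 1) ^ D) (eventually_atTop.mpr ⟨D + 1, fun m hm => ?_⟩)
  obtain ⟨n, rfl⟩ : ∃ n, m = n + D := ⟨m - D, by omega⟩
  have hfac : (n.factorial : ℝ) * (n + 1) ^ D ≤ (n + D).factorial := by
    have h6 := Nat.pow_succ_le_ascFactorial (n + 1) D
    have h7 := Nat.factorial_mul_ascFactorial n D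
    have h8 : n.factorial * (n + 1) ^ D ≤ (n + D).factorial := by
      rw [← h7]
      exact Nat.mul_le_mul_left _ h6
    exact_mod_cast h8
  have hnf : (0 : ℝ) < n.factorial := by exact_mod_cast n.factorial_pos
  have h9 : ((n : ℝ) + 1) ^ D * ‖b (n + D)‖ ≤ C := by
    refine le_of_mul_le_mul_left ?_ hnf
    calc _ = (n.factorial : ℝ) * (n + 1) ^ D * ‖b (n + D)‖ := by ring
      _ ≤ (n + D).factorial * ‖b (n + D)‖ := by gcongr
      _ ≤ _ := h1 n
  have hm0 : (0 : ℝ) < ((n + D : ℕ) : ℝ) := by exact_mod_cast (by omega : 0 < n + D)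
  rw [Real.norm_of_nonneg (by positivity), ← div_eq_mul_inv, le_div_iff₀ (by positivity)]
  have h10 : ((n + D : ℕ) : ℝ) ≤ (n + 1) * (D + 1) := by
    push_cast
    have : (0 : ℝ) ≤ n * D := by positivity
    nlinarith
  calc ‖b (n + D)‖ * ((n + D : ℕ) : ℝ) ^ D ≤ ‖b (n + D)‖ * ((n + 1) * (D + 1)) ^ D := by gcongr
    _ = ((n : ℝ) + 1) ^ D * ‖b (n + D)‖ * (D + 1) ^ D := by rw [mul_pow]; ring
    _ ≤ _ := by gcongr

/-- A power series that extends analytically across every point of the unit circle converges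
beyond it. -/
theorem exists_summable_of_analytic_extension {b : ℕ → ℂ} {g : ℂ → ℂ}
    (hg : ∀ z ∈ Metric.ball (0 : ℂ) 1, HasSum (fun n => b n * z ^ n) (g z))
    (hext : ∀ p ∈ Metric.sphere (0 : ℂ) 1, ∃ h : ℂ → ℂ, AnalyticAt ℂ h p ∧
      ∀ᶠ z in 𝓝[Metric.ball 0 1] p, g z = h z) :
    ∃ r : ℝ, 1 < r ∧ Summable fun n => b n * (r : ℂ) ^ n := by
  obtain ⟨ε, hε, hloc⟩ := (isCompact_sphere (0 : ℂ) 1).induction_on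
    (p := fun s => ∃ ε > 0, ∀ p ∈ s, ∃ h : ℂ → ℂ, AnalyticOnNhd ℂ h (Metric.ball p ε) ∧
      ∀ z ∈ Metric.ball (0 : ℂ) 1 ∩ Metric.ball p ε, g z = h z)
    ⟨1, one_pos, by simp⟩
    (fun s t hst ⟨ε, hε, h⟩ => ⟨ε, hε, fun p hp => h p (hst hp)⟩)
    (fun s t ⟨ε, hε, h⟩ ⟨ε', hε', h'⟩ => ⟨min ε ε', lt_min hε hε', fun p hp => by
      have hs1 := Metric.ball_subset_ball (x := p) (min_le_left ε ε')
      have hs2 := Metric.ball_subset_ball (x := p) (min_le_right ε ε')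
      rcases hp with hp | hp
      · obtain ⟨k, hk, he⟩ := h p hp
        exact ⟨k, hk.mono hs1, fun z hz => he z ⟨hz.1, hs1 hz.2⟩⟩
      · obtain ⟨k, hk, he⟩ := h' p hp
        exact ⟨k, hk.mono hs2, fun z hz => he z ⟨hz.1, hs2 hz.2⟩⟩⟩)
    (fun p hp => by
      obtain ⟨k, hk, he⟩ := hext p hp
      obtain ⟨r, hr, hkr⟩ := hk.exists_ball
      obtain ⟨r', hr', he'⟩ := Metric.mem_nhdsWithin_iff.mp he
      refine ⟨Metric.ball p (min r r' / 2),
        mem_nhdsWithin_of_mem_nhds (Metric.ball_mem_nhds p (by positivity)),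
        min r r' / 2, by positivity, fun q hq => ⟨k, hkr.mono ?_, fun z hz => he' ⟨?_, hz.1⟩⟩⟩
      · refine Metric.ball_subset_ball' ?_
        have h1 : dist q p < min r r' / 2 := hq
        linarith [min_le_left r r']
      · have h1 : dist q p < min r r' / 2 := hq
        have h2 : dist z q < min r r' / 2 := hz.2
        have := dist_triangle z q p
        rw [Metric.mem_ball]
        linarith [min_le_right r r'])
  choose! h hh he using hloc
  have hgA := analyticOnNhd_of_hasSum one_pos hg
  have hnorm : ∀ z : ℂ, z ≠ 0 → z / ‖z‖ ∈ Metric.sphere (0 : ℂ) 1 := fun z hz => by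
    simp [hz]
  have hdist : ∀ z : ℂ, z ≠ 0 → dist z (z / ‖z‖) = |‖z‖ - 1| := by
    intro z hz
    have hz' : (‖z‖ : ℂ) ≠ 0 := by simpa using hz
    have h1 : z - z / ‖z‖ = ((‖z‖ - 1 : ℝ) : ℂ) * (z / ‖z‖) := by
      push_cast
      field_simp
    rw [dist_eq_norm, h1, norm_mul, Complex.norm_real, Real.norm_eq_abs,
      mem_sphere_zero_iff_norm.mp (hnorm z hz), mul_one]
  classical
  -- Outside the disk the value is that of the local extension at the radial projection of `z`;
  -- uniform radii make this defined on a larger disk.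
  set k : ℂ → ℂ := fun z => if ‖z‖ < 1 then g z else h (z / ‖z‖) z with hk
  have hkd : DifferentiableOn ℂ k (Metric.ball 0 (1 + ε)) := by
    intro z₀ hz₀
    refine DifferentiableAt.differentiableWithinAt ?_
    rw [mem_ball_zero_iff] at hz₀
    by_cases h1 : ‖z₀‖ < 1
    · refine ((hgA z₀ (by simpa using h1)).differentiableAt).congr_of_eventuallyEq ?_
      have : IsOpen {z : ℂ | ‖z‖ < 1} := isOpen_lt continuous_norm continuous_const
      filter_upwards [this.mem_nhds h1] with z hz
      simp only [hk]
      exact if_pos hz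
    · push Not at h1
      have hz0 : z₀ ≠ 0 := fun h => by
        rw [h, norm_zero] at h1
        exact absurd h1 (by norm_num)
      set p₀ := z₀ / ‖z₀‖ with hp₀
      have hp₀s := hnorm z₀ hz0
      have hz₀p : z₀ ∈ Metric.ball p₀ ε := by
        rw [Metric.mem_ball, hdist z₀ hz0, abs_of_nonneg (by linarith)]
        linarith
      refine ((hh p₀ hp₀s z₀ hz₀p).differentiableAt).congr_of_eventuallyEq ?_
      have hcont : ContinuousAt (fun z : ℂ => z / ‖z‖) z₀ :=
        continuousAt_id.div (Complex.continuous_ofReal.comp continuous_norm).continuousAt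
          (by simpa using hz0)
      have hlt : IsOpen {z : ℂ | ‖z‖ < 1 + ε} := isOpen_lt continuous_norm continuous_const
      filter_upwards [Metric.isOpen_ball.mem_nhds hz₀p,
        hcont.eventually (Metric.ball_mem_nhds _ (half_pos hε)), hlt.mem_nhds hz₀,
        isOpen_ne.mem_nhds hz0] with z e1 e2 e3 e4
      simp only [hk]
      split_ifs with h2
      · exact he p₀ hp₀s z ⟨by simpa using h2, e1⟩
      · push Not at h2
        set p := z / ‖z‖ with hp
        have hps := hnorm z e4
        have hzp : z ∈ Metric.ball p ε := by
          rw [Metric.mem_ball, hdist z e4, abs_of_nonneg (by linarith)]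
          have : ‖z‖ < 1 + ε := e3
          linarith
        set η : ℝ := min (ε / 2) 1 / 2 with hη
        have hη0 : 0 < η := by positivity
        have hη1 : η < 1 := by
          have := min_le_right (ε / 2) 1
          linarith
        have hη2 : η < ε / 2 := by
          have h3 := min_le_left (ε / 2) 1
          have h4 : 0 < min (ε / 2) 1 := by positivity
          linarith
        -- A point slightly inside `p` lies in the unit disk and in both small disks. Near it both
        -- extensions equal `g`, so they agree on the convex intersection.
        set q : ℂ := ((1 - η : ℝ) : ℂ) * p with hq
        have hpn : ‖p‖ = 1 := mem_sphere_zero_iff_norm.mp hps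
        have hqn : ‖q‖ = 1 - η := by
          rw [hq, norm_mul, Complex.norm_real, Real.norm_of_nonneg (by linarith), hpn, mul_one]
        have hqp : dist q p = η := by
          have : q - p = ((-η : ℝ) : ℂ) * p := by rw [hq]; push_cast; ring
          rw [dist_eq_norm, this, norm_mul, Complex.norm_real, Real.norm_eq_abs, abs_neg,
            abs_of_pos hη0, hpn, mul_one]
        have hqD : q ∈ Metric.ball (0 : ℂ) 1 := by rw [mem_ball_zero_iff, hqn]; linarith
        have hq1 : q ∈ Metric.ball p ε := by rw [Metric.mem_ball, hqp]; linarith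
        have hq2 : q ∈ Metric.ball p₀ ε := by
          have h5 : dist p p₀ < ε / 2 := e2
          have := dist_triangle q p p₀
          rw [Metric.mem_ball]
          linarith
        have hEq : Set.EqOn (h p) (h p₀) (Metric.ball p ε ∩ Metric.ball p₀ ε) := by
          refine ((hh p hps).mono Set.inter_subset_left).eqOn_of_preconnected_of_eventuallyEq
            ((hh p₀ hp₀s).mono Set.inter_subset_right)
            ((convex_ball _ _).inter (convex_ball _ _)).isPreconnected ⟨hq1, hq2⟩ ?_
          filter_upwards [Metric.isOpen_ball.mem_nhds hq1, Metric.isOpen_ball.mem_nhds hq2,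
            Metric.isOpen_ball.mem_nhds hqD] with y h6 h7 h8
          rw [← he p hps y ⟨h8, h6⟩, ← he p₀ hp₀s y ⟨h8, h7⟩]
        exact hEq ⟨hzp, e1⟩
  have hps := hasFPowerSeriesAt_of_hasSum one_pos hg
  have hkg : k =ᶠ[𝓝 0] g := by
    filter_upwards [Metric.ball_mem_nhds (0 : ℂ) one_pos] with z hz
    simp only [hk]
    exact if_pos (by simpa using hz)
  refine ⟨1 + ε / 2, by linarith, ?_⟩
  have hmem : ((1 + ε / 2 : ℝ) : ℂ) ∈ Metric.ball (0 : ℂ) (1 + ε) := by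
    rw [mem_ball_zero_iff, Complex.norm_real, Real.norm_of_nonneg (by linarith)]
    linarith
  refine (Complex.hasSum_taylorSeries_on_ball hkd hmem).summable.congr fun n => ?_
  rw [EventuallyEq.iteratedDeriv_eq n hkg, iteratedDeriv_eq_of_hasFPowerSeriesAt hps, sub_zero,
    smul_eq_mul, smul_eq_mul]
  have : (n.factorial : ℂ) ≠ 0 := by exact_mod_cast n.factorial_ne_zero
  field_simp

end Darboux

/-! ### Logarithmic singularities on the unit circle -/

section Singularities

open Asymptotics

/-- The function `log(u)^k u^s`, with principal values. -/
noncomputable def logPower (s : ℝ) (k : ℕ) (u : ℂ) : ℂ :=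
  Complex.log u ^ k * Complex.exp (s * Complex.log u)

theorem analyticAt_logPower (s : ℝ) (k : ℕ) {u : ℂ} (hu : u ∈ Complex.slitPlane) :
    AnalyticAt ℂ (logPower s k) u :=
  ((analyticAt_clog hu).pow k).mul ((analyticAt_const.mul (analyticAt_clog hu)).cexp)

theorem Complex.norm_log_le_abs_log_add_pi (v : ℂ) :
    ‖Complex.log v‖ ≤ |Real.log ‖v‖| + Real.pi := by
  refine (Complex.norm_le_abs_re_add_abs_im _).trans ?_
  rw [Complex.log_re, Complex.log_im]
  gcongr
  exact Complex.abs_arg_le_pi v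

theorem norm_logPower_le {s : ℝ} {D : ℕ} (hs : D < s) (k : ℕ) :
    ∃ C : ℝ, ∀ v : ℂ, v ≠ 0 → ‖v‖ ≤ 1 → ‖logPower s k v‖ ≤ C * ‖v‖ ^ D := by
  -- The surplus `s - D` is split into `k + 1` equal shares `t`, and `‖v‖^t` controls one factor
  -- `log v`. The extra share keeps the denominator nonzero for `k = 0`.
  set t : ℝ := (s - D) / (k + 1) with ht
  have ht0 : 0 < t := div_pos (by linarith) (by positivity)
  refine ⟨(1 / t + Real.pi) ^ k, fun v hv hv1 => ?_⟩
  have hx : 0 < ‖v‖ := norm_pos_iff.mpr hv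
  have h1 : ‖Complex.exp (s * Complex.log v)‖ = ‖v‖ ^ s := by
    rw [Complex.norm_exp, Complex.re_ofReal_mul, Complex.log_re, Real.rpow_def_of_pos hx, mul_comm]
  have hxt : ‖v‖ ^ t ≤ 1 := Real.rpow_le_one hx.le hv1 ht0.le
  have hst : s = D + (k + 1 : ℕ) * t := by
    rw [ht]
    push_cast
    field_simp
    ring
  have h2 : ‖v‖ ^ s ≤ ‖v‖ ^ D * (‖v‖ ^ t) ^ k := by
    rw [hst, Real.rpow_add hx, Real.rpow_natCast, mul_comm ((k + 1 : ℕ) : ℝ), Real.rpow_mul hx.le,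
      Real.rpow_natCast, pow_succ]
    gcongr
    exact mul_le_of_le_one_right (by positivity) hxt
  have h3 : ‖Complex.log v‖ * ‖v‖ ^ t ≤ 1 / t + Real.pi := by
    have h4 := Real.abs_log_mul_self_rpow_lt ‖v‖ t hx hv1 ht0
    rw [abs_mul, abs_of_nonneg (Real.rpow_nonneg hx.le t)] at h4
    calc _ ≤ (|Real.log ‖v‖| + Real.pi) * ‖v‖ ^ t := by
          gcongr
          exact Complex.norm_log_le_abs_log_add_pi v
      _ = |Real.log ‖v‖| * ‖v‖ ^ t + Real.pi * ‖v‖ ^ t := by ring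
      _ ≤ _ := add_le_add h4.le (mul_le_of_le_one_right Real.pi_pos.le hxt)
  rw [logPower, norm_mul, norm_pow, h1]
  calc _ ≤ ‖Complex.log v‖ ^ k * (‖v‖ ^ D * (‖v‖ ^ t) ^ k) := by gcongr
    _ = (‖Complex.log v‖ * ‖v‖ ^ t) ^ k * ‖v‖ ^ D := by rw [mul_pow]; ring
    _ ≤ _ := by gcongr

theorem tendsto_exp_log_div {N : ℕ} (hN : 0 < N) :
    Tendsto (fun v : ℂ => Complex.exp (Complex.log v / N)) (𝓝[≠] 0) (𝓝 0) := by
  rw [Complex.tendsto_exp_nhds_zero_iff]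
  have h1 : Tendsto (fun v : ℂ => Real.log ‖v‖) (𝓝[≠] 0) atBot := by
    refine Real.tendsto_log_nhdsGT_zero.comp ?_
    exact tendsto_norm_nhdsNE_zero
  have hN' : (0 : ℝ) < N := by exact_mod_cast hN
  refine (h1.atBot_div_const hN').congr fun v => ?_
  rw [Complex.div_natCast_re, Complex.log_re]

theorem mem_slitPlane_one_sub {w : ℂ} (hw : ‖w‖ ≤ 1) (h1 : w ≠ 1) :
    1 - w ∈ Complex.slitPlane := by
  rw [Complex.mem_slitPlane_iff]
  have h2 : w.re ≤ 1 := (Complex.re_le_norm w).trans hw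
  rcases h2.lt_or_eq with h | h
  · left
    simpa using h
  · right
    intro h3
    refine h1 (Complex.ext (by simpa using h) ?_)
    simpa using h3

/-- A point with positive real part is at distance at least its modulus from the negative axis. -/
theorem mem_slitPlane_of_dist_le {u v : ℂ} (hu : 0 < u.re) (h : dist v u ≤ ‖u‖ / 2) :
    v ∈ Complex.slitPlane := by
  rw [Complex.mem_slitPlane_iff]
  by_contra! hv
  have h1 : ‖u‖ ≤ ‖u - v‖ := by
    rw [Complex.norm_def, Complex.norm_def]
    refine Real.sqrt_le_sqrt ?_
    rw [Complex.normSq_apply, Complex.normSq_apply, Complex.sub_re, Complex.sub_im, hv.2]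
    nlinarith [hv.1]
  have h2 : 0 < ‖u‖ := norm_pos_iff.mpr fun h0 => by simp [h0] at hu
  rw [dist_comm, dist_eq_norm] at h
  linarith

/-- Cauchy's estimate on the circle of radius `‖u‖ / 2` around `z`: the bound `(3/2 ‖u‖)^D` divided
by `(‖u‖ / 2)^D` is the constant `3^D`. -/
theorem tameAt_of_norm_le {φ : ℂ → ℂ} {D : ℕ} {ζ : ℂ} {C : ℝ} (hζ : ‖ζ‖ = 1)
    (h : ∀ᶠ v in 𝓝[Complex.slitPlane] 0, AnalyticAt ℂ φ v ∧ ‖φ v‖ ≤ C * ‖v‖ ^ D) :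
    TameAt D (fun z => φ (1 - z / ζ)) ζ := by
  obtain ⟨ε, hε, hφ⟩ := Metric.mem_nhdsWithin_iff.mp h
  have hζ0 : ζ ≠ 0 := norm_pos_iff.mp (hζ ▸ one_pos)
  refine ⟨D.factorial * (|C| * 3 ^ D), ?_⟩
  filter_upwards [self_mem_nhdsWithin,
    mem_nhdsWithin_of_mem_nhds (Metric.ball_mem_nhds ζ (half_pos hε))] with z hz1 hz2
  rw [mem_ball_zero_iff] at hz1
  set u := 1 - z / ζ with hu
  have hzζ : ‖z / ζ‖ < 1 := by rwa [norm_div, hζ, div_one]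
  have hure : 0 < u.re := by
    have := (Complex.re_le_norm (z / ζ)).trans_lt hzζ
    rw [hu, Complex.sub_re, Complex.one_re]
    linarith
  have hu0 : 0 < ‖u‖ := norm_pos_iff.mpr fun h0 => by simp [h0] at hure
  have hdist : ∀ x y : ℂ, dist (1 - x / ζ) (1 - y / ζ) = dist x y := by
    intro x y
    rw [dist_sub_left, dist_eq_norm, dist_eq_norm, ← sub_div, norm_div, hζ, div_one]
  have huz : ‖u‖ = dist z ζ := by
    rw [← hdist z ζ, div_self hζ0, sub_self, dist_zero_right]
  have huε : ‖u‖ < ε / 2 := by rw [huz]; exact hz2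
  have hkey : ∀ x ∈ Metric.closedBall z (‖u‖ / 2), AnalyticAt ℂ (fun z => φ (1 - z / ζ)) x ∧
      ‖φ (1 - x / ζ)‖ ≤ |C| * (3 / 2 * ‖u‖) ^ D := by
    intro x hx
    rw [Metric.mem_closedBall, ← hdist] at hx
    have h1 : ‖1 - x / ζ‖ ≤ 3 / 2 * ‖u‖ := by
      have := dist_triangle (1 - x / ζ) u 0
      rw [dist_zero_right, dist_zero_right] at this
      linarith
    have h2 := hφ ⟨by rw [mem_ball_zero_iff]; linarith, mem_slitPlane_of_dist_le hure hx⟩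
    constructor
    · refine AnalyticAt.fun_comp h2.1 ?_
      exact analyticAt_const.sub (analyticAt_id.div_const)
    · refine h2.2.trans ?_
      gcongr
      exact le_abs_self C
  refine ⟨(hkey z (Metric.mem_closedBall_self (by positivity))).1, ?_⟩
  have h3 := Complex.norm_iteratedDeriv_le_of_forall_mem_sphere_norm_le D (half_pos hu0)
    (DifferentiableOn.diffContOnCl (by
      rw [closure_ball _ (half_pos hu0).ne']
      exact fun x hx => (hkey x hx).1.differentiableAt.differentiableWithinAt))
    (fun x hx => (hkey x (Metric.sphere_subset_closedBall hx)).2)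
  refine h3.trans (le_of_eq ?_)
  rw [show (3 / 2 * ‖u‖) ^ D = 3 ^ D * (‖u‖ / 2) ^ D by rw [← mul_pow]; congr 1; ring]
  have : (‖u‖ / 2) ^ D ≠ 0 := (pow_pos (half_pos hu0) D).ne'
  field_simp

theorem tameAt_logPower_mul {s : ℝ} {D : ℕ} (hs : D < s) (k : ℕ) {N : ℕ} (hN : 0 < N)
    {Q : ℂ → ℂ} (hQ : AnalyticAt ℂ Q 0) {ζ : ℂ} (hζ : ‖ζ‖ = 1) :
    TameAt D (fun z => logPower s k (1 - z / ζ) *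
      Q (Complex.exp (Complex.log (1 - z / ζ) / N))) ζ := by
  obtain ⟨C, hC⟩ := norm_logPower_le hs k
  have hle : 𝓝[Complex.slitPlane] (0 : ℂ) ≤ 𝓝[≠] 0 := nhdsWithin_mono _ fun v hv =>
    Complex.slitPlane_ne_zero hv
  have hexp := (tendsto_exp_log_div hN).mono_left hle
  refine tameAt_of_norm_le (φ := fun v => logPower s k v * Q (Complex.exp (Complex.log v / N)))
    (C := C * (‖Q 0‖ + 1)) hζ ?_
  filter_upwards [self_mem_nhdsWithin, hexp.eventually hQ.eventually_analyticAt,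
    hexp.eventually (hQ.continuousAt.norm.eventually (Iio_mem_nhds (lt_add_one _))),
    mem_nhdsWithin_of_mem_nhds (Metric.ball_mem_nhds (0 : ℂ) one_pos)] with v hv h1 h2 h3
  rw [mem_ball_zero_iff] at h3
  have h4 := hC v (Complex.slitPlane_ne_zero hv) h3.le
  refine ⟨(analyticAt_logPower s k hv).mul
    (AnalyticAt.fun_comp h1 ((analyticAt_clog hv).div_const).cexp), ?_⟩
  rw [norm_mul]
  calc _ ≤ C * ‖v‖ ^ D * (‖Q 0‖ + 1) := by
        refine mul_le_mul h4 (le_of_lt h2) (norm_nonneg _) ((norm_nonneg _).trans h4)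
    _ = _ := by ring

theorem AnalyticAt.exists_taylor {H : ℂ → ℂ} (hH : AnalyticAt ℂ H 0) :
    ∃ (β : ℕ → ℂ) (Q : ℕ → ℂ → ℂ), (∀ J, AnalyticAt ℂ (Q J) 0) ∧
      (∀ J y, H y = ∑ j ∈ Finset.range J, β j * y ^ j + y ^ J * Q J y) ∧
      ∀ᶠ y in 𝓝 0, HasSum (fun j => β j * y ^ j) (H y) := by
  obtain ⟨p, hp⟩ := hH
  have hq := fun J => HasFPowerSeriesAt.has_fpower_series_iterate_dslope_fslope J hp
  have h0 : ∀ J, ((Function.swap dslope 0)^[J] H) 0 = p.coeff J := fun J => by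
    rw [← (hq J).coeff_zero 0]
    have := FormalMultilinearSeries.coeff_iterate_fslope (p := p) J 0
    rw [zero_add] at this
    rw [← this]
    exact congrArg _ (Subsingleton.elim _ _)
  refine ⟨fun j => p.coeff j, fun J => (Function.swap dslope 0)^[J] H,
    fun J => (hq J).analyticAt, fun J y => ?_, ?_⟩
  · induction J with
    | zero => simp
    | succ J ih =>
      beta_reduce at ih ⊢
      rw [ih, Finset.sum_range_succ, Function.iterate_succ_apply', ← h0 J, pow_succ]
      have h1 := sub_smul_dslope ((Function.swap dslope 0)^[J] H) 0 y
      rw [sub_zero, smul_eq_mul] at h1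
      simp only [Function.swap] at h1 ⊢
      linear_combination -(y ^ J) * h1
  · rw [hasFPowerSeriesAt_iff] at hp
    filter_upwards [hp] with y hy
    rw [zero_add] at hy
    refine hy.congr_fun fun n => ?_
    rw [smul_eq_mul, mul_comm]

end Singularities

/-! ### Darboux's method -/

section DarbouxExpansion

open Asymptotics

theorem logPower_mul_exp_pow (M N k j : ℕ) (u : ℂ) :
    Complex.log u ^ k * (Complex.exp (-(M / N) * Complex.log u) *
      Complex.exp (Complex.log u / N) ^ j) = logPower ((j - M) / N) k u := by
  rw [logPower, ← Complex.exp_nat_mul, ← Complex.exp_add]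
  congr 2
  push_cast
  ring

theorem analyticAt_logPower_one_sub_div (s : ℝ) (k : ℕ) {ζ p : ℂ} (hζ : ‖ζ‖ = 1)
    (hp : ‖p‖ ≤ 1) (hne : p ≠ ζ) : AnalyticAt ℂ (fun z => logPower s k (1 - z / ζ)) p := by
  have hζ0 : ζ ≠ 0 := norm_pos_iff.mp (hζ ▸ one_pos)
  refine AnalyticAt.fun_comp (analyticAt_logPower s k (mem_slitPlane_one_sub ?_ ?_))
    (analyticAt_const.sub (analyticAt_id.div_const))
  · rwa [norm_div, hζ, div_one]
  · rw [Ne, div_eq_one_iff_eq hζ0]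
    exact hne

theorem hasSum_logPower_one_sub_div (s : ℝ) (k : ℕ) {ζ z : ℂ} (hζ : ‖ζ‖ = 1)
    (hz : z ∈ Metric.ball (0 : ℂ) 1) :
    HasSum (fun n => logCoeff s k n * ζ⁻¹ ^ n * z ^ n) (logPower s k (1 - z / ζ)) := by
  have h : z / ζ ∈ Metric.ball (0 : ℂ) 1 := by
    rw [mem_ball_zero_iff] at hz ⊢
    rwa [norm_div, hζ, div_one]
  refine (hasSum_logCoeff s k h).congr_fun fun n => ?_
  rw [div_pow, inv_pow]
  ring

/-- A Puiseux series with only integral powers of `u` is analytic. -/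
theorem analyticAt_of_puiseux_support {β : ℕ → ℂ} {H : ℂ → ℂ} {M N : ℕ} (hN : 0 < N)
    (hH : ∀ᶠ y in 𝓝 0, HasSum (fun j => β j * y ^ j) (H y))
    (hβ : ∀ j, (∃ i : ℕ, j = M + N * i) ∨ β j = 0) :
    ∃ h : ℂ → ℂ, AnalyticAt ℂ h 0 ∧ ∀ᶠ y in 𝓝 0, H y = y ^ M * h (y ^ N) := by
  obtain ⟨r, hr, hS⟩ := Metric.eventually_nhds_iff_ball.mp hH
  have hinj : Function.Injective fun i : ℕ => M + N * i := fun i j hij => by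
    have h1 : N * i = N * j := Nat.add_left_cancel hij
    exact Nat.eq_of_mul_eq_mul_left hN h1
  have hS' : ∀ y ∈ Metric.ball (0 : ℂ) r,
      HasSum (fun i => y ^ M * (β (M + N * i) * (y ^ N) ^ i)) (H y) := by
    intro y hy
    refine ((hinj.hasSum_iff ?_).mpr (hS y hy)).congr_fun fun i => ?_
    · intro j hj
      rcases hβ j with ⟨i, hi⟩ | h
      · exact absurd ⟨i, hi.symm⟩ hj
      · rw [h, zero_mul]
    · rw [Function.comp_apply, pow_add, pow_mul]
      ring
  have hsum : ∀ t ∈ Metric.ball (0 : ℂ) (r ^ N), Summable fun i => β (M + N * i) * t ^ i := by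
    intro t ht
    rcases eq_or_ne t 0 with rfl | ht0
    · refine summable_of_ne_finset_zero (s := {0}) fun i hi => ?_
      rw [zero_pow (by simpa using hi), mul_zero]
    · obtain ⟨y, hy⟩ := IsAlgClosed.exists_pow_nat_eq t hN
      have hyr : y ∈ Metric.ball (0 : ℂ) r := by
        rw [mem_ball_zero_iff] at ht ⊢
        rw [← hy, norm_pow] at ht
        exact lt_of_pow_lt_pow_left₀ N hr.le ht
      have hy0 : y ^ M ≠ 0 := pow_ne_zero _ fun h => ht0 (by rw [← hy, h, zero_pow hN.ne'])
      have h1 := (hS' y hyr).summable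
      rw [summable_mul_left_iff hy0, hy] at h1
      exact h1
  refine ⟨fun t => ∑' i, β (M + N * i) * t ^ i, ?_, ?_⟩
  · exact analyticOnNhd_of_hasSum (pow_pos hr N) (fun t ht => (hsum t ht).hasSum) 0
      (Metric.mem_ball_self (pow_pos hr N))
  · filter_upwards [Metric.ball_mem_nhds (0 : ℂ) hr] with y hy
    rw [← tsum_mul_left]
    exact (hS' y hy).tsum_eq.symm

/-- The numbers `β ζ k j` are the Taylor coefficients of `H ζ k`. The last clause identifies the
only local terms invisible in the asymptotics: integral powers of `u` without logarithm, whose sum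
is analytic. -/
theorem exists_darboux_expansion {b : ℕ → ℂ} {g : ℂ → ℂ}
    (hg : ∀ z ∈ Metric.ball (0 : ℂ) 1, HasSum (fun n => b n * z ^ n) (g z)) {Z : Finset ℂ}
    (hZ : ∀ ζ ∈ Z, ‖ζ‖ = 1)
    (hext : ∀ p ∈ Metric.sphere (0 : ℂ) 1, p ∉ Z → ∃ h : ℂ → ℂ, AnalyticAt ℂ h p ∧
      ∀ᶠ z in 𝓝[Metric.ball 0 1] p, g z = h z)
    {N M m : ℕ} (hN : 0 < N) {H : ℂ → ℕ → ℂ → ℂ} (hH : ∀ ζ ∈ Z, ∀ k, AnalyticAt ℂ (H ζ k) 0)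
    (hgH : ∀ ζ ∈ Z, ∀ᶠ z in 𝓝[Metric.ball 0 1] ζ, g z = ∑ k ∈ Finset.range m,
      Complex.log (1 - z / ζ) ^ k * (Complex.exp (-(M / N) * Complex.log (1 - z / ζ)) *
        H ζ k (Complex.exp (Complex.log (1 - z / ζ) / N)))) :
    ∃ β : ℂ → ℕ → ℕ → ℂ,
      (∀ J D : ℕ, (D : ℝ) < (J - M) / N →
        (fun n : ℕ => b n - ∑ ζ ∈ Z, ∑ k ∈ Finset.range m, ∑ j ∈ Finset.range J,
          β ζ k j * (logCoeff ((j - M) / N) k n * ζ⁻¹ ^ n)) =O[atTop] fun n => ((n : ℝ) ^ D)⁻¹) ∧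
      ∀ ζ ∈ Z, (∀ k < m, ∀ j : ℕ, (k = 0 ∧ ∃ i : ℕ, ((j : ℝ) - M) / N = i) ∨ β ζ k j = 0) →
        ∃ h : ℂ → ℂ, AnalyticAt ℂ h ζ ∧ ∀ᶠ z in 𝓝[Metric.ball 0 1] ζ, g z = h z := by
  have hT : ∀ ζ ∈ Z, ∀ k, ∃ (β : ℕ → ℂ) (Q : ℕ → ℂ → ℂ), (∀ J, AnalyticAt ℂ (Q J) 0) ∧
      (∀ J y, H ζ k y = ∑ j ∈ Finset.range J, β j * y ^ j + y ^ J * Q J y) ∧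
      ∀ᶠ y in 𝓝 0, HasSum (fun j => β j * y ^ j) (H ζ k y) :=
    fun ζ hζ k => (hH ζ hζ k).exists_taylor
  choose! β Q hQ hβQ hβ using hT
  have hgA := analyticOnNhd_of_hasSum one_pos hg
  refine ⟨β, fun J D hD => ?_, fun ζ hζ hz => ?_⟩
  · set S : ℂ → ℂ → ℂ := fun ζ z => ∑ k ∈ Finset.range m, ∑ j ∈ Finset.range J,
      β ζ k j * logPower ((j - M) / N) k (1 - z / ζ) with hS
    have hSA : ∀ ζ ∈ Z, ∀ p : ℂ, ‖p‖ ≤ 1 → p ≠ ζ → AnalyticAt ℂ (fun z => -S ζ z) p := by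
      intro ζ hζ p hp hne
      refine AnalyticAt.fun_neg ?_
      simp only [hS]
      exact Finset.analyticAt_fun_sum _ fun k _ => Finset.analyticAt_fun_sum _ fun j _ =>
        analyticAt_const.mul (analyticAt_logPower_one_sub_div _ k (hZ ζ hζ) hp hne)
    have hSsum : ∀ ζ ∈ Z, ∀ z ∈ Metric.ball (0 : ℂ) 1,
        HasSum (fun n => (∑ k ∈ Finset.range m, ∑ j ∈ Finset.range J,
          β ζ k j * (logCoeff ((j - M) / N) k n * ζ⁻¹ ^ n)) * z ^ n) (S ζ z) := by
      intro ζ hζ z hz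
      simp only [hS, Finset.sum_mul]
      refine hasSum_sum fun k _ => hasSum_sum fun j _ => ?_
      refine ((hasSum_logPower_one_sub_div _ k (hZ ζ hζ) hz).mul_left (β ζ k j)).congr_fun
        fun n => ?_
      ring
    have hf : ∀ z ∈ Metric.ball (0 : ℂ) 1, HasSum (fun n => (b n - ∑ ζ ∈ Z,
        ∑ k ∈ Finset.range m, ∑ j ∈ Finset.range J,
          β ζ k j * (logCoeff ((j - M) / N) k n * ζ⁻¹ ^ n)) * z ^ n)
        (g z + ∑ ζ ∈ Z, -S ζ z) := by
      intro z hz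
      rw [Finset.sum_neg_distrib, ← sub_eq_add_neg]
      refine ((hg z hz).sub (hasSum_sum fun ζ hζ => hSsum ζ hζ z hz)).congr_fun fun n => ?_
      rw [sub_mul, Finset.sum_mul]
    have htame : ∀ p ∈ Metric.closedBall (0 : ℂ) 1, TameAt D (fun z => g z + ∑ ζ ∈ Z, -S ζ z) p := by
      intro p hp
      have hp1 : ‖p‖ ≤ 1 := by simpa using hp
      by_cases hpZ : p ∈ Z
      · have h1 : TameAt D (fun z => g z + -S p z) p := by
          refine TameAt.congr (f := fun z => ∑ k ∈ Finset.range m,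
            logPower ((J - M) / N) k (1 - z / p) *
              Q p k J (Complex.exp (Complex.log (1 - z / p) / N)))
            (TameAt.sum _ fun k _ => tameAt_logPower_mul hD k hN (hQ p hpZ k J) (hZ p hpZ)) ?_
          filter_upwards [hgH p hpZ] with z hz
          rw [hz, ← sub_eq_add_neg]
          simp only [hS]
          rw [← Finset.sum_sub_distrib]
          refine Finset.sum_congr rfl fun k _ => ?_
          rw [hβQ p hpZ k J, mul_add, mul_add, Finset.mul_sum, Finset.mul_sum, eq_sub_iff_add_eq,
            add_comm]
          congr 1
          · refine Finset.sum_congr rfl fun j _ => ?_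
            rw [← logPower_mul_exp_pow]
            ring
          · rw [← logPower_mul_exp_pow]
            ring
        refine TameAt.congr (h1.add (TameAt.sum (Z.erase p) fun ζ hζ =>
          (hSA ζ (Finset.mem_of_mem_erase hζ) p hp1
            (Finset.ne_of_mem_erase hζ).symm).tameAt D)) (Eventually.of_forall fun z => ?_)
        rw [← Finset.add_sum_erase Z _ hpZ, add_assoc]
      · have h2 : TameAt D (fun z => ∑ ζ ∈ Z, -S ζ z) p := TameAt.sum Z fun ζ hζ =>
          (hSA ζ hζ p hp1 fun h => hpZ (h ▸ hζ)).tameAt D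
        refine TameAt.add ?_ h2
        rcases hp1.lt_or_eq with h | h
        · exact (hgA p (by simpa using h)).tameAt D
        · obtain ⟨k, hk, hgk⟩ := hext p (by simpa using h) hpZ
          exact (hk.tameAt D).congr (hgk.mono fun z hz => hz.symm)
    obtain ⟨C, hC⟩ := exists_bound_of_tameAt htame
    exact isBigO_coeff_of_iteratedDeriv_bounded hf hC
  · have hζ0 : ζ ≠ 0 := norm_pos_iff.mp (hZ ζ hζ ▸ one_pos)
    have hN0 : (N : ℂ) ≠ 0 := by exact_mod_cast hN.ne'
    have hk0 : ∀ k ∈ Finset.range m, k ≠ 0 → ∀ᶠ y in 𝓝 0, H ζ k y = 0 := by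
      intro k hk hk0
      filter_upwards [hβ ζ hζ k] with y hy
      refine hy.unique ?_
      have : (fun j => β ζ k j * y ^ j) = fun _ => (0 : ℂ) := funext fun j => by
        rcases hz k (Finset.mem_range.mp hk) j with h | h
        · exact absurd h.1 hk0
        · rw [h, zero_mul]
      rw [this]
      exact hasSum_zero
    have hexp : Tendsto (fun z => Complex.exp (Complex.log (1 - z / ζ) / N))
        (𝓝[Metric.ball 0 1] ζ) (𝓝 0) := by
      refine (tendsto_exp_log_div hN).comp (tendsto_nhdsWithin_iff.mpr ⟨?_, ?_⟩)
      · have : ContinuousAt (fun z : ℂ => 1 - z / ζ) ζ := by fun_prop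
        have h1 := this.tendsto
        rw [div_self hζ0, sub_self] at h1
        exact h1.mono_left nhdsWithin_le_nhds
      · filter_upwards [self_mem_nhdsWithin] with z hz1 h2
        rw [Set.mem_singleton_iff, sub_eq_zero, eq_comm, div_eq_one_iff_eq hζ0] at h2
        rw [h2, mem_ball_zero_iff, hZ ζ hζ] at hz1
        exact lt_irrefl _ hz1
    have hall := (Finset.eventually_all (Finset.range m)).mpr fun k hk =>
      hexp.eventually (p := fun y => k ≠ 0 → H ζ k y = 0) (by
        by_cases h : k = 0
        · simp [h]
        · filter_upwards [hk0 k hk h] with y hy _ using hy)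
    rcases Nat.eq_zero_or_pos m with rfl | hm
    · exact ⟨0, analyticAt_const, (hgH ζ hζ).mono fun z hz => by simpa using hz⟩
    · obtain ⟨h, hh, hHh⟩ := analyticAt_of_puiseux_support (M := M) hN (hβ ζ hζ 0) fun j => by
        rcases hz 0 hm j with ⟨-, i, hi⟩ | h
        · left
          refine ⟨i, ?_⟩
          have hN' : (N : ℝ) ≠ 0 := by exact_mod_cast hN.ne'
          rw [div_eq_iff hN'] at hi
          have : (j : ℝ) = M + N * i := by linarith
          exact_mod_cast this
        · exact Or.inr h
      -- With `y = exp (log u / N)` one has `H y = y^M h (y^N)`; the factor `y^M` cancels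
      -- `u^(-M/N)`, and `y^N = u`.
      refine ⟨fun z => h (1 - z / ζ), ?_, ?_⟩
      · refine AnalyticAt.fun_comp ?_ (analyticAt_const.sub (analyticAt_id.div_const))
        simpa [hζ0] using hh
      · filter_upwards [hgH ζ hζ, hall, hexp.eventually hHh, self_mem_nhdsWithin]
          with z h1 h2 h3 hz1
        have hu : 1 - z / ζ ≠ 0 := fun h4 => by
          rw [sub_eq_zero, eq_comm, div_eq_one_iff_eq hζ0] at h4
          rw [h4, mem_ball_zero_iff, hZ ζ hζ] at hz1
          exact lt_irrefl _ hz1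
        rw [h1, Finset.sum_eq_single_of_mem 0 (Finset.mem_range.mpr hm) fun k hk hk0 => by
          rw [h2 k hk hk0, mul_zero, mul_zero], h3, ← Complex.exp_nat_mul _ N, mul_div_cancel₀ _ hN0,
          Complex.exp_log hu, pow_zero, one_mul, ← mul_assoc, ← Complex.exp_nat_mul,
          ← Complex.exp_add]
        have : -((M : ℂ) / N) * Complex.log (1 - z / ζ) + M * (Complex.log (1 - z / ζ) / N) = 0 := by
          ring
        rw [this, Complex.exp_zero, one_mul]

end DarbouxExpansion

/-! ### Expansions along an arithmetic progression of exponents -/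

section Grid

open Asymptotics

theorem isBigO_nilssonMonomial (α : ℚ) {l l' : ℕ} (h : l' ≤ l) :
    nilssonMonomial (α, l') =O[atTop] nilssonMonomial (α, l) := by
  refine IsBigO.of_bound 1 ?_
  have h1 := (Real.tendsto_log_atTop.comp tendsto_natCast_atTop_atTop).eventually_ge_atTop (1 : ℝ)
  filter_upwards [h1] with n hn
  have hn' : 1 ≤ Real.log n := hn
  have hn0 : 0 ≤ Real.log n := zero_le_one.trans hn'
  rw [one_mul, nilssonMonomial, nilssonMonomial, Real.norm_of_nonneg (by positivity),
    Real.norm_of_nonneg (by positivity)]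
  gcongr

theorem isLittleO_nilssonMonomial {α α' : ℚ} {l l' : ℕ} (h : α < α' ∨ α = α' ∧ l' < l) :
    nilssonMonomial (α', l') =o[atTop] nilssonMonomial (α, l) := by
  rcases h with h | ⟨rfl, h⟩
  · refine IsLittleO.trans_isBigO ?_ (isBigO_nilssonMonomial α (Nat.zero_le l))
    have hε : (0 : ℝ) < (α' : ℝ) - α := by
      have : (α : ℝ) < α' := by exact_mod_cast h
      linarith
    have h1 := (isLittleO_log_rpow_rpow_atTop (l' : ℝ) hε).comp_tendsto
      (tendsto_natCast_atTop_atTop (R := ℝ))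
    have h2 := h1.mul_isBigO (isBigO_refl (fun n : ℕ => ((n : ℝ) ^ (α' : ℝ))⁻¹) atTop)
    refine h2.congr' (Eventually.of_forall fun n => ?_) ?_
    · simp only [Function.comp_apply, nilssonMonomial, Real.rpow_natCast]
      rfl
    · filter_upwards [eventually_gt_atTop 0] with n hn
      have hn' : (0 : ℝ) < n := by exact_mod_cast hn
      simp only [Function.comp_apply, nilssonMonomial, pow_zero]
      rw [Real.rpow_sub hn']
      have := (Real.rpow_pos_of_pos hn' (α' : ℝ)).ne'
      have := (Real.rpow_pos_of_pos hn' (α : ℝ)).ne'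
      field_simp
  · have h1 : (fun _ : ℕ => (1 : ℝ)) =o[atTop] fun n : ℕ => Real.log n ^ (l - l') := by
      rw [isLittleO_one_left_iff]
      refine tendsto_norm_atTop_atTop.comp ((tendsto_pow_atTop (by omega)).comp ?_)
      exact Real.tendsto_log_atTop.comp tendsto_natCast_atTop_atTop
    have h2 := (isBigO_refl (fun n : ℕ => nilssonMonomial (α, l') n) atTop).mul_isLittleO h1
    refine h2.congr (fun n => mul_one _) fun n => ?_
    simp only [nilssonMonomial]
    rw [div_mul_eq_mul_div, ← pow_add]
    congr 2
    omega

theorem isBigO_nilssonMonomial_of_le {α α' : ℚ} {l l' : ℕ} (hα : α ≤ α') (hl : l' ≤ l) :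
    nilssonMonomial (α', l') =O[atTop] nilssonMonomial (α, l) := by
  rcases hα.lt_or_eq with h | rfl
  · exact (isLittleO_nilssonMonomial (Or.inl h)).isBigO
  · exact isBigO_nilssonMonomial α hl

/-- The `q`-th exponent in the expansion of the coefficients of a function whose singularities
are Puiseux series in `u ^ (1 / N)`, starting with `u ^ (- M / N)`. -/
def puiseuxExponent (N M q : ℕ) : ℚ := ((q : ℚ) - M) / N + 1

theorem puiseuxExponent_add_mul {N : ℕ} (hN : 0 < N) (M j i : ℕ) :
    puiseuxExponent N M (j + i * N) = puiseuxExponent N M j + i := by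
  have : (N : ℚ) ≠ 0 := by exact_mod_cast hN.ne'
  rw [puiseuxExponent, puiseuxExponent]
  push_cast
  field_simp
  ring

theorem puiseuxExponent_strictMono {N : ℕ} (hN : 0 < N) (M : ℕ) :
    StrictMono (puiseuxExponent N M) := fun p q h => by
  have hN' : (0 : ℚ) < N := by exact_mod_cast hN
  have h' : (p : ℚ) < q := by exact_mod_cast h
  rw [puiseuxExponent, puiseuxExponent]
  gcongr

/-- The exponents `s + 1 + i` are placed on the common grid, at the indices `q = j + i N`, and `d`
pads the logarithmic degree, so that expansions for different `j` and `k` can be added. -/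
theorem exists_logCoeff_grid_expansion {N : ℕ} (hN : 0 < N) (M j k : ℕ) {d : ℕ} (hk : k ≤ d) :
    ∃ ε : ℕ → ℕ → ℂ,
      (∀ Q : ℕ, (fun n : ℕ => logCoeff (((j : ℝ) - M) / N) k n -
        ∑ q ∈ Finset.range Q, ∑ l ∈ Finset.range (d + 1),
          ε q l * (nilssonMonomial (puiseuxExponent N M q, l) n : ℂ)) =O[atTop]
            nilssonMonomial (puiseuxExponent N M Q, d)) ∧
      (∀ q l, q < j → ε q l = 0) ∧ (∀ q l, k < l → ε q l = 0) ∧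
      ((∀ i : ℕ, ((j : ℝ) - M) / N ≠ i) → ε j k ≠ 0) ∧
      ((∃ i : ℕ, ((j : ℝ) - M) / N = i) → ε j k = 0 ∧ (1 ≤ k → ε j (k - 1) ≠ 0) ∧
        (k = 0 → ∀ q l, ε q l = 0)) := by
  set s : ℝ := ((j : ℝ) - M) / N with hs
  obtain ⟨e, he, he0, he1, he2⟩ := exists_logCoeff_expansion s k
  have hexp : ∀ i : ℕ, ((puiseuxExponent N M (j + i * N) : ℚ) : ℝ) = s + 1 + i := fun i => by
    rw [puiseuxExponent_add_mul hN, puiseuxExponent]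
    push_cast
    rw [hs]
  have hj : ∀ l, (if j ≤ j ∧ N ∣ j - j then e ((j - j) / N) l else 0) = e 0 l := by simp
  refine ⟨fun q l => if j ≤ q ∧ N ∣ q - j then e ((q - j) / N) l else 0, fun Q => ?_,
    fun q l h => if_neg fun h' => absurd h'.1 (by omega), fun q l h => ?_, fun h => ?_, fun h => ?_⟩
  · set I : ℕ := (Q - j + (N - 1)) / N with hI
    have hlt : ∀ i, i < I ↔ j + i * N < Q := by
      intro i
      rw [hI, ← Nat.succ_le_iff, Nat.le_div_iff_mul_le hN, Nat.succ_mul]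
      constructor <;> intro h
      · by_contra h'
        have : Q - j ≤ i * N := by omega
        omega
      · omega
    have hsum : ∀ n : ℕ, ∑ q ∈ Finset.range Q, ∑ l ∈ Finset.range (d + 1),
        (if j ≤ q ∧ N ∣ q - j then e ((q - j) / N) l else 0) *
          (nilssonMonomial (puiseuxExponent N M q, l) n : ℂ) =
        ∑ i ∈ Finset.range I, ∑ l ∈ Finset.range (k + 1),
          e i l * ((Real.log n ^ l / (n : ℝ) ^ (s + 1 + i) : ℝ) : ℂ) := by
      intro n
      symm
      refine Finset.sum_of_injOn (fun i => j + i * N) ?_ ?_ ?_ ?_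
      · intro a _ c _ hac
        have h1 : a * N = c * N := Nat.add_left_cancel hac
        exact Nat.eq_of_mul_eq_mul_right hN h1
      · intro i hi
        simp only [Finset.coe_range, Set.mem_Iio] at hi ⊢
        exact (hlt i).mp hi
      · intro q hq hq'
        refine Finset.sum_eq_zero fun l _ => ?_
        rw [if_neg, zero_mul]
        rintro ⟨h1, i, hi⟩
        refine hq' ⟨i, ?_, ?_⟩
        · simp only [Finset.coe_range, Set.mem_Iio]
          rw [hlt, mul_comm, ← hi]
          have := Finset.mem_range.mp hq
          omega
        · simp only
          rw [mul_comm, ← hi]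
          omega
      · intro i _
        have h1 : j ≤ j + i * N ∧ N ∣ j + i * N - j :=
          ⟨by omega, by rw [Nat.add_sub_cancel_left]; exact dvd_mul_left _ _⟩
        have h2 : (j + i * N - j) / N = i := by
          rw [Nat.add_sub_cancel_left, Nat.mul_div_cancel _ hN]
        simp only [if_pos h1, h2]
        refine Finset.sum_subset_zero_on_sdiff (Finset.range_mono (by omega)) (fun l hl => ?_)
          fun l _ => ?_
        · rw [Finset.mem_sdiff, Finset.mem_range, Finset.mem_range] at hl
          rw [he0 i l (by omega), zero_mul]
        · rw [nilssonMonomial, hexp]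
    have h1 := he I
    simp only [hsum]
    refine h1.trans ?_
    have h2 : (fun n : ℕ => Real.log n ^ k / (n : ℝ) ^ (s + 1 + I)) =
        nilssonMonomial (puiseuxExponent N M (j + I * N), k) := by
      funext n
      rw [nilssonMonomial, hexp]
    rw [h2]
    refine isBigO_nilssonMonomial_of_le ((puiseuxExponent_strictMono hN M).monotone ?_) hk
    exact not_lt.mp fun h => lt_irrefl _ ((hlt I).mpr h)
  · beta_reduce
    split_ifs
    · exact he0 _ _ h
    · rfl
  · beta_reduce
    rw [hj]
    exact he1 h
  · obtain ⟨h1, h2, h3⟩ := he2 h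
    beta_reduce
    rw [hj, hj]
    refine ⟨h1, h2, fun h q l => ?_⟩
    split_ifs
    · exact h3 h _ _
    · rfl

/-! ### From expansions on the grid to Nilsson expansions. -/

theorem exists_mem_nilssonIndex_iff {N : ℕ} (hN : 0 < N) (M d : ℕ) {ω : ℚ × ℕ} :
    ω ∈ nilssonIndex ((Finset.range N).image (puiseuxExponent N M)) d ↔
      ∃ q, ω.1 = puiseuxExponent N M q ∧ ω.2 ≤ d := by
  rw [nilssonIndex, Set.mem_ofPred_eq]
  constructor
  · rintro ⟨⟨s, hs, k, hk⟩, hd⟩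
    obtain ⟨q, -, rfl⟩ := Finset.mem_image.mp hs
    exact ⟨q + k * N, by rw [hk, puiseuxExponent_add_mul hN], hd⟩
  · rintro ⟨q, hq, hd⟩
    refine ⟨⟨_, Finset.mem_image_of_mem _ (Finset.mem_range.mpr (Nat.mod_lt q hN)), q / N, ?_⟩, hd⟩
    rw [← puiseuxExponent_add_mul hN, hq]
    congr 1
    rw [add_comm, mul_comm]
    exact (Nat.div_add_mod q N).symm

theorem floor_puiseuxExponent {N : ℕ} (hN : 0 < N) (M q : ℕ) :
    ⌊(puiseuxExponent N M q - 1) * N + M⌋₊ = q := by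
  have : (N : ℚ) ≠ 0 := by exact_mod_cast hN.ne'
  rw [puiseuxExponent, add_sub_cancel_right, div_mul_cancel₀ _ this, sub_add_cancel,
    Nat.floor_natCast]

/-- The grid expansion up to `q` includes all logarithmic powers at the last exponent. Those below
`β` are of smaller order than the monomial `(q, β)` and may be dropped. The floor recovers the grid
index from the exponent. -/
theorem hasNilssonExpansion_of_grid {b : ℕ → ℂ} {U : Finset ℂ} (hU : ∀ u ∈ U, ‖u‖ = 1) {N : ℕ}
    (hN : 0 < N) (M d : ℕ) {C : ℂ → ℕ → ℕ → ℂ}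
    (h : ∀ Q : ℕ, (fun n : ℕ => b n - ∑ u ∈ U, ∑ q ∈ Finset.range Q, ∑ l ∈ Finset.range (d + 1),
      C u q l * (nilssonMonomial (puiseuxExponent N M q, l) n : ℂ) * u ^ n) =O[atTop]
        nilssonMonomial (puiseuxExponent N M Q, d))
    (hne : ∃ u ∈ U, ∃ q, ∃ l ≤ d, C u q l ≠ 0) :
    HasNilssonExpansion b ((Finset.range N).image (puiseuxExponent N M)) d U 1
      fun ω u => C u ⌊(ω.1 - 1) * N + M⌋₊ ω.2 := by
  constructor
  · intro ω hω
    obtain ⟨q, hq, hωd⟩ := (exists_mem_nilssonIndex_iff hN M d).mp hω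
    obtain ⟨α, β⟩ := ω
    simp only at hq hωd
    subst hq
    set T : ℕ × ℕ → ℕ → ℂ := fun p n =>
      (nilssonMonomial (puiseuxExponent N M p.1, p.2) n : ℂ) * ∑ u ∈ U, C u p.1 p.2 * u ^ n with hT
    have hmono := puiseuxExponent_strictMono hN M
    set P : Finset (ℕ × ℕ) := Finset.range (q + 1) ×ˢ Finset.range (d + 1) with hP
    have h1 : ∀ n, ∑ ω' ∈ nilssonInitial ((Finset.range N).image (puiseuxExponent N M)) d
        (puiseuxExponent N M q, β), (nilssonMonomial ω' n : ℂ) *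
          ∑ u ∈ U, C u ⌊(ω'.1 - 1) * N + M⌋₊ ω'.2 * (u * ((1 : ℝ) : ℂ)⁻¹) ^ n =
        ∑ p ∈ P with (p.1 < q ∨ β ≤ p.2), T p n := by
      intro n
      symm
      refine Finset.sum_of_injOn (fun p => (puiseuxExponent N M p.1, p.2)) ?_ ?_ ?_ ?_
      · rintro ⟨a, a'⟩ _ ⟨c, c'⟩ _ hac
        simp only [Prod.mk.injEq] at hac
        exact Prod.ext (hmono.injective hac.1) hac.2
      · rintro ⟨a, a'⟩ ha
        simp only [hP, Finset.coe_filter, Finset.mem_product, Finset.mem_range,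
          Set.mem_ofPred_eq] at ha
        rw [nilssonInitial, Set.Finite.coe_toFinset, Set.mem_ofPred_eq]
        refine ⟨(exists_mem_nilssonIndex_iff hN M d).mpr ⟨a, rfl, by simp only; omega⟩, ?_⟩
        by_cases haq : a < q
        · exact Or.inl (hmono haq)
        · have : a = q := by omega
          subst this
          refine Or.inr ⟨rfl, ?_⟩
          simp only
          omega
      · rintro ω' hω' hn
        rw [nilssonInitial, Set.Finite.mem_toFinset, Set.mem_ofPred_eq] at hω'
        obtain ⟨a, ha, had⟩ := (exists_mem_nilssonIndex_iff hN M d).mp hω'.1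
        refine absurd ⟨(a, ω'.2), ?_, Prod.ext ha.symm rfl⟩ hn
        simp only [hP, Finset.coe_filter, Finset.mem_product, Finset.mem_range,
          Set.mem_ofPred_eq]
        rcases hω'.2 with h2 | h2
        · rw [ha] at h2
          have := hmono.lt_iff_lt.mp h2
          omega
        · rw [ha] at h2
          have h3 := hmono.injective h2.1
          have h4 := h2.2
          simp only at h4
          omega
      · intro p _
        simp only [hT, floor_puiseuxExponent hN, Complex.ofReal_one, inv_one, mul_one]
    have hbd : ∀ p : ℕ × ℕ, (fun n => ∑ u ∈ U, C u p.1 p.2 * u ^ n) =O[atTop]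
        fun _ : ℕ => (1 : ℝ) := by
      intro p
      refine IsBigO.of_bound (∑ u ∈ U, ‖C u p.1 p.2‖) (Eventually.of_forall fun n => ?_)
      rw [norm_one, mul_one]
      refine (norm_sum_le _ _).trans (le_of_eq (Finset.sum_congr rfl fun u hu => ?_))
      rw [norm_mul, norm_pow, hU u hu, one_pow, mul_one]
    have h2 : (fun n => b n - ∑ p ∈ P, T p n) =o[atTop]
        nilssonMonomial (puiseuxExponent N M q, β) := by
      have h3 := (h (q + 1)).trans_isLittleO (isLittleO_nilssonMonomial (l := β) (l' := d)
        (Or.inl (hmono (Nat.lt_succ_self q))))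
      refine h3.congr_left fun n => ?_
      congr 1
      rw [hP, Finset.sum_product, Finset.sum_comm]
      refine Finset.sum_congr rfl fun q' _ => ?_
      rw [Finset.sum_comm]
      refine Finset.sum_congr rfl fun l _ => ?_
      simp only [hT, Finset.mul_sum]
      exact Finset.sum_congr rfl fun u _ => by ring
    have h4 : (fun n => ∑ p ∈ P with ¬(p.1 < q ∨ β ≤ p.2), T p n) =o[atTop]
        nilssonMonomial (puiseuxExponent N M q, β) := by
      refine IsLittleO.fun_sum fun p hp => ?_
      simp only [hP, Finset.mem_filter, Finset.mem_product, Finset.mem_range] at hp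
      have hpq : p.1 = q := by omega
      have h5 : (fun n => (nilssonMonomial (puiseuxExponent N M p.1, p.2) n : ℂ)) =o[atTop]
          nilssonMonomial (puiseuxExponent N M q, β) := by
        rw [← isLittleO_norm_left]
        simp only [Complex.norm_real]
        rw [isLittleO_norm_left]
        exact isLittleO_nilssonMonomial (Or.inr ⟨by rw [hpq], by omega⟩)
      have h6 := h5.mul_isBigO (hbd p)
      simpa only [mul_one] using h6
    have h7 : (fun n => b n - ∑ p ∈ P with (p.1 < q ∨ β ≤ p.2), T p n) =o[atTop]
        fun n => (nilssonMonomial (puiseuxExponent N M q, β) n : ℂ) := by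
      have h8 := h2.add h4
      rw [← isLittleO_norm_right]
      simp only [Complex.norm_real]
      rw [isLittleO_norm_right]
      refine h8.congr_left fun n => ?_
      rw [← Finset.sum_filter_add_sum_filter_not P (fun p => p.1 < q ∨ β ≤ p.2)]
      ring
    refine h7.tendsto_div_nhds_zero.congr fun n => ?_
    rw [h1, Complex.ofReal_one, inv_one, one_pow, mul_one, mul_one_div]
  · obtain ⟨u, hu, q, l, hl, hc⟩ := hne
    refine ⟨(puiseuxExponent N M q, l), (exists_mem_nilssonIndex_iff hN M d).mpr ⟨q, rfl, hl⟩, u, hu,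
      ?_⟩
    simpa only [floor_puiseuxExponent hN] using hc

theorem IsNilssonType.mul_geometric {b : ℕ → ℂ} (h : IsNilssonType b) {r : ℝ} (hr : 0 < r) :
    IsNilssonType fun n => b n * (r : ℂ) ^ n := by
  obtain ⟨S, d, Λ, t, c, ht, hΛ, h1, ω, hω, μ, hμ, hc⟩ := h
  have hr0 : (r : ℂ) ≠ 0 := by exact_mod_cast hr.ne'
  classical
  refine ⟨S, d, Λ.image fun μ => r * μ, r * t, fun ω μ => c ω (μ / r), mul_pos hr ht, ?_, ?_,
    ω, hω, r * μ, Finset.mem_image_of_mem _ hμ, by beta_reduce; rwa [mul_div_cancel_left₀ _ hr0]⟩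
  · intro μ hμ
    obtain ⟨ν, hν, rfl⟩ := Finset.mem_image.mp hμ
    rw [norm_mul, Complex.norm_real, Real.norm_of_nonneg hr.le, hΛ ν hν]
  · intro ω hω
    refine (h1 ω hω).congr fun n => ?_
    congr 2
    · push_cast
      rw [mul_inv, mul_pow, mul_assoc, ← mul_assoc ((r : ℂ) ^ n), ← mul_pow,
        mul_inv_cancel₀ hr0, one_pow, one_mul]
    · refine Finset.sum_congr rfl fun ω' _ => ?_
      rw [Finset.sum_image fun x _ y _ hxy => mul_left_cancel₀ hr0 hxy]
      congr 1
      refine Finset.sum_congr rfl fun μ _ => ?_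
      beta_reduce
      rw [mul_div_cancel_left₀ _ hr0]
      congr 2
      push_cast
      field_simp

end Grid

/-! ### Nilsson type of coefficient sequences -/

section Transfer

open Asymptotics

/-- Insert the expansions of the model coefficients into the Darboux expansion. The coefficient at
grid index `q` involves only `j ≤ q`, so it does not depend on the truncation `J`. -/
theorem isBigO_sub_grid {b : ℕ → ℂ} {Z : Finset ℂ} (hZ : ∀ ζ ∈ Z, ‖ζ‖ = 1) {N M m : ℕ}
    (hN : 0 < N) {β : ℂ → ℕ → ℕ → ℂ} {ε : ℕ → ℕ → ℕ → ℕ → ℂ}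
    (hβ : ∀ J D : ℕ, (D : ℝ) < (J - M) / N →
      (fun n : ℕ => b n - ∑ ζ ∈ Z, ∑ k ∈ Finset.range m, ∑ j ∈ Finset.range J,
        β ζ k j * (logCoeff ((j - M) / N) k n * ζ⁻¹ ^ n)) =O[atTop] fun n => ((n : ℝ) ^ D)⁻¹)
    (hε : ∀ k < m, ∀ j Q : ℕ, (fun n : ℕ => logCoeff (((j : ℝ) - M) / N) k n -
        ∑ q ∈ Finset.range Q, ∑ l ∈ Finset.range (m + 1),
          ε k j q l * (nilssonMonomial (puiseuxExponent N M q, l) n : ℂ)) =O[atTop]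
            nilssonMonomial (puiseuxExponent N M Q, m))
    (hε0 : ∀ k < m, ∀ j q l, q < j → ε k j q l = 0) (Q : ℕ) :
    (fun n : ℕ => b n - ∑ ζ ∈ Z, ∑ q ∈ Finset.range Q, ∑ l ∈ Finset.range (m + 1),
      (∑ k ∈ Finset.range m, ∑ j ∈ Finset.range (q + 1), β ζ k j * ε k j q l) *
        (nilssonMonomial (puiseuxExponent N M q, l) n : ℂ) * ζ⁻¹ ^ n) =O[atTop]
          nilssonMonomial (puiseuxExponent N M Q, m) := by
  have hN' : (0 : ℝ) < N := by exact_mod_cast hN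
  -- `D` is taken at least as large as the grid exponent, so that `n^(-D)` is negligible; `J` then
  -- follows from `D`.
  obtain ⟨D, hD⟩ := exists_nat_ge (puiseuxExponent N M Q)
  obtain ⟨J', hJ'⟩ := exists_nat_gt ((D : ℝ) * N + M)
  set J := max J' Q with hJ
  have hJD : (D : ℝ) < (J - M) / N := by
    rw [lt_div_iff₀ hN']
    have : (J' : ℝ) ≤ J := by exact_mod_cast le_max_left _ _
    linarith
  have h1 : (fun n : ℕ => b n - ∑ ζ ∈ Z, ∑ k ∈ Finset.range m, ∑ j ∈ Finset.range J,
      β ζ k j * (logCoeff ((j - M) / N) k n * ζ⁻¹ ^ n)) =O[atTop]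
        nilssonMonomial (puiseuxExponent N M Q, m) := by
    refine (hβ J D hJD).trans ?_
    have h2 := isBigO_nilssonMonomial_of_le hD (Nat.zero_le m)
    refine h2.congr_left fun n => ?_
    simp only [nilssonMonomial, pow_zero, one_div]
    congr 1
    rw [Rat.cast_natCast, Real.rpow_natCast]
  have h3 : (fun n : ℕ => ∑ ζ ∈ Z, ∑ k ∈ Finset.range m, ∑ j ∈ Finset.range J,
      β ζ k j * ((logCoeff (((j : ℝ) - M) / N) k n - ∑ q ∈ Finset.range Q,
        ∑ l ∈ Finset.range (m + 1),
          ε k j q l * (nilssonMonomial (puiseuxExponent N M q, l) n : ℂ)) * ζ⁻¹ ^ n)) =O[atTop]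
        nilssonMonomial (puiseuxExponent N M Q, m) := by
    refine IsBigO.fun_sum fun ζ hζ => IsBigO.fun_sum fun k hk => IsBigO.fun_sum fun j _ => ?_
    refine IsBigO.const_mul_left ?_ _
    refine IsBigO.trans ?_ (hε k (Finset.mem_range.mp hk) j Q)
    refine IsBigO.of_bound 1 (Eventually.of_forall fun n => ?_)
    rw [norm_mul, norm_pow, norm_inv, hZ ζ hζ, inv_one, one_pow, mul_one, one_mul]
  refine (h1.add h3).congr_left fun n => ?_
  have h4 : ∀ ζ ∈ Z, ∑ q ∈ Finset.range Q, ∑ l ∈ Finset.range (m + 1),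
      (∑ k ∈ Finset.range m, ∑ j ∈ Finset.range (q + 1), β ζ k j * ε k j q l) *
        (nilssonMonomial (puiseuxExponent N M q, l) n : ℂ) * ζ⁻¹ ^ n =
      ∑ k ∈ Finset.range m, ∑ j ∈ Finset.range J, β ζ k j * ((∑ q ∈ Finset.range Q,
        ∑ l ∈ Finset.range (m + 1),
          ε k j q l * (nilssonMonomial (puiseuxExponent N M q, l) n : ℂ)) * ζ⁻¹ ^ n) := by
    intro ζ _
    have h5 : ∀ q ∈ Finset.range Q, ∀ l, ∑ k ∈ Finset.range m, ∑ j ∈ Finset.range (q + 1),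
        β ζ k j * ε k j q l = ∑ k ∈ Finset.range m, ∑ j ∈ Finset.range J,
          β ζ k j * ε k j q l := by
      intro q hq l
      refine Finset.sum_congr rfl fun k hk => Finset.sum_subset (Finset.range_mono ?_)
        fun j _ hj => ?_
      · have := Finset.mem_range.mp hq
        have := le_max_right J' Q
        omega
      · rw [hε0 k (Finset.mem_range.mp hk) j q l (by simpa using hj), mul_zero]
    calc _ = ∑ q ∈ Finset.range Q, ∑ l ∈ Finset.range (m + 1), ∑ k ∈ Finset.range m,
          ∑ j ∈ Finset.range J, β ζ k j * (ε k j q l *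
            (nilssonMonomial (puiseuxExponent N M q, l) n : ℂ) * ζ⁻¹ ^ n) := by
          refine Finset.sum_congr rfl fun q hq => Finset.sum_congr rfl fun l _ => ?_
          rw [h5 q hq l]
          simp only [Finset.sum_mul]
          exact Finset.sum_congr rfl fun k _ => Finset.sum_congr rfl fun j _ => by ring
      _ = ∑ k ∈ Finset.range m, ∑ q ∈ Finset.range Q, ∑ j ∈ Finset.range J,
          ∑ l ∈ Finset.range (m + 1), β ζ k j * (ε k j q l *
            (nilssonMonomial (puiseuxExponent N M q, l) n : ℂ) * ζ⁻¹ ^ n) := by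
          rw [Finset.sum_comm (s := Finset.range m)]
          refine Finset.sum_congr rfl fun q _ => ?_
          rw [Finset.sum_comm]
          exact Finset.sum_congr rfl fun k _ => Finset.sum_comm
      _ = _ := by
          refine Finset.sum_congr rfl fun k _ => ?_
          rw [Finset.sum_comm]
          simp only [Finset.sum_mul, Finset.mul_sum]
  rw [Finset.sum_congr rfl h4]
  simp only [sub_mul, mul_sub, Finset.sum_sub_distrib]
  ring

/-- Strong induction on the exponent index `j`, and for fixed `j` descent from the highest power of
the logarithm: the system is triangular, up to the shift by one at nonnegative integral exponents.
-/
theorem grid_coeff_ne_zero {Z : Finset ℂ} {N M m : ℕ} {β : ℂ → ℕ → ℕ → ℂ}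
    {ε : ℕ → ℕ → ℕ → ℕ → ℂ}
    (h1 : ∀ k < m, ∀ j q l : ℕ, k < l → ε k j q l = 0)
    (h2 : ∀ k < m, ∀ j : ℕ, (∀ i : ℕ, ((j : ℝ) - M) / N ≠ i) → ε k j j k ≠ 0)
    (h3 : ∀ k < m, ∀ j : ℕ, (∃ i : ℕ, ((j : ℝ) - M) / N = i) → ε k j j k = 0 ∧
      (1 ≤ k → ε k j j (k - 1) ≠ 0) ∧ (k = 0 → ∀ q l, ε k j q l = 0))
    (h0 : ∀ ζ ∈ Z, ∀ q, ∀ l ≤ m,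
      ∑ k ∈ Finset.range m, ∑ j ∈ Finset.range (q + 1), β ζ k j * ε k j q l = 0) :
    ∀ ζ ∈ Z, ∀ k < m, ∀ j : ℕ, (k = 0 ∧ ∃ i : ℕ, ((j : ℝ) - M) / N = i) ∨ β ζ k j = 0 := by
  intro ζ hζ k hk j
  induction j using Nat.strong_induction_on generalizing k with
  | _ j ih =>
  -- Smaller indices contribute nothing at `q = j`: their `β` vanishes, or they belong to a
  -- polynomial, for which all `ε` vanish.
  have hz : ∀ l ≤ m, ∑ k ∈ Finset.range m, β ζ k j * ε k j j l = 0 := by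
    intro l hl
    rw [← h0 ζ hζ j l hl]
    refine Finset.sum_congr rfl fun k hk => ?_
    have hk' := Finset.mem_range.mp hk
    rw [Finset.sum_range_succ, Finset.sum_eq_zero, zero_add]
    intro j' hj'
    rcases ih j' (Finset.mem_range.mp hj') k hk' with ⟨rfl, h⟩ | h
    · rw [(h3 0 hk' j' h).2.2 rfl, mul_zero]
    · rw [h, zero_mul]
  by_contra! hcon
  classical
  set B : Finset ℕ := {k ∈ Finset.range m |
    ¬((k = 0 ∧ ∃ i : ℕ, ((j : ℝ) - M) / N = i) ∨ β ζ k j = 0)} with hB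
  have hBne : B.Nonempty := ⟨k, by
    rw [hB, Finset.mem_filter]
    refine ⟨Finset.mem_range.mpr hk, ?_⟩
    rintro (⟨h, i, hi⟩ | h)
    · exact hcon.1 h i hi
    · exact hcon.2 h⟩
  -- `K` is the highest logarithmic power violating the claim at `j`.
  obtain ⟨K, hK, hmax⟩ := B.exists_max_image id hBne
  rw [hB, Finset.mem_filter, not_or] at hK
  obtain ⟨hKm, hK1, hK2⟩ := hK
  have hKm' := Finset.mem_range.mp hKm
  have hgt : ∀ k ∈ Finset.range m, K < k → β ζ k j = 0 := by
    intro k hk hKk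
    by_contra hne
    have : k ∈ B := by
      rw [hB, Finset.mem_filter]
      refine ⟨hk, ?_⟩
      rintro (⟨h, -⟩ | h)
      · omega
      · exact hne h
    exact absurd (hmax k this) (not_le.mpr hKk)
  by_cases hs : ∃ i : ℕ, ((j : ℝ) - M) / N = i
  · have hKpos : 1 ≤ K := by
      by_contra h
      exact hK1 ⟨by omega, hs⟩
    have h4 := hz (K - 1) (by omega)
    rw [Finset.sum_eq_single_of_mem K hKm] at h4
    · exact mul_ne_zero hK2 ((h3 K hKm' j hs).2.1 hKpos) h4
    · intro k hk hne
      have hk' := Finset.mem_range.mp hk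
      rcases lt_or_gt_of_ne hne with h | h
      · rcases Nat.lt_or_ge k (K - 1) with h' | h'
        · rw [h1 k hk' j j _ h', mul_zero]
        · have : K - 1 = k := by omega
          rw [this, (h3 k hk' j hs).1, mul_zero]
      · rw [hgt k hk h, zero_mul]
  · push Not at hs
    have h4 := hz K hKm'.le
    rw [Finset.sum_eq_single_of_mem K hKm] at h4
    · exact mul_ne_zero hK2 (h2 K hKm' j hs) h4
    · intro k hk hne
      rcases lt_or_gt_of_ne hne with h | h
      · rw [h1 k (Finset.mem_range.mp hk) j j K h, mul_zero]
      · rw [hgt k hk h, zero_mul]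

/-- The asymptotic bases are the inverses `ζ⁻¹`. If all coefficients were zero, `g` would extend
across the entire circle, against `hb`. -/
theorem isNilssonType_of_puiseux_log {b : ℕ → ℂ} {g : ℂ → ℂ}
    (hg : ∀ z ∈ Metric.ball (0 : ℂ) 1, HasSum (fun n => b n * z ^ n) (g z)) {Z : Finset ℂ}
    (hZ : ∀ ζ ∈ Z, ‖ζ‖ = 1)
    (hext : ∀ p ∈ Metric.sphere (0 : ℂ) 1, p ∉ Z → ∃ h : ℂ → ℂ, AnalyticAt ℂ h p ∧
      ∀ᶠ z in 𝓝[Metric.ball 0 1] p, g z = h z)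
    {N M m : ℕ} (hN : 0 < N) {H : ℂ → ℕ → ℂ → ℂ} (hH : ∀ ζ ∈ Z, ∀ k, AnalyticAt ℂ (H ζ k) 0)
    (hgH : ∀ ζ ∈ Z, ∀ᶠ z in 𝓝[Metric.ball 0 1] ζ, g z = ∑ k ∈ Finset.range m,
      Complex.log (1 - z / ζ) ^ k * (Complex.exp (-(M / N) * Complex.log (1 - z / ζ)) *
        H ζ k (Complex.exp (Complex.log (1 - z / ζ) / N))))
    (hb : ∀ r : ℝ, 1 < r → ¬ Summable fun n => b n * (r : ℂ) ^ n) : IsNilssonType b := by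
  obtain ⟨β, hβ, hβ0⟩ := exists_darboux_expansion hg hZ hext hN hH hgH
  have hε : ∀ k < m, ∀ j, _ := fun k hk j => exists_logCoeff_grid_expansion hN M j k hk.le
  choose! ε h0 hlt h1 h2 h3 using hε
  have hgrid := isBigO_sub_grid hZ hN hβ h0 hlt
  classical
  refine ⟨_, m, Z.image fun ζ => ζ⁻¹, 1, _, one_pos, ?_, hasNilssonExpansion_of_grid (N := N)
    (C := fun u q l => ∑ k ∈ Finset.range m, ∑ j ∈ Finset.range (q + 1), β u⁻¹ k j * ε k j q l)
    ?_ hN M m (fun Q => ?_) ?_⟩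
  · intro μ hμ
    obtain ⟨ζ, hζ, rfl⟩ := Finset.mem_image.mp hμ
    rw [norm_inv, hZ ζ hζ, inv_one]
  · intro μ hμ
    obtain ⟨ζ, hζ, rfl⟩ := Finset.mem_image.mp hμ
    rw [norm_inv, hZ ζ hζ, inv_one]
  · refine (hgrid Q).congr_left fun n => ?_
    rw [Finset.sum_image fun x _ y _ hxy => inv_injective hxy]
    simp only [inv_inv]
  · by_contra! hcon
    have h4 := grid_coeff_ne_zero (Z := Z) (N := N) (M := M) (β := β) h1 h2 h3
      fun ζ hζ q l hl => by
        have := hcon ζ⁻¹ (Finset.mem_image_of_mem _ hζ) q l hl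
        simpa only [inv_inv] using this
    obtain ⟨r, hr, hsum⟩ := exists_summable_of_analytic_extension hg fun p hp => by
      by_cases hpZ : p ∈ Z
      · exact hβ0 p hpZ (h4 p hpZ)
      · exact hext p hp hpZ
    exact hb r hr hsum

end Transfer

/-! ### Rescaling to the unit disk -/

section Rescaling

theorem exists_radius {a : ℕ → ℂ} {G : ℂ → ℂ} {ρ : ℝ} (hρ : 0 < ρ)
    (hG : ∀ z ∈ Metric.ball (0 : ℂ) ρ, HasSum (fun n : ℕ => a n * z ^ n) (G z))
    (hlim : 0 < limsup (fun n : ℕ => ‖a n‖ₑ ^ (1 / (n : ℝ))) atTop) :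
    ∃ (R : ℝ) (g : ℂ → ℂ), ρ ≤ R ∧
      (∀ z ∈ Metric.ball (0 : ℂ) R, HasSum (fun n : ℕ => a n * z ^ n) (g z)) ∧
      (∀ r : ℝ, R < r → ¬ Summable fun n => a n * (r : ℂ) ^ n) := by
  set p := FormalMultilinearSeries.ofScalars ℂ a with hp
  -- By Cauchy–Hadamard an infinite radius would force the limsup to be zero.
  have h1 : p.radius ≠ ⊤ := by
    intro h
    have h2 := p.radius_inv_eq_limsup
    rw [h, ENNReal.inv_top] at h2
    rw [h2] at hlim
    refine hlim.ne' (limsup_congr (Eventually.of_forall fun n => ?_))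
    rw [ENNReal.coe_rpow_of_nonneg _ (by positivity)]
    congr 1
    rw [← enorm_eq_nnnorm, ← ofReal_norm, ← ofReal_norm,
      FormalMultilinearSeries.norm_apply_eq_norm_coef, hp, FormalMultilinearSeries.coeff_ofScalars]
  have hρR : ENNReal.ofReal ρ ≤ p.radius := (hasFPowerSeriesOnBall_of_hasSum hρ hG).r_le
  refine ⟨p.radius.toReal, p.sum, (ENNReal.ofReal_le_iff_le_toReal h1).mp hρR, fun z hz => ?_,
    fun r hr hsum => ?_⟩
  · rw [← Metric.eball_ofReal, ENNReal.ofReal_toReal h1] at hz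
    refine (p.hasSum hz).congr_fun fun n => ?_
    rw [hp, FormalMultilinearSeries.ofScalars_apply_eq, smul_eq_mul]
  · have hr0 : 0 ≤ r := ENNReal.toReal_nonneg.trans hr.le
    lift r to NNReal using hr0
    have h3 := le_radius_ofScalars_of_summable hsum
    have h4 := ENNReal.toReal_mono h1 h3
    exact absurd hr (not_lt.mpr h4)

theorem tendsto_mul_nhdsWithin_ball {R : ℝ} (hR : 0 < R) (p : ℂ) :
    Tendsto (fun z : ℂ => R * z) (𝓝[Metric.ball 0 1] p) (𝓝[Metric.ball 0 R] (R * p)) := by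
  refine tendsto_nhdsWithin_iff.mpr ⟨?_, ?_⟩
  · exact ((continuous_const.mul continuous_id).tendsto p).mono_left nhdsWithin_le_nhds
  · filter_upwards [self_mem_nhdsWithin] with z hz
    rw [mem_ball_zero_iff] at hz ⊢
    rw [norm_mul, Complex.norm_real, Real.norm_of_nonneg hR.le]
    exact mul_lt_of_lt_one_right hR hz

theorem exists_isolating_radius (Λ : Finset ℂ) (p : ℂ) :
    ∃ δ > 0, ∀ q ∈ Λ, q ∈ Metric.ball p δ → q = p := by
  classical
  obtain ⟨δ, hδ, h⟩ := Metric.isOpen_iff.mp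
    ((Λ.erase p).finite_toSet.isClosed.isOpen_compl) p (by simp)
  refine ⟨δ, hδ, fun q hq hqp => ?_⟩
  by_contra hne
  exact h hqp (Finset.mem_coe.mpr (Finset.mem_erase.mpr ⟨hne, hq⟩))

/-- The order of the quantifiers lets finitely many points share `N`, then `m`, then `M`; the bound
`M₀` depends on the first two. -/
theorem exists_local_puiseux_log_expansion {G g : ℂ → ℂ} {Λ : Finset ℂ} {ρ R : ℝ} (hρ : 0 < ρ)
    (hρR : ρ ≤ R) (hext : ExtendsMultivalued Λ ρ G)
    (hmon : HasQuasiUnipotentLocalMonodromy Λ ρ G)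
    (hg : AnalyticOnNhd ℂ g (Metric.ball 0 R)) (hGg : ∀ z ∈ Metric.ball (0 : ℂ) ρ, G z = g z)
    {ζ : ℂ} (hζ : ‖ζ‖ = 1) (hζΛ : R * ζ ∈ Λ) :
    ∃ N₀ m₀ : ℕ, 0 < N₀ ∧ ∀ N, 0 < N → N₀ ∣ N → ∀ m ≥ m₀, ∃ M₀ : ℕ, ∀ M ≥ M₀,
      ∃ H : ℕ → ℂ → ℂ, (∀ k, AnalyticAt ℂ (H k) 0) ∧
        ∀ᶠ z in 𝓝[Metric.ball 0 1] ζ, g (R * z) = ∑ k ∈ Finset.range m,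
          Complex.log (1 - z / ζ) ^ k * (Complex.exp (-(M / N) * Complex.log (1 - z / ζ)) *
            H k (Complex.exp (Complex.log (1 - z / ζ) / N))) := by
  have hR : 0 < R := hρ.trans_le hρR
  have hR0 : (R : ℂ) ≠ 0 := by exact_mod_cast hR.ne'
  have hζ0 : ζ ≠ 0 := norm_pos_iff.mp (hζ ▸ one_pos)
  have hp : ‖(R : ℂ) * ζ‖ = R := by
    rw [norm_mul, hζ, mul_one, Complex.norm_real, Real.norm_of_nonneg hR.le]
  obtain ⟨δ, hδ, hδΛ⟩ := exists_isolating_radius Λ (R * ζ)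
  obtain ⟨F, hF, hgF⟩ := exists_local_branch hext hρ hρR hg hGg hp hδ hδΛ
  obtain ⟨hqu, hmg⟩ := hmon _ hζΛ δ hδ hδΛ F hF
  obtain ⟨N₀, m₀, hN₀, h⟩ :=
    exists_puiseux_log_expansion (Complex.log (-(R * ζ))) hF.1 hqu hmg
  refine ⟨N₀, m₀, hN₀, fun N hN hdvd m hm => ?_⟩
  obtain ⟨M₀, h⟩ := h N hN hdvd m hm
  refine ⟨M₀, fun M hM => ?_⟩
  obtain ⟨H, hH, x, hx⟩ := h M hM
  refine ⟨H, hH, ?_⟩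
  have hmul := tendsto_mul_nhdsWithin_ball hR ζ
  have hlog : Tendsto (fun z : ℂ => (Complex.log (1 - z / ζ)).re) (𝓝[Metric.ball 0 1] ζ) atBot := by
    simp only [Complex.log_re]
    refine Real.tendsto_log_nhdsGT_zero.comp (tendsto_norm_nhdsNE_zero.comp
      (tendsto_nhdsWithin_iff.mpr ⟨?_, ?_⟩))
    · have : ContinuousAt (fun z : ℂ => 1 - z / ζ) ζ := by fun_prop
      have h1 := this.tendsto
      rw [div_self hζ0, sub_self] at h1
      exact h1.mono_left nhdsWithin_le_nhds
    · filter_upwards [self_mem_nhdsWithin] with z hz1 h2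
      rw [Set.mem_singleton_iff, sub_eq_zero, eq_comm, div_eq_one_iff_eq hζ0] at h2
      rw [h2, mem_ball_zero_iff, hζ] at hz1
      exact lt_irrefl _ hz1
  filter_upwards [hmul.eventually self_mem_nhdsWithin,
    hmul.eventually (mem_nhdsWithin_of_mem_nhds (Metric.ball_mem_nhds _ hδ)),
    hlog.eventually (eventually_lt_atBot x)] with z h1 h2 h3
  rw [hgF _ ⟨h1, h2⟩, mul_div_mul_left _ _ hR0]
  exact hx _ h3

end Rescaling

/-! ### The theorem. -/

theorem corollary4p2 (a : ℕ → ℂ) (G : ℂ → ℂ) (Λ : Finset ℂ) (ρ : ℝ) (hρ : 0 < ρ)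
    (hG : ∀ z ∈ Metric.ball (0 : ℂ) ρ, HasSum (fun n : ℕ => a n * z ^ n) (G z))
    (hext : ExtendsMultivalued Λ ρ G)
    (hmon : HasQuasiUnipotentLocalMonodromy Λ ρ G)
    (hlim : 0 < limsup (fun n : ℕ => ‖a n‖ₑ ^ (1 / (n : ℝ))) atTop) :
    IsNilssonType a := by
  obtain ⟨R, g, hρR, hg, hR⟩ := exists_radius hρ hG hlim
  have hR0 : 0 < R := hρ.trans_le hρR
  have hRC : (R : ℂ) ≠ 0 := by exact_mod_cast hR0.ne'
  have hgA := analyticOnNhd_of_hasSum hR0 hg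
  have hGg : ∀ z ∈ Metric.ball (0 : ℂ) ρ, G z = g z := fun z hz =>
    (hG z hz).unique (hg z (Metric.ball_subset_ball hρR hz))
  have hnorm : ∀ ζ : ℂ, ‖ζ‖ = 1 → ‖(R : ℂ) * ζ‖ = R := fun ζ hζ => by
    rw [norm_mul, hζ, mul_one, Complex.norm_real, Real.norm_of_nonneg hR0.le]
  classical
  set Z : Finset ℂ := {ζ ∈ Λ.image fun p => p / R | ‖ζ‖ = 1} with hZdef
  have hZ : ∀ ζ, ζ ∈ Z ↔ ‖ζ‖ = 1 ∧ R * ζ ∈ Λ := by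
    intro ζ
    rw [hZdef, Finset.mem_filter, Finset.mem_image, and_comm]
    refine and_congr_right fun _ => ⟨?_, fun h => ⟨_, h, mul_div_cancel_left₀ _ hRC⟩⟩
    rintro ⟨p, hp, rfl⟩
    rwa [mul_div_cancel₀ _ hRC]
  have hloc : ∀ ζ ∈ Z, _ := fun ζ hζ => exists_local_puiseux_log_expansion hρ hρR hext hmon hgA hGg
    ((hZ ζ).mp hζ).1 ((hZ ζ).mp hζ).2
  choose! N₀ m₀ hN₀ hloc using hloc
  -- Common parameters for all singular points: the product of the `N₀ ζ` and the maxima of the `m₀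
  -- ζ` and `M₀ ζ`.
  have hN : 0 < ∏ ζ ∈ Z, N₀ ζ := Finset.prod_pos hN₀
  have hloc' : ∀ ζ ∈ Z, _ := fun ζ hζ => hloc ζ hζ (∏ ζ ∈ Z, N₀ ζ) hN (Finset.dvd_prod_of_mem _ hζ)
    (Z.sup m₀) (Finset.le_sup hζ)
  choose! M₀ hM₀ using hloc'
  have hloc'' : ∀ ζ ∈ Z, _ := fun ζ hζ => hM₀ ζ hζ (Z.sup M₀) (Finset.le_sup hζ)
  choose! H hH hgH using hloc''
  have key : IsNilssonType fun n => a n * (R : ℂ) ^ n := by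
    refine isNilssonType_of_puiseux_log (g := fun z => g (R * z)) (fun z hz => ?_)
      (fun ζ hζ => ((hZ ζ).mp hζ).1) (fun p hp hpZ => ?_) hN hH hgH fun r hr hsum => ?_
    · have hz' : (R : ℂ) * z ∈ Metric.ball (0 : ℂ) R := by
        rw [mem_ball_zero_iff] at hz ⊢
        rw [norm_mul, Complex.norm_real, Real.norm_of_nonneg hR0.le]
        exact mul_lt_of_lt_one_right hR0 hz
      refine (hg _ hz').congr_fun fun n => ?_
      rw [mul_pow, mul_assoc]
    · have hp1 := mem_sphere_zero_iff_norm.mp hp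
      obtain ⟨h, hh, hgh⟩ := exists_analytic_extension hext hρ hρR hgA hGg (hnorm p hp1)
        fun h => hpZ ((hZ p).mpr ⟨hp1, h⟩)
      exact ⟨fun z => h (R * z), hh.fun_comp (analyticAt_const.mul analyticAt_id),
        (tendsto_mul_nhdsWithin_ball hR0 p).eventually hgh⟩
    · refine hR (R * r) (lt_mul_of_one_lt_right hR0 hr) (hsum.congr fun n => ?_)
      push_cast
      rw [mul_pow, mul_assoc]
  have hfin := key.mul_geometric (inv_pos.mpr hR0)
  refine (funext fun n => ?_ : (fun n => a n * (R : ℂ) ^ n * ((R⁻¹ : ℝ) : ℂ) ^ n) = a) ▸ hfin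
  rw [Complex.ofReal_inv, mul_assoc, ← mul_pow, mul_inv_cancel₀ hRC, one_pow, mul_one]
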